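/- Let $k$ be a commutative ring with unit and let $\mathrm{Ch}_k$ be the category of unbounded, homologically graded chain complexes of $k$-modules, with the usual tensor product and the symmetry $x\otimes y\mapsto(-1)^{|x||y|}y\otimes x$. Let $\mathcal I$ be the category with objects $\mathbf m=\{1,\dots,m\}$, $m\ge 0$, and injective maps as morphisms, with the symmetric monoidal structure given by ordered concatenation $\sqcup$, unit $\mathbf 0$ and block permutations as symmetries. A commutative $\mathcal I$-dga is a lax symmetric monoidal functor $E\colon(\mathcal I,\sqcup,\mathbf 0)\to(\mathrm{Ch}_k,\otimes,k)$; morphisms are the monoidal natural transformations. For a functor $P\colon\mathcal I\to\mathrm{Ch}_k$, the simplicial replacement is the simplicial chain complex $$\mathrm{srep}(P)[p]=\bigoplus_{\mathbf n_0\xleftarrow{\alpha_1}\cdots\xleftarrow{\alpha_p}\mathbf n_p}P(\mathbf n_p),$$ where the last face map is induced by $P(\alpha_p)$ and all other structure maps are the identity on $P(\mathbf n_p)$ and the structure maps of the nerve of $\mathcal I$ on the indices. The homotopy colimit is $P_{h\mathcal I}=\mathrm{Tot}\,C_*(\mathrm{srep}(P))$: its module in degree $n$ is $\bigoplus_{p+q=n}\mathrm{srep}(P)[p]_q$,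 and its differential on $\mathrm{srep}(P)[p]_q$ is $\sum_{i=0}^p(-1)^id_i+(-1)^pd_P$ (where $d_P$ is the internal differential, and the first term is zero if $p=0$). Let $\widetilde\Sigma_s$ be the category with object set the symmetric group $\Sigma_s$ and exactly one morphism between any two objects. The functors $\widetilde\Sigma_s\times\widetilde\Sigma_{j_1}\times\dots\times\widetilde\Sigma_{j_s}\to\widetilde\Sigma_{j_1+\dots+j_s}$ that send $(\sigma;\tau_1,\dots,\tau_s)$ to $\sigma(j_1,\dots,j_s)\circ(\tau_1\sqcup\dots\sqcup\tau_s)$, where $\sigma(j_1,\dots,j_s)$ permutes the blocks of sizes $j_1,\dots,j_s$ as $\sigma$ permutes letters, the right multiplications by $\Sigma_s$ and the unit $\mathrm{id}\in\Sigma_1$ induce, via nerves and the shuffle maps, the structure of an operad in $\mathrm{Ch}_k$ on the chain complexes $\mathcal E_s=C_*(k\{N(\widetilde\Sigma_s)\})$ of unnormalized chains: the Barratt–Eccles operad $\mathcal E$. Then for every commutative $\mathcal I$-dga $E$ the chain complex $E_{h\mathcal I}$ has an action of the operad $\mathcal E$, which is natural with respect to morphisms of commutative $\mathcal I$-dgas.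 Explicitly, the structure map $\mathcal E_s\otimes(E_{h\mathcal I})^{\otimes s}\to E_{h\mathcal I}$ is the composite of the following maps. 1. The lax symmetric monoidal structure map of $\mathrm{Tot}\,C_*$. It sends $c\otimes y_1\otimes\dots\otimes y_s$, with $c$ a simplex of $N(\widetilde\Sigma_s)$ of dimension $r_0$ and $y_i\in\mathrm{srep}(E)[r_i]_{q_i}$, to $(-1)^{\sum_{1\le i<j\le s}q_ir_j}$ times the sum, over all $(r_0,r_1,\dots,r_s)$-shuffles, of the sign of the shuffle times the tensor product of the corresponding degeneracies of $c,y_1,\dots,y_s$. 2. The map induced by the action of simplices $(\sigma_0,\dots,\sigma_N)$ of $N(\widetilde\Sigma_s)$ on families of elements $y_i=(\alpha^i_1,\dots,\alpha^i_N;x^i)$ of $\mathrm{srep}(E)[N]$, with $x^i\in E(\mathbf n^i_N)$ homogeneous. On the indices it is given by the action of $\widetilde\Sigma_s$ on $\mathcal I$, i.e. $(\sigma;\mathbf m_1,\dots,\mathbf m_s)\mapsto\mathbf m_{\sigma^{-1}(1)}\sqcup\dots\sqcup\mathbf m_{\sigma^{-1}(s)}$ on objects, with the morphisms of $\widetilde\Sigma_s$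 acting by block permutations. On the coefficients it is given by $\pm x^{\sigma_N^{-1}(1)}\cdots x^{\sigma_N^{-1}(s)}$, with the Koszul sign of the permutation of $x^1,\dots,x^s$. -/

import Mathlib

open CategoryTheory Opposite Simplicial
open scoped DirectSum

universe u v

noncomputable section

namespace IDGA

/-! ### Chain complexes and multilinear chain maps -/

/-- Unbounded, homologically graded chain complexes of `k`-modules. -/
abbrev Ch (k : Type u) [CommRing k] := ChainComplex (ModuleCat.{v} k) ℤ

/-- The sign `(-1)^n`. -/
def sgn (n : ℤ) : ℤ := (n.negOnePow : ℤ)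

/-- The sign with which a permutation `σ`, sending the tensor factor in position `i` to position
`σ i`, acts on homogeneous elements of degrees `p i`. -/
def koszul {s : ℕ} (σ : Equiv.Perm (Fin s)) (p : Fin s → ℤ) : ℤ :=
  sgn (∑ i, ∑ j, if i < j ∧ σ j < σ i then p i * p j else 0)

theorem hom_congr {k : Type u} [CommRing k] {M N : ModuleCat.{v} k} {f g : M ⟶ N} (h : f = g)
    (x : M) : f.hom x = g.hom x := by rw [h]

/-- The graded module underlying a chain complex, as a direct sum. -/
abbrev Gr {k : Type u} [CommRing k] (X : Ch.{u, v} k) : Type v := ⨁ n : ℤ, X.X n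

namespace Gr

variable {k : Type u} [CommRing k]

/-- The inclusion of the elements of degree `n`. -/
def ι (X : Ch.{u, v} k) (n : ℤ) : X.X n →ₗ[k] Gr X :=
  DirectSum.lof k ℤ (fun n => X.X n) n

/-- The differential. -/
def d (X : Ch.{u, v} k) : Gr X →ₗ[k] Gr X :=
  DirectSum.toModule k ℤ (Gr X) fun n => ι X (n - 1) ∘ₗ (X.d n (n - 1)).hom

/-- The map of underlying graded modules of a chain map. -/
def map {X Y : Ch.{u, v} k} (f : X ⟶ Y) : Gr X →ₗ[k] Gr Y :=
  DirectSum.toModule k ℤ (Gr Y) fun n => ι Y n ∘ₗ (f.f n).hom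

end Gr

/-- `Φ` is (the map on elements of) a chain map `C ⊗ X 0 ⊗ ⋯ ⊗ X (s - 1) ⟶ Y`: it preserves
degrees and is compatible with the differentials. -/
structure IsChainMap {k : Type u} [CommRing k] {s : ℕ} {C : Ch.{u, u} k} {X : Fin s → Ch.{u, v} k}
    {Y : Ch.{u, v} k} (Φ : Gr C →ₗ[k] MultilinearMap k (fun i => Gr (X i)) (Gr Y)) : Prop where
  degree : ∀ (p₀ : ℤ) (c : C.X p₀) (p : Fin s → ℤ) (x : ∀ i, (X i).X (p i)),
    Φ (Gr.ι C p₀ c) (fun i => Gr.ι (X i) (p i) (x i)) ∈ LinearMap.range (Gr.ι Y (p₀ + ∑ i, p i))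
  differential : ∀ (p₀ : ℤ) (c : C.X p₀) (p : Fin s → ℤ) (x : ∀ i, (X i).X (p i)),
    Gr.d Y (Φ (Gr.ι C p₀ c) (fun i => Gr.ι (X i) (p i) (x i))) =
      Φ (Gr.d C (Gr.ι C p₀ c)) (fun i => Gr.ι (X i) (p i) (x i)) +
      ∑ i, sgn (p₀ + ∑ j ∈ Finset.Iio i, p j) •
        Φ (Gr.ι C p₀ c) (Function.update (fun i => Gr.ι (X i) (p i) (x i)) i
          (Gr.d (X i) (Gr.ι (X i) (p i) (x i))))

/-! ### Permutations of blocks -/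

/-- For a family of sizes `m 0, …, m (s - 1)` and a permutation `σ`, the ordered concatenation of
blocks of sizes `m (σ⁻¹ 0), …, m (σ⁻¹ (s - 1))`, identified with the disjoint union of all blocks. -/
def blockEquiv {s : ℕ} (σ : Equiv.Perm (Fin s)) (m : Fin s → ℕ) :
    Fin (∑ i, m (σ.symm i)) ≃ (j : Fin s) × Fin (m j) :=
  finSigmaFinEquiv.symm.trans (Equiv.sigmaCongrLeft (β := fun j => Fin (m j)) σ.symm)

/-- The permutation `σ(j₀, …, j_{s-1})` of `j₀ + ⋯ + j_{s-1}` elements that permutes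
the blocks of sizes `j₀, …, j_{s-1}` in the same way as `σ` permutes `s` letters. -/
def blockPerm {s : ℕ} (σ : Equiv.Perm (Fin s)) (j : Fin s → ℕ) : Equiv.Perm (Fin (∑ i, j i)) :=
  (finSigmaFinEquiv.symm.trans (blockEquiv σ j).symm).trans
    (finCongr (Equiv.sum_comp σ.symm j))

/-- The block sum `τ₀ ⊔ ⋯ ⊔ τ_{s-1}`. -/
def permSum {s : ℕ} {j : Fin s → ℕ} (τ : ∀ i, Equiv.Perm (Fin (j i))) :
    Equiv.Perm (Fin (∑ i, j i)) :=
  (finSigmaFinEquiv.symm.trans (Equiv.sigmaCongrRight τ)).trans finSigmaFinEquiv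

/-- The sums of the sizes of the blocks of a two-fold partition agree. -/
theorem sum_blocks {s : ℕ} {j : Fin s → ℕ} (l : Fin (∑ i, j i) → ℕ) :
    ∑ i, ∑ t, l (finSigmaFinEquiv ⟨i, t⟩) = ∑ u, l u := by
  rw [← Equiv.sum_comp finSigmaFinEquiv l, Fintype.sum_sigma]

/-! ### Operads in chain complexes and their algebras -/

/-- The data of a (symmetric) operad in chain complexes: chain complexes `obj n`, a right action of
the symmetric groups, a unit, and the composition
`obj s ⊗ obj (j 0) ⊗ ⋯ ⊗ obj (j (s - 1)) ⟶ obj (j 0 + ⋯ + j (s - 1))`. -/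
structure OperadData (k : Type u) [CommRing k] where
  obj : ℕ → Ch.{u, u} k
  act (n : ℕ) : Equiv.Perm (Fin n) → (obj n ⟶ obj n)
  one : (obj 1).X 0
  comp {s : ℕ} (j : Fin s → ℕ) :
    Gr (obj s) →ₗ[k] MultilinearMap k (fun i => Gr (obj (j i))) (Gr (obj (∑ i, j i)))

namespace OperadData

variable {k : Type u} [CommRing k] (O : OperadData k)

/-- The identification `obj m = obj n` for equal arities. -/
def cast {m n : ℕ} (h : m = n) : Gr (O.obj m) →ₗ[k] Gr (O.obj n) :=
  Gr.map (eqToHom (congrArg O.obj h))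

/-- The axioms of an operad. -/
structure IsOperad : Prop where
  act_one : ∀ n, O.act n 1 = 𝟙 _
  act_mul : ∀ n (σ τ : Equiv.Perm (Fin n)), O.act n (σ * τ) = O.act n σ ≫ O.act n τ
  one_cycle : Gr.d (O.obj 1) (Gr.ι (O.obj 1) 0 O.one) = 0
  comp_chain : ∀ {s : ℕ} (j : Fin s → ℕ), IsChainMap (O.comp j)
  one_comp : ∀ (j : Fin 1 → ℕ) (x : ∀ i, Gr (O.obj (j i))),
    O.cast (Fin.sum_univ_one j) (O.comp j (Gr.ι _ 0 O.one) x) = x 0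
  comp_one : ∀ (s : ℕ) (c : Gr (O.obj s)),
    O.cast (by simp) (O.comp (fun _ : Fin s => 1) c (fun _ => Gr.ι _ 0 O.one)) = c
  assoc : ∀ {s : ℕ} (j : Fin s → ℕ) (l : Fin (∑ i, j i) → ℕ)
    (p₀ : ℤ) (c : (O.obj s).X p₀) (p : Fin s → ℤ) (a : ∀ i, (O.obj (j i)).X (p i))
    (q : Fin (∑ i, j i) → ℤ) (b : ∀ t, (O.obj (l t)).X (q t)),
    O.cast (sum_blocks l)
      (O.comp (fun i => ∑ t, l (finSigmaFinEquiv ⟨i, t⟩)) (Gr.ι _ p₀ c) fun i =>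
        O.comp (fun t => l (finSigmaFinEquiv ⟨i, t⟩)) (Gr.ι _ (p i) (a i)) fun t =>
          Gr.ι _ (q (finSigmaFinEquiv ⟨i, t⟩)) (b (finSigmaFinEquiv ⟨i, t⟩))) =
    sgn (∑ i, p i * ∑ i' ∈ Finset.Iio i, ∑ t, q (finSigmaFinEquiv ⟨i', t⟩)) •
      O.comp l (O.comp j (Gr.ι _ p₀ c) fun i => Gr.ι _ (p i) (a i)) fun t => Gr.ι _ (q t) (b t)
  equivariant_left : ∀ {s : ℕ} (σ : Equiv.Perm (Fin s)) (j : Fin s → ℕ) (c : Gr (O.obj s))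
    (p : Fin s → ℤ) (a : ∀ i, (O.obj (j i)).X (p i)),
    O.comp j (Gr.map (O.act s σ) c) (fun i => Gr.ι _ (p i) (a i)) =
    koszul σ p • Gr.map (O.act _ (blockPerm σ j))
      (O.cast (Equiv.sum_comp σ.symm j)
        (O.comp (fun i => j (σ.symm i)) c fun i => Gr.ι _ (p (σ.symm i)) (a (σ.symm i))))
  equivariant_right : ∀ {s : ℕ} (j : Fin s → ℕ) (τ : ∀ i, Equiv.Perm (Fin (j i)))
    (c : Gr (O.obj s)) (a : ∀ i, Gr (O.obj (j i))),
    O.comp j c (fun i => Gr.map (O.act _ (τ i)) (a i)) =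
    Gr.map (O.act _ (permSum τ)) (O.comp j c a)

/-- The maps `θ s : obj s ⊗ A^{⊗ s} ⟶ A` define an action of the operad on the chain complex `A`,
i.e. they are chain maps that are unital, associative and equivariant. -/
structure IsAction (A : Ch.{u, v} k)
    (θ : ∀ s : ℕ, Gr (O.obj s) →ₗ[k] MultilinearMap k (fun _ : Fin s => Gr A) (Gr A)) : Prop where
  chain : ∀ s, IsChainMap (X := fun _ : Fin s => A) (θ s)
  unit : ∀ x : Fin 1 → Gr A, θ 1 (Gr.ι _ 0 O.one) x = x 0
  assoc : ∀ {s : ℕ} (j : Fin s → ℕ) (p₀ : ℤ) (c : (O.obj s).X p₀) (p : Fin s → ℤ)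
    (a : ∀ i, (O.obj (j i)).X (p i)) (q : Fin (∑ i, j i) → ℤ) (x : ∀ t, A.X (q t)),
    (θ s (Gr.ι _ p₀ c) fun i => θ (j i) (Gr.ι _ (p i) (a i)) fun t =>
      Gr.ι A (q (finSigmaFinEquiv ⟨i, t⟩)) (x (finSigmaFinEquiv ⟨i, t⟩))) =
    sgn (∑ i, p i * ∑ i' ∈ Finset.Iio i, ∑ t, q (finSigmaFinEquiv ⟨i', t⟩)) •
      θ _ (O.comp j (Gr.ι _ p₀ c) fun i => Gr.ι _ (p i) (a i)) fun t => Gr.ι A (q t) (x t)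
  equivariant : ∀ {s : ℕ} (σ : Equiv.Perm (Fin s)) (c : Gr (O.obj s)) (q : Fin s → ℤ)
    (x : ∀ i, A.X (q i)),
    θ s (Gr.map (O.act s σ) c) (fun i => Gr.ι A (q i) (x i)) =
    koszul σ q • θ s c fun i => Gr.ι A (q (σ.symm i)) (x (σ.symm i))

end OperadData

/-! ### Shuffles -/

/-- An `(r 0, …, r (m - 1))`-shuffle, i.e. a partition of `{0, …, N - 1}`, `N = ∑ i, r i`, into
subsets of cardinalities `r i`, given by the function that sends an element to the index of the
subset containing it. -/
def Shuffle {m : ℕ} (r : Fin m → ℕ) : Type :=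
  {w : Fin (∑ i, r i) → Fin m // ∀ i, (Finset.univ.filter fun t => w t = i).card = r i}

namespace Shuffle

variable {m : ℕ} {r : Fin m → ℕ}

instance : Fintype (Shuffle r) :=
  inferInstanceAs (Fintype {w : Fin (∑ i, r i) → Fin m //
    ∀ i, (Finset.univ.filter fun t => w t = i).card = r i})

/-- The sign of the permutation that lists the subsets of the shuffle one after the other, each in
increasing order. -/
def sign (w : Shuffle r) : ℤ :=
  (-1) ^ (Finset.univ.filter fun t : Fin (∑ i, r i) × Fin (∑ i, r i) =>
    t.1 < t.2 ∧ w.1 t.2 < w.1 t.1).card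

/-- The monotone surjection `[N] ⟶ [r i]` that increases precisely at the elements of the `i`-th
subset of the shuffle; the induced map is the composite of the degeneracies `s_ν`, in increasing
order of `ν`, for all `ν` outside that subset. -/
def deg (w : Shuffle r) (i : Fin m) : Fin (∑ i, r i + 1) →o Fin (r i + 1) :=
    { toFun := fun t =>
        ⟨(Finset.univ.filter fun u : Fin (∑ i, r i) => u.val < t.val ∧ w.1 u = i).card,
          Nat.lt_succ_of_le ((Finset.card_le_card (fun u hu => by
            simp only [Finset.mem_filter, Finset.mem_univ, true_and] at hu ⊢
            exact hu.2)).trans (w.2 i).le)⟩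
      monotone' := fun t t' h => by
        refine Fin.mk_le_mk.2 (Finset.card_le_card fun u hu => ?_)
        simp only [Finset.mem_filter, Finset.mem_univ, true_and] at hu ⊢
        exact ⟨hu.1.trans_le h, hu.2⟩ }

end Shuffle

/-! ### The Barratt--Eccles operad -/

section BarrattEccles

variable (k : Type u) [CommRing k]

variable {k} in
/-- The module of degree `n` of `extendZ`. -/
abbrev ExtX (C : ChainComplex (ModuleCat.{v} k) ℕ) (n : ℤ) : Type v :=
  ⨁ p : {p : ℕ // (p : ℤ) = n}, C.X p.1

variable {k} in
/-- The differential of `extendZ`. -/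
def extD (C : ChainComplex (ModuleCat.{v} k) ℕ) (n : ℤ) : ExtX C (n + 1) →ₗ[k] ExtX C n :=
  DirectSum.toModule k _ _ fun p =>
    match p with
    | ⟨0, _⟩ => 0
    | ⟨p + 1, h⟩ => DirectSum.lof k {p : ℕ // (p : ℤ) = n} (fun p => C.X p.1)
        ⟨p, by push_cast at h; linarith⟩ ∘ₗ (C.d (p + 1) p).hom

variable {k} in
theorem extD_extD (C : ChainComplex (ModuleCat.{v} k) ℕ) (n : ℤ) :
    extD C n ∘ₗ extD C (n + 1) = 0 := by
  refine DirectSum.linearMap_ext _ fun p => LinearMap.ext fun x => ?_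
  match p with
  | ⟨0, _⟩ => simp [extD]
  | ⟨1, _⟩ => simp [extD]
  | ⟨p + 2, h⟩ =>
    have : (C.d (p + 1) p).hom ((C.d (p + 1 + 1) (p + 1)).hom x) = 0 := by
      rw [← LinearMap.comp_apply, ← ModuleCat.hom_comp, C.d_comp_d]; rfl
    simp [extD, this]

/-- A chain complex in non-negative degrees, as a chain complex indexed by `ℤ`. -/
def extendZ : ChainComplex (ModuleCat.{v} k) ℕ ⥤ Ch.{u, v} k where
  obj C := ChainComplex.of (fun n : ℤ => ModuleCat.of k (ExtX C n))
    (fun n => ModuleCat.ofHom (extD C n))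
    (fun n => by rw [← ModuleCat.ofHom_comp, extD_extD]; rfl)
  map {C D} f := ChainComplex.ofHom
    (fun n => ModuleCat.ofHom (DirectSum.lmap fun p => (f.f p.1).hom))
    (fun n => by
      ext1
      refine DirectSum.linearMap_ext _ fun p => LinearMap.ext fun x => ?_
      match p with
      | ⟨0, _⟩ => simp [extD]
      | ⟨p + 1, h⟩ =>
        have : (f.f p).hom ((C.d (p + 1) p).hom x) = (D.d (p + 1) p).hom ((f.f (p + 1)).hom x) := by
          rw [← LinearMap.comp_apply, ← ModuleCat.hom_comp, ← f.comm]; rfl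
        simp [extD, this])
  map_id C := by
    ext n : 2
    refine DirectSum.linearMap_ext _ fun p => LinearMap.ext fun x => ?_
    simp
  map_comp f g := by
    ext n : 2
    refine DirectSum.linearMap_ext _ fun p => LinearMap.ext fun x => ?_
    simp

/-- A `p`-simplex of the nerve of the translation category of `Σ_s`. Since there is precisely one
morphism between any two objects of this category, it is given by its vertices. -/
abbrev ESimplex (s p : ℕ) : Type := Fin (p + 1) → Equiv.Perm (Fin s)

/-- The simplicial `k`-module `k{N(Σ̃_s)}`. -/
def linNerve (s : ℕ) : SimplicialObject (ModuleCat.{u} k) where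
  obj n := ModuleCat.of k (ESimplex s n.unop.len →₀ k)
  map f := ModuleCat.ofHom (Finsupp.lmapDomain k k fun c => c ∘ f.unop.toOrderHom)
  map_id n := by
    ext1
    exact Finsupp.lhom_ext fun c x => Finsupp.mapDomain_single
  map_comp f g := by
    ext1
    refine Finsupp.lhom_ext fun c x => ?_
    refine Finsupp.mapDomain_single.trans (Eq.symm ?_)
    exact (congrArg (Finsupp.mapDomain _) Finsupp.mapDomain_single).trans Finsupp.mapDomain_single

/-- The chain complex `C_*(k{N(Σ̃_s)})`. -/
def beObj (s : ℕ) : Ch.{u, u} k :=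
  (AlgebraicTopology.alternatingFaceMapComplex (ModuleCat.{u} k) ⋙ extendZ k).obj (linNerve k s)

variable {k} in
/-- The basis element of degree `p` given by a `p`-simplex `c`. -/
def beGen {s p : ℕ} (c : ESimplex s p) : (beObj k s).X p :=
  DirectSum.lof k {q : ℕ // (q : ℤ) = p} (fun q => ESimplex s q.1 →₀ k) ⟨p, rfl⟩ (Finsupp.single c 1)

/-- The underlying graded module of `C_*(k{N(Σ̃_s)})` is free on the simplices. -/
def beCoord (s : ℕ) : Gr (beObj k s) →ₗ[k] Π₀ _ : (p : ℕ) × ESimplex s p, k :=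
  DirectSum.toModule k ℤ _ fun n =>
    DirectSum.toModule k {q : ℕ // (q : ℤ) = n} _ fun q =>
      (Finsupp.linearCombination k fun c : ESimplex s q.1 =>
        DFinsupp.single (⟨q.1, c⟩ : (p : ℕ) × ESimplex s p) 1)

/-- The operad structure of the translation categories, on objects:
`(σ; τ₀, …, τ_{s-1}) ↦ σ(j₀, …, j_{s-1}) ∘ (τ₀ ⊔ ⋯ ⊔ τ_{s-1})`. -/
def permComp {s : ℕ} {j : Fin s → ℕ} (σ : Equiv.Perm (Fin s)) (τ : ∀ i, Equiv.Perm (Fin (j i))) :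
    Equiv.Perm (Fin (∑ i, j i)) :=
  blockPerm σ j * permSum τ

/-- The composition of the Barratt--Eccles operad on simplices: the shuffle map followed by the map
induced by the operad structure of the translation categories. -/
def beCompSimplex {s : ℕ} (j : Fin s → ℕ) (c : (p : ℕ) × ESimplex s p)
    (a : ∀ i, (p : ℕ) × ESimplex (j i) p) : Gr (beObj k (∑ i, j i)) :=
  ∑ w : Shuffle (Fin.cons c.1 (fun i => (a i).1) : Fin (s + 1) → ℕ),
    w.sign • Gr.ι (beObj k (∑ i, j i)) _ (beGen fun t =>
      permComp (c.2 (w.deg 0 t)) fun i => (a i).2 (w.deg i.succ t))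

open scoped Classical in
/-- The multilinear extension of `beCompSimplex`. -/
def beComp {s : ℕ} (j : Fin s → ℕ) :
    Gr (beObj k s) →ₗ[k]
      MultilinearMap k (fun i => Gr (beObj k (j i))) (Gr (beObj k (∑ i, j i))) :=
  DFinsupp.lsum k (fun c : (p : ℕ) × ESimplex s p => LinearMap.toSpanSingleton k _
    ((MultilinearMap.fromDFinsuppEquiv (fun i => (p : ℕ) × ESimplex (j i) p) k
      fun a => MultilinearMap.mkPiRing k (Fin s) (beCompSimplex k j c a)).compLinearMap
        fun i => beCoord k (j i))) ∘ₗ beCoord k s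

/-- The right action of `σ` on `C_*(k{N(Σ̃_s)})`, induced by the right multiplication by `σ`. -/
def beAct (s : ℕ) (σ : Equiv.Perm (Fin s)) : beObj k s ⟶ beObj k s :=
  (AlgebraicTopology.alternatingFaceMapComplex (ModuleCat.{u} k) ⋙ extendZ k).map
    { app := fun n => ModuleCat.ofHom (Finsupp.lmapDomain k k
        fun (c : ESimplex s n.unop.len) t => c t * σ)
      naturality := fun m n f => by
        ext1
        refine Finsupp.lhom_ext fun c x => ?_
        refine Eq.trans (congrArg (Finsupp.mapDomain _) Finsupp.mapDomain_single) ?_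
        refine Eq.trans Finsupp.mapDomain_single (Eq.symm ?_)
        exact (congrArg (Finsupp.mapDomain _) Finsupp.mapDomain_single).trans
          Finsupp.mapDomain_single }

/-- The Barratt--Eccles operad. -/
def barrattEccles : OperadData k where
  obj := beObj k
  act := beAct k
  one := beGen (fun _ => 1 : ESimplex 1 0)
  comp := beComp k

end BarrattEccles

/-! ### The category `𝓘` and commutative `𝓘`-dgas -/

/-- The objects of the category `𝓘`: the finite sets with `card` elements `0, …, card - 1`. -/
structure ICat where
  card : ℕ

namespace ICat

/-- The morphisms of `𝓘` are the injective maps. -/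
instance : Category ICat where
  Hom m n := Fin m.card ↪ Fin n.card
  id m := Function.Embedding.refl _
  comp f g := Function.Embedding.trans f g

/-- The injection underlying a morphism. -/
def toEmb {m n : ICat} (f : m ⟶ n) : Fin m.card ↪ Fin n.card := f

/-- The morphism given by an injection. -/
def ofEmb {m n : ICat} (f : Fin m.card ↪ Fin n.card) : m ⟶ n := f

/-- The identity, as a morphism between objects with the same number of elements. -/
def castHom {m n : ICat} (h : m.card = n.card) : m ⟶ n := ofEmb (finCongr h).toEmbedding

/-- The ordered concatenation `m ⊔ n`. -/
def add (m n : ICat) : ICat := ⟨m.card + n.card⟩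

/-- The ordered concatenation `f ⊔ g` of morphisms. -/
def addHom {m m' n n' : ICat} (f : m ⟶ m') (g : n ⟶ n') : add m n ⟶ add m' n' :=
  ofEmb ((finSumFinEquiv.symm.toEmbedding.trans ((toEmb f).sumMap (toEmb g))).trans
    finSumFinEquiv.toEmbedding)

/-- The symmetry isomorphism `m ⊔ n ⟶ n ⊔ m`, which exchanges the two blocks. -/
def swap (m n : ICat) : add m n ⟶ add n m :=
  ofEmb ((finSumFinEquiv.symm.trans (Equiv.sumComm _ _)).trans finSumFinEquiv).toEmbedding

/-- The ordered concatenation of a finite family of objects. -/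
def sum {s : ℕ} (m : Fin s → ICat) : ICat := ⟨∑ i, (m i).card⟩

end ICat

/-- A commutative `𝓘`-dga, i.e. a lax symmetric monoidal functor from `(𝓘, ⊔, 0)` to chain
complexes. The structure map `E(m) ⊗ E(n) ⟶ E(m ⊔ n)` is given by the bilinear map `mul m n`, which
preserves degrees (`mul_degree`) and is compatible with the differentials (`leibniz`); the structure
map from the unit is given by the cycle `one` of degree `0`. -/
structure CommIDGA (k : Type u) [CommRing k] where
  toFunctor : ICat ⥤ Ch.{u, v} k
  one : (toFunctor.obj ⟨0⟩).X 0
  mul (m n : ICat) :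
    Gr (toFunctor.obj m) →ₗ[k] Gr (toFunctor.obj n) →ₗ[k] Gr (toFunctor.obj (m.add n))
  one_cycle : Gr.d _ (Gr.ι _ 0 one) = 0
  mul_degree : ∀ m n (p q : ℤ) (x : (toFunctor.obj m).X p) (y : (toFunctor.obj n).X q),
    mul m n (Gr.ι _ p x) (Gr.ι _ q y) ∈ LinearMap.range (Gr.ι (toFunctor.obj (m.add n)) (p + q))
  leibniz : ∀ m n (p q : ℤ) (x : (toFunctor.obj m).X p) (y : (toFunctor.obj n).X q),
    Gr.d _ (mul m n (Gr.ι _ p x) (Gr.ι _ q y)) =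
      mul m n (Gr.d _ (Gr.ι _ p x)) (Gr.ι _ q y) + sgn p • mul m n (Gr.ι _ p x) (Gr.d _ (Gr.ι _ q y))
  mul_natural : ∀ {m m' n n' : ICat} (f : m ⟶ m') (g : n ⟶ n') (x : Gr (toFunctor.obj m))
    (y : Gr (toFunctor.obj n)),
    Gr.map (toFunctor.map (ICat.addHom f g)) (mul m n x y) =
      mul m' n' (Gr.map (toFunctor.map f) x) (Gr.map (toFunctor.map g) y)
  mul_assoc : ∀ (l m n : ICat) (x : Gr (toFunctor.obj l)) (y : Gr (toFunctor.obj m))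
    (z : Gr (toFunctor.obj n)),
    Gr.map (toFunctor.map (ICat.castHom (Nat.add_assoc l.card m.card n.card)))
      (mul (l.add m) n (mul l m x y) z) = mul l (m.add n) x (mul m n y z)
  one_mul : ∀ (m : ICat) (x : Gr (toFunctor.obj m)),
    Gr.map (toFunctor.map (ICat.castHom (Nat.zero_add m.card))) (mul ⟨0⟩ m (Gr.ι _ 0 one) x) = x
  mul_one : ∀ (m : ICat) (x : Gr (toFunctor.obj m)),
    Gr.map (toFunctor.map (ICat.castHom (Nat.add_zero m.card))) (mul m ⟨0⟩ x (Gr.ι _ 0 one)) = x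
  mul_comm : ∀ m n (p q : ℤ) (x : (toFunctor.obj m).X p) (y : (toFunctor.obj n).X q),
    Gr.map (toFunctor.map (ICat.swap m n)) (mul m n (Gr.ι _ p x) (Gr.ι _ q y)) =
      sgn (p * q) • mul n m (Gr.ι _ q y) (Gr.ι _ p x)

namespace CommIDGA

variable {k : Type u} [CommRing k]

/-- A morphism of commutative `𝓘`-dgas: a natural transformation that is compatible with the units
and the products. -/
structure Hom (E F : CommIDGA.{u, v} k) where
  toNatTrans : E.toFunctor ⟶ F.toFunctor
  map_one : ((toNatTrans.app ⟨0⟩).f 0).hom E.one = F.one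
  map_mul : ∀ (m n : ICat) (x : Gr (E.toFunctor.obj m)) (y : Gr (E.toFunctor.obj n)),
    Gr.map (toNatTrans.app (m.add n)) (E.mul m n x y) =
      F.mul m n (Gr.map (toNatTrans.app m) x) (Gr.map (toNatTrans.app n) y)

/-- The iterated product `E(m 0) ⊗ ⋯ ⊗ E(m (s - 1)) ⟶ E(m 0 ⊔ ⋯ ⊔ m (s - 1))`. -/
def prod (E : CommIDGA.{u, v} k) : (s : ℕ) → (m : Fin s → ICat) →
    MultilinearMap k (fun i => Gr (E.toFunctor.obj (m i))) (Gr (E.toFunctor.obj (ICat.sum m))) :=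
  fun s => match s with
  | 0 => fun m => MultilinearMap.constOfIsEmpty k _
      (Gr.map (E.toFunctor.map (ICat.castHom (by simp [ICat.sum]))) (Gr.ι _ 0 E.one))
  | s + 1 => fun m => LinearMap.uncurryLeft
      { toFun := fun x => (Gr.map (E.toFunctor.map (ICat.castHom
            (by simp [ICat.sum, ICat.add, Fin.sum_univ_succ]))) ∘ₗ
          E.mul (m 0) (ICat.sum fun i => m i.succ) x).compMultilinearMap
            (E.prod s fun i => m i.succ)
        map_add' := fun x y => by ext; simp
        map_smul' := fun a x => by ext; simp }

end CommIDGA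

/-! ### Homotopy colimits -/

section Hocolim

variable {k : Type u} [CommRing k]

/-- A `p`-simplex `n₀ ← n₁ ← ⋯ ← n_p` of the nerve of `𝓘`. -/
abbrev NSimplex (p : ℕ) : Type := (Fin (p + 1))ᵒᵖ ⥤ ICat

instance (p : ℕ) : DecidableEq (NSimplex p) := Classical.decEq _

namespace NSimplex

/-- The object `n_p` of the simplex `n₀ ← n₁ ← ⋯ ← n_p`. -/
abbrev last {p : ℕ} (F : NSimplex p) : ICat := F.obj (op (Fin.last p))

/-- The simplicial structure of the nerve of `𝓘`. -/
abbrev pull {p q : ℕ} (F : NSimplex p) (f : Fin (q + 1) →o Fin (p + 1)) : NSimplex q :=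
  f.monotone.functor.op ⋙ F

/-- The morphism `n_p ⟶ n_{f(q)}` of `F`; it is an identity if `f(q) = p`, and the morphism `α_p` if
`f` is the last coface map. -/
abbrev lastHom {p q : ℕ} (F : NSimplex p) (f : Fin (q + 1) →o Fin (p + 1)) :
    F.last ⟶ (F.pull f).last :=
  F.map (homOfLE (Fin.le_last (f (Fin.last q)))).op

end NSimplex

/-- The elements of simplicial degree `p` and chain degree `q` of the simplicial replacement. -/
abbrev SrepX (P : ICat ⥤ Ch.{u, v} k) (p : ℕ) (q : ℤ) : Type v :=
  ⨁ F : NSimplex p, (P.obj F.last).X q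

/-- The element `(F; x)` of the simplicial replacement. -/
def srepGen (P : ICat ⥤ Ch.{u, v} k) {p : ℕ} (F : NSimplex p) (q : ℤ) :
    (P.obj F.last).X q →ₗ[k] SrepX P p q :=
  DirectSum.lof k (NSimplex p) (fun F => (P.obj F.last).X q) F

theorem srep_ext {P : ICat ⥤ Ch.{u, v} k} {p : ℕ} {q : ℤ} {M : Type*} [AddCommGroup M] [Module k M]
    {f g : SrepX P p q →ₗ[k] M} (h : ∀ F x, f (srepGen P F q x) = g (srepGen P F q x)) : f = g :=
  DirectSum.linearMap_ext _ fun F => LinearMap.ext fun x => h F x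

/-- The vertical differential of the simplicial replacement. -/
def srepD (P : ICat ⥤ Ch.{u, v} k) (p : ℕ) (q q' : ℤ) : SrepX P p q →ₗ[k] SrepX P p q' :=
  DirectSum.toModule k (NSimplex p) _ fun F => srepGen P F q' ∘ₗ ((P.obj F.last).d q q').hom

/-- The simplicial structure maps of the simplicial replacement: they are induced by those of the
nerve on the indices and by the functoriality of `P`. -/
def srepMap (P : ICat ⥤ Ch.{u, v} k) {p p' : ℕ} (f : Fin (p' + 1) →o Fin (p + 1)) (q : ℤ) :
    SrepX P p q →ₗ[k] SrepX P p' q :=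
  DirectSum.toModule k (NSimplex p) _ fun F =>
    srepGen P (F.pull f) q ∘ₗ ((P.map (F.lastHom f)).f q).hom

/-- The effect of a map of diagrams on simplicial replacements. -/
def srepNat {P Q : ICat ⥤ Ch.{u, v} k} (φ : P ⟶ Q) (p : ℕ) (q : ℤ) :
    SrepX P p q →ₗ[k] SrepX Q p q :=
  DirectSum.toModule k (NSimplex p) _ fun F => srepGen Q F q ∘ₗ ((φ.app F.last).f q).hom

@[simp]
theorem srepD_gen (P : ICat ⥤ Ch.{u, v} k) {p : ℕ} (F : NSimplex p) (q q' : ℤ)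
    (x : (P.obj F.last).X q) :
    srepD P p q q' (srepGen P F q x) = srepGen P F q' (((P.obj F.last).d q q').hom x) :=
  DirectSum.toModule_lof _ _ _

@[simp]
theorem srepMap_gen (P : ICat ⥤ Ch.{u, v} k) {p p' : ℕ} (f : Fin (p' + 1) →o Fin (p + 1))
    (F : NSimplex p) (q : ℤ) (x : (P.obj F.last).X q) :
    srepMap P f q (srepGen P F q x) =
      srepGen P (F.pull f) q (((P.map (F.lastHom f)).f q).hom x) :=
  DirectSum.toModule_lof _ _ _

@[simp]
theorem srepNat_gen {P Q : ICat ⥤ Ch.{u, v} k} (φ : P ⟶ Q) {p : ℕ} (F : NSimplex p) (q : ℤ)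
    (x : (P.obj F.last).X q) :
    srepNat φ p q (srepGen P F q x) = srepGen Q F q (((φ.app F.last).f q).hom x) :=
  DirectSum.toModule_lof _ _ _

/-- The chain complex of `p`-simplices of the simplicial replacement of `P`. -/
def srepObj (P : ICat ⥤ Ch.{u, v} k) (p : ℕ) : Ch.{u, v} k where
  X q := ModuleCat.of k (SrepX P p q)
  d q q' := ModuleCat.ofHom (srepD P p q q')
  shape q q' h := by
    ext1
    refine srep_ext fun F x => ?_
    refine (srepD_gen P F q q' x).trans ?_
    rw [(P.obj F.last).shape q q' h]
    exact map_zero _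
  d_comp_d' q q' q'' _ _ := by
    ext1
    refine srep_ext fun F x => ?_
    refine (congrArg _ (srepD_gen P F q q' x)).trans ((srepD_gen P F q' q'' _).trans ?_)
    exact (congrArg (srepGen P F q'') (hom_congr ((P.obj F.last).d_comp_d q q' q'') x)).trans
      (map_zero _)

/-- The simplicial replacement of `P`, a simplicial object in chain complexes. -/
def srepSimp (P : ICat ⥤ Ch.{u, v} k) : SimplicialObject (Ch.{u, v} k) where
  obj n := srepObj P n.unop.len
  map f :=
    { f := fun q => ModuleCat.ofHom (srepMap P f.unop.toOrderHom q)
      comm' := fun q q' _ => by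
        ext1
        refine srep_ext fun F x => ?_
        refine (congrArg _ (srepMap_gen P _ F q x)).trans ((srepD_gen P _ q q' _).trans ?_)
        refine Eq.symm ((congrArg _ (srepD_gen P F q q' x)).trans ((srepMap_gen P _ F q' _).trans ?_))
        exact congrArg (srepGen P (F.pull f.unop.toOrderHom) q')
          (hom_congr ((P.map (F.lastHom f.unop.toOrderHom)).comm q q').symm x) }
  map_id n := by
    ext q : 2
    refine srep_ext fun F x => ?_
    refine (srepMap_gen P _ F q x).trans ?_
    have h : P.map (F.lastHom (SimplexCategory.Hom.toOrderHom (𝟙 n.unop))) = 𝟙 (P.obj F.last) :=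
      (congrArg P.map (F.map_id _)).trans (P.map_id _)
    exact congrArg (srepGen P F q)
      (hom_congr (congrArg (fun g : P.obj F.last ⟶ P.obj F.last => g.f q) h) x)
  map_comp f g := by
    ext q : 2
    refine srep_ext fun F x => ?_
    refine (srepMap_gen P _ F q x).trans (Eq.symm ?_)
    refine (congrArg _ (srepMap_gen P _ F q x)).trans ((srepMap_gen P _ _ q _).trans ?_)
    have h : P.map (F.lastHom f.unop.toOrderHom) ≫
        P.map ((F.pull f.unop.toOrderHom).lastHom g.unop.toOrderHom) =
        P.map (F.lastHom (f ≫ g).unop.toOrderHom) :=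
      (P.map_comp _ _).symm.trans (congrArg P.map (F.map_comp _ _).symm)
    exact congrArg (srepGen P (F.pull (f ≫ g).unop.toOrderHom) q)
      (hom_congr (congrArg (fun h => h.f q) h) x)

/-- The simplicial replacement functor. -/
def srep : (ICat ⥤ Ch.{u, v} k) ⥤ SimplicialObject (Ch.{u, v} k) where
  obj P := srepSimp P
  map {P Q} φ :=
    { app := fun n =>
        { f := fun q => ModuleCat.ofHom (srepNat φ n.unop.len q)
          comm' := fun q q' _ => by
            ext1
            refine srep_ext fun F x => ?_
            refine (congrArg _ (srepNat_gen φ F q x)).trans ((srepD_gen Q F q q' _).trans ?_)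
            refine Eq.symm ((congrArg _ (srepD_gen P F q q' x)).trans
              ((srepNat_gen φ F q' _).trans ?_))
            exact congrArg (srepGen Q F q') (hom_congr ((φ.app F.last).comm q q').symm x) }
      naturality := fun m n f => by
        ext q : 2
        refine srep_ext fun F x => ?_
        refine (congrArg _ (srepMap_gen P _ F q x)).trans ((srepNat_gen φ _ q _).trans ?_)
        refine Eq.symm ((congrArg _ (srepNat_gen φ F q x)).trans ((srepMap_gen Q _ F q _).trans ?_))
        exact congrArg (srepGen Q (F.pull f.unop.toOrderHom) q) (hom_congr (congrArg (fun h => h.f q)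
          (φ.naturality (F.lastHom f.unop.toOrderHom)).symm) x) }
  map_id P := by
    ext n q : 3
    refine srep_ext (P := P) (p := n.unop.len) fun F x => ?_
    exact srepNat_gen (𝟙 P) F q x
  map_comp φ ψ := by
    ext n q : 3
    refine srep_ext (p := n.unop.len) fun F x => ?_
    exact (srepNat_gen (φ ≫ ψ) F q x).trans
      ((congrArg _ (srepNat_gen φ F q x)).trans (srepNat_gen ψ F q _)).symm

/-- The elements of degree `n` of the total complex: the direct sum of the `Y_{p,q}` over all
`p + q = n`. -/
abbrev TotX (Y : ChainComplex (Ch.{u, v} k) ℕ) (n : ℤ) : Type v :=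
  ⨁ a : {a : ℕ × ℤ // a.1 + a.2 = n}, (Y.X a.1.1).X a.1.2

/-- The inclusion of `Y_{p,q}` into the total complex. -/
def totGen (Y : ChainComplex (Ch.{u, v} k) ℕ) (p : ℕ) (q n : ℤ) (h : p + q = n) :
    (Y.X p).X q →ₗ[k] TotX Y n :=
  DirectSum.lof k {a : ℕ × ℤ // a.1 + a.2 = n} (fun a => (Y.X a.1.1).X a.1.2) ⟨(p, q), h⟩

/-- The differential of the total complex, `d y = d_h y + (-1)^p d_v y` for `y` in `Y_{p,q}`. -/
def totD (Y : ChainComplex (Ch.{u, v} k) ℕ) (n : ℤ) : TotX Y (n + 1) →ₗ[k] TotX Y n :=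
  DirectSum.toModule k _ _ fun a =>
    (match a with
      | ⟨(0, _), _⟩ => 0
      | ⟨(p + 1, q), h⟩ => totGen Y p q n (by push_cast at h; linarith) ∘ₗ
          ((Y.d (p + 1) p).f q).hom) +
    sgn a.1.1 • (totGen Y a.1.1 (a.1.2 - 1) n (by have := a.2; linarith) ∘ₗ
      ((Y.X a.1.1).d a.1.2 (a.1.2 - 1)).hom)

theorem totD_gen_zero (Y : ChainComplex (Ch.{u, v} k) ℕ) (q n : ℤ) (h : (0 : ℕ) + q = n + 1)
    (x : (Y.X 0).X q) : totD Y n (totGen Y 0 q (n + 1) h x) =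
      totGen Y 0 (q - 1) n (by linarith) (((Y.X 0).d q (q - 1)).hom x) := by
  refine (DirectSum.toModule_lof _ _ _).trans ?_
  simp [sgn]

theorem totD_gen_succ (Y : ChainComplex (Ch.{u, v} k) ℕ) (p : ℕ) (q n : ℤ)
    (h : (p + 1 : ℕ) + q = n + 1) (x : (Y.X (p + 1)).X q) :
    totD Y n (totGen Y (p + 1) q (n + 1) h x) =
      totGen Y p q n (by push_cast at h; linarith) (((Y.d (p + 1) p).f q).hom x) -
      sgn p • totGen Y (p + 1) (q - 1) n (by linarith) (((Y.X (p + 1)).d q (q - 1)).hom x) := by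
  refine (DirectSum.toModule_lof _ _ _).trans ?_
  simp [sgn, Int.negOnePow_succ, sub_eq_add_neg]

theorem tot_ext {Y : ChainComplex (Ch.{u, v} k) ℕ} {n : ℤ} {M : Type*} [AddCommGroup M] [Module k M]
    {f g : TotX Y n →ₗ[k] M}
    (h : ∀ p q h x, f (totGen Y p q n h x) = g (totGen Y p q n h x)) : f = g :=
  DirectSum.linearMap_ext _ fun a => LinearMap.ext fun x => h a.1.1 a.1.2 a.2 x

theorem totD_totD (Y : ChainComplex (Ch.{u, v} k) ℕ) (n : ℤ) : totD Y n ∘ₗ totD Y (n + 1) = 0 := by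
  refine tot_ext fun p q h x => ?_
  have hv : ∀ p x, ((Y.X p).d (q - 1) (q - 1 - 1)).hom (((Y.X p).d q (q - 1)).hom x) = 0 :=
    fun p x => hom_congr ((Y.X p).d_comp_d _ _ _) x
  have hc : ∀ p x, ((Y.d (p + 1) p).f (q - 1)).hom (((Y.X (p + 1)).d q (q - 1)).hom x) =
      ((Y.X p).d q (q - 1)).hom (((Y.d (p + 1) p).f q).hom x) :=
    fun p x => hom_congr ((Y.d (p + 1) p).comm q (q - 1)).symm x
  have hh : ∀ p x, ((Y.d (p + 1) p).f q).hom (((Y.d (p + 1 + 1) (p + 1)).f q).hom x) = 0 :=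
    fun p x => hom_congr (congrArg (fun h => h.f q) (Y.d_comp_d (p + 1 + 1) (p + 1) p)) x
  rw [LinearMap.comp_apply, LinearMap.zero_apply]
  match p with
  | 0 => rw [totD_gen_zero, totD_gen_zero, hv, map_zero]
  | 1 =>
    rw [totD_gen_succ, map_sub, map_zsmul, totD_gen_succ, totD_gen_zero, hv, hc]
    simp [sgn]
  | p + 2 =>
    rw [totD_gen_succ, map_sub, map_zsmul, totD_gen_succ, totD_gen_succ, hv, hc, hh]
    have : sgn (p + 1) = - sgn p := by simp [sgn, Int.negOnePow_succ]
    simp [this]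

/-- The map of total complexes induced by a map of bicomplexes. -/
def totMap {Y Z : ChainComplex (Ch.{u, v} k) ℕ} (f : Y ⟶ Z) (n : ℤ) : TotX Y n →ₗ[k] TotX Z n :=
  DirectSum.lmap fun a => ((f.f a.1.1).f a.1.2).hom

theorem totMap_gen {Y Z : ChainComplex (Ch.{u, v} k) ℕ} (f : Y ⟶ Z) (p : ℕ) (q n : ℤ)
    (h : p + q = n) (x : (Y.X p).X q) :
    totMap f n (totGen Y p q n h x) = totGen Z p q n h (((f.f p).f q).hom x) :=
  DirectSum.lmap_lof _ _ _

theorem totD_totMap {Y Z : ChainComplex (Ch.{u, v} k) ℕ} (f : Y ⟶ Z) (n : ℤ) :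
    totD Z n ∘ₗ totMap f (n + 1) = totMap f n ∘ₗ totD Y n := by
  refine tot_ext fun p q h x => ?_
  have hv : ∀ p x, ((f.f p).f (q - 1)).hom (((Y.X p).d q (q - 1)).hom x) =
      ((Z.X p).d q (q - 1)).hom (((f.f p).f q).hom x) :=
    fun p x => hom_congr ((f.f p).comm q (q - 1)).symm x
  have hh : ∀ p x, ((f.f p).f q).hom (((Y.d (p + 1) p).f q).hom x) =
      ((Z.d (p + 1) p).f q).hom (((f.f (p + 1)).f q).hom x) :=
    fun p x => hom_congr (congrArg (fun h => h.f q) (f.comm (p + 1) p).symm) x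
  rw [LinearMap.comp_apply, LinearMap.comp_apply]
  match p with
  | 0 => rw [totMap_gen, totD_gen_zero, totD_gen_zero, totMap_gen, hv]
  | p + 1 =>
    rw [totMap_gen, totD_gen_succ, totD_gen_succ, map_sub, map_zsmul, totMap_gen, totMap_gen, hv, hh]

/-- The total complex of a chain complex of chain complexes. -/
def tot : ChainComplex (Ch.{u, v} k) ℕ ⥤ Ch.{u, v} k where
  obj Y := ChainComplex.of (fun n : ℤ => ModuleCat.of k (TotX Y n))
    (fun n => ModuleCat.ofHom (totD Y n))
    (fun n => by rw [← ModuleCat.ofHom_comp, totD_totD]; rfl)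
  map {Y Z} f := ChainComplex.ofHom
    (fun n => ModuleCat.ofHom (totMap f n))
    (fun n => by
      simp only [ChainComplex.of_d]
      rw [← ModuleCat.ofHom_comp, ← ModuleCat.ofHom_comp, totD_totMap])
  map_id Y := by
    ext n : 2
    exact tot_ext fun p q h x => totMap_gen (𝟙 Y) p q n h x
  map_comp f g := by
    ext n : 2
    refine tot_ext fun p q h x => ?_
    exact (totMap_gen (f ≫ g) p q n h x).trans
      ((congrArg _ (totMap_gen f p q n h x)).trans (totMap_gen g p q n h _)).symm

/-- The homotopy colimit functor `P ↦ P_{h𝓘} = Tot C_*(srep P)`. -/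
def hocolim : (ICat ⥤ Ch.{u, v} k) ⥤ Ch.{u, v} k :=
  srep ⋙ AlgebraicTopology.alternatingFaceMapComplex (Ch.{u, v} k) ⋙ tot

/-- The indices of the summands of the homotopy colimit: a `p`-simplex of the nerve of `𝓘` together
with a chain degree `q`. -/
abbrev HIndex : Type := (p : ℕ) × (NSimplex p × ℤ)

/-- The element `(F; x)` of the homotopy colimit, where `F` is a `p`-simplex of the nerve of `𝓘`. -/
def hGen (P : ICat ⥤ Ch.{u, v} k) {p : ℕ} (F : NSimplex p) :
    Gr (P.obj F.last) →ₗ[k] Gr (hocolim.obj P) :=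
  DirectSum.toModule k ℤ _ fun q => Gr.ι (hocolim.obj P) (p + q) ∘ₗ
    totGen ((AlgebraicTopology.alternatingFaceMapComplex _).obj (srep.obj P)) p q (p + q) rfl ∘ₗ
      srepGen P F q

/-- The underlying graded module of the homotopy colimit, decomposed into its summands. -/
def hCoord (P : ICat ⥤ Ch.{u, v} k) :
    Gr (hocolim.obj P) →ₗ[k] Π₀ a : HIndex, (P.obj a.2.1.last).X a.2.2 :=
  DirectSum.toModule k ℤ _ fun n =>
    DirectSum.toModule k {a : ℕ × ℤ // a.1 + a.2 = n} _ fun a =>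
      DirectSum.toModule k (NSimplex a.1.1) _ fun F =>
        DFinsupp.lsingle (M := fun a : HIndex => (P.obj a.2.1.last).X a.2.2) ⟨a.1.1, F, a.1.2⟩

/-- The action of the translation category operad on `𝓘`, on the level of simplices of the nerves:
at the vertex `t` it has the object `m_{σ⁻¹(0)} ⊔ ⋯ ⊔ m_{σ⁻¹(s-1)}` with `σ = c t` and `m_i` the
object of `G i` at `t`. The morphisms are given by the morphisms of the `G i` on the blocks and
permute the blocks as prescribed by `c`. -/
def actSimplex {s N : ℕ} (c : ESimplex s N) (G : Fin s → NSimplex N) : NSimplex N where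
  obj t := ICat.sum fun i => (G ((c t.unop).symm i)).obj t
  map {t t'} f := ICat.ofEmb
    (((blockEquiv (c t.unop) fun i => ((G i).obj t).card).toEmbedding.trans
      (Function.Embedding.sigmaMap (Function.Embedding.refl _)
        fun i => ICat.toEmb ((G i).map f))).trans
      (blockEquiv (c t'.unop) fun i => ((G i).obj t').card).symm.toEmbedding)
  map_id t := by
    refine Function.Embedding.ext fun x => ?_
    refine ((blockEquiv (c t.unop) fun i => ((G i).obj t).card).symm_apply_eq).2 ?_
    exact Sigma.ext rfl (heq_of_eq (congrArg (fun h => ICat.toEmb h _) ((G _).map_id t)))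
  map_comp {t t' t''} f g := by
    refine Function.Embedding.ext fun x => ?_
    let e := blockEquiv (c t.unop) fun i => ((G i).obj t).card
    let e' := blockEquiv (c t'.unop) fun i => ((G i).obj t').card
    let e'' := blockEquiv (c t''.unop) fun i => ((G i).obj t'').card
    change e''.symm (Sigma.map id (fun i => ICat.toEmb ((G i).map (f ≫ g))) (e x)) =
      e''.symm (Sigma.map id (fun i => ICat.toEmb ((G i).map g))
        (e' (e'.symm (Sigma.map id (fun i => ICat.toEmb ((G i).map f)) (e x)))))
    rw [Equiv.apply_symm_apply]
    refine congrArg e''.symm ?_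
    exact Sigma.ext rfl (heq_of_eq (congrArg (fun h => ICat.toEmb h (e x).2) ((G _).map_comp f g)))

/-- The action of a simplex `c` of `N(Σ̃_s)` on elements `(F i; x i)` of the homotopy colimit, with
`F i` an `r i`-simplex of the nerve of `𝓘` and `x i` of degree `q i`. It is the composite of

* the structure map of the total complex, with sign `(-1)^(∑_{i<j} q i * r j)`,
* the shuffle map, i.e. the signed sum over all shuffles of the corresponding degeneracies, and
* the action of simplices `c` of `N(Σ̃_s)` on simplices `(G i; y i)` of the simplicial replacement
  of the same dimension, which is given by `actSimplex c G` on the indices and, for `σ` the last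
  vertex of `c`, by the product `y (σ⁻¹ 0) ⋯ y (σ⁻¹ (s - 1))` with the sign of this permutation of
  graded elements. -/
def actGen (E : CommIDGA.{u, v} k) {s : ℕ} (c : (p : ℕ) × ESimplex s p) (a : Fin s → HIndex) :
    MultilinearMap k (fun i => (E.toFunctor.obj (a i).2.1.last).X (a i).2.2)
      (Gr (hocolim.obj E.toFunctor)) :=
  sgn (∑ i, ∑ j, if i < j then (a i).2.2 * ((a j).1 : ℤ) else 0) •
    ∑ w : Shuffle (Fin.cons c.1 (fun i => (a i).1) : Fin (s + 1) → ℕ),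
      w.sign •
        let c' : ESimplex s _ := fun t => c.2 (w.deg 0 t)
        let G : Fin s → NSimplex _ := fun i => (a i).2.1.pull (w.deg i.succ)
        let σ : Equiv.Perm (Fin s) := c' (Fin.last _)
        koszul σ (fun i => (a i).2.2) •
          ((hGen E.toFunctor (actSimplex c' G)).compMultilinearMap
            ((MultilinearMap.domDomCongrLinearEquiv' k k
                (fun i => Gr (E.toFunctor.obj (G i).last)) _ σ).symm
              (E.prod s fun i => (G (σ.symm i)).last))).compLinearMap
            fun i => Gr.map (E.toFunctor.map ((a i).2.1.lastHom (w.deg i.succ))) ∘ₗ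
              Gr.ι (E.toFunctor.obj (a i).2.1.last) (a i).2.2

open scoped Classical in
/-- The action of the Barratt--Eccles operad on the homotopy colimit, the multilinear extension of
`actGen`. -/
def hocolimAction (E : CommIDGA.{u, v} k) (s : ℕ) :
    Gr (beObj k s) →ₗ[k] MultilinearMap k
      (fun _ : Fin s => Gr (hocolim.obj E.toFunctor)) (Gr (hocolim.obj E.toFunctor)) :=
  DFinsupp.lsum k (fun c : (p : ℕ) × ESimplex s p => LinearMap.toSpanSingleton k _
    ((MultilinearMap.fromDFinsuppEquiv (fun _ : Fin s => HIndex) k fun a => actGen E c a).compLinearMap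
      fun _ => hCoord E.toFunctor)) ∘ₗ beCoord k s

end Hocolim

end IDGA

end

noncomputable section

namespace IDGA

/-! ### Signs -/

/-! All structure maps are multilinear, so every identity is checked on generators: simplices of the
nerve of the translation category for the operad, and pairs `(F; x)` with `x` homogeneous for the
homotopy colimit. On generators the operadic composition and the action have the same shape `shSum`:
a signed sum over shuffles of an operation on simplices of one common dimension, evaluated on the
degeneracies prescribed by the shuffle. For the operad the operation is `permComp` at every vertex
(`beLevel`); for the action it is `actLevel`, with an additional global sign of exponent `totExp`.
The axioms thereby separate into three problems.

Shuffle sums. A shuffle is a word in which the letter `i` occurs `r i` times, and the degeneracy of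
the `i`-th factor is the counting function `cnt w i`. A face at a vertex between two different
letters does not see their order, so it cancels against the word with these letters exchanged; the
remaining faces are faces of a single factor (`sum_words_faces`, `shSum_faces`). Symmetry is a
relabelling of letters (`shSum_perm`). For associativity, nested shuffles are words in the union of
all letters; the two ways of nesting give the same words and differ only in the order of letters
that defines the sign (`sum_words_nest`, `wsign_change`, `shSum_assoc`).

Identities in a fixed dimension. The laws of `permComp` hold because both sides compute a position
as the offset of a block plus a position inside the block (`nested_block_sum`). For the action the
decisive point is that `actLevel` commutes with the simplicial operators (`pull_actLevel`). An
operator that moves the last vertex changes both the coefficients and the permutation that orders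
their product. Compatibility with it is the commutativity of `E`: the signed products in two orders
correspond to each other under a block permutation (`permComm`, obtained from adjacent
transpositions, and `map_blkHom`).

Signs. The Koszul signs and the signs of the total complex are compared through their exponents
modulo 2, pair of indices by pair of indices (`koszul_mul`, `koszul_permComp`, `koszul_update`,
`koszul_add`, `totExp_nested`). Naturality only needs that morphisms preserve finite products. -/

theorem sgn_add (a b : ℤ) : sgn (a + b) = sgn a * sgn b := by
  simp [sgn, Int.negOnePow_add]

@[simp]
theorem sgn_zero : sgn 0 = 1 := by simp [sgn]

theorem sgn_natCast (n : ℕ) : sgn n = (-1) ^ n := by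
  simp [sgn, Int.negOnePow]

/-- The sign identities below are proved by exhibiting half of the difference of two exponents, or
by checking its parity term by term. -/
theorem sgn_congr {a b : ℤ} (h : Even (a - b)) : sgn a = sgn b := by
  simp only [sgn, (Int.negOnePow_eq_iff a b).2 h]

theorem sgn_mul_self (a : ℤ) : sgn a * sgn a = 1 := by
  rw [← sgn_add, ← sgn_zero]
  exact sgn_congr (by simp)

theorem neg_one_pow_congr {a b : ℕ} (h : Even ((a : ℤ) - b)) : (-1 : ℤ) ^ a = (-1) ^ b := by
  rw [← sgn_natCast, ← sgn_natCast, sgn_congr h]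

/-! ### Words -/

section Words

variable {ι : Type*} [DecidableEq ι] {N : ℕ}

/-- The number of letters `i` of the word `w` in positions before `t`. -/
def cnt (w : Fin N → ι) (i : ι) (t : ℕ) : ℕ :=
  (Finset.univ.filter fun u : Fin N => u.val < t ∧ w u = i).card

theorem cnt_eq_sum (w : Fin N → ι) (i : ι) (t : ℕ) :
    cnt w i t = ∑ u : Fin N, if u.val < t ∧ w u = i then 1 else 0 := by
  rw [cnt, Finset.card_filter]

@[simp]
theorem cnt_zero (w : Fin N → ι) (i : ι) : cnt w i 0 = 0 := by simp [cnt]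

theorem cnt_succ (w : Fin N → ι) (i : ι) {t : ℕ} (h : t < N) :
    cnt w i (t + 1) = cnt w i t + if w ⟨t, h⟩ = i then 1 else 0 := by
  have h1 : ∀ u : Fin N, (if u.val < t + 1 ∧ w u = i then 1 else 0) =
      (if u.val < t ∧ w u = i then 1 else 0) +
        if u = ⟨t, h⟩ then (if w u = i then 1 else 0) else 0 := by
    intro u
    by_cases hu : u = ⟨t, h⟩
    · subst hu; simp
    · have : u.val ≠ t := fun h' => hu (Fin.ext h')
      have h2 : u.val < t + 1 ↔ u.val < t := by omega
      simp [hu, h2]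
  rw [cnt_eq_sum, cnt_eq_sum, Finset.sum_congr rfl fun u _ => h1 u, Finset.sum_add_distrib]
  simp

theorem cnt_mono (w : Fin N → ι) (i : ι) : Monotone (cnt w i) := fun t t' h => by
  refine Finset.card_le_card fun u hu => ?_
  simp only [Finset.mem_filter, Finset.mem_univ, true_and] at hu ⊢
  exact ⟨hu.1.trans_le h, hu.2⟩

theorem cnt_self (w : Fin N → ι) (i : ι) :
    cnt w i N = (Finset.univ.filter fun u : Fin N => w u = i).card := by
  simp [cnt]

theorem cnt_le_self (w : Fin N → ι) (i : ι) (t : ℕ) : cnt w i t ≤ cnt w i N := by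
  rw [cnt_self]
  exact Finset.card_le_card fun u hu => by simp_all

theorem cnt_lt_of_eq (w : Fin N → ι) {i : ι} (t : Fin N) (h : w t = i) {t' : ℕ}
    (ht : t.val < t') : cnt w i t < cnt w i t' := by
  have := cnt_succ w i t.2
  rw [Fin.eta, if_pos h] at this
  exact (by omega : cnt w i t < cnt w i (t + 1)).trans_le (cnt_mono w i ht)

theorem cnt_inj (w : Fin N → ι) {i : ι} {t t' : Fin N} (h : w t = i) (h' : w t' = i)
    (he : cnt w i t = cnt w i t') : t = t' := by
  rcases lt_trichotomy t t' with h1 | h1 | h1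
  · exact absurd he (cnt_lt_of_eq w t h h1).ne
  · exact h1
  · exact absurd he (cnt_lt_of_eq w t' h' h1).ne'

/-- The words of length `N` in which the letter `i` occurs `r i` times. -/
def words [Fintype ι] (N : ℕ) (r : ι → ℕ) : Finset (Fin N → ι) :=
  Finset.univ.filter fun w => ∀ i, (Finset.univ.filter fun t => w t = i).card = r i

theorem mem_words [Fintype ι] {r : ι → ℕ} {w : Fin N → ι} :
    w ∈ words N r ↔ ∀ i, cnt w i N = r i := by
  simp [words, cnt_self]

theorem card_letters [Fintype ι] (w : Fin N → ι) (p : ι → Prop) [DecidablePred p] :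
    (Finset.univ.filter fun t => p (w t)).card = ∑ i, if p i then cnt w i N else 0 := by
  rw [Finset.card_filter]
  have h : ∀ i, (if p i then cnt w i N else 0) = ∑ t, if w t = i then (if p (w t) then 1 else 0) else 0 := by
    intro i
    rw [cnt_self, Finset.card_filter]
    split_ifs with hi
    · exact Finset.sum_congr rfl fun t _ => by
        split_ifs with h1 h2 <;> simp_all
    · exact (Finset.sum_eq_zero fun t _ => by
        split_ifs with h1 h2 <;> simp_all).symm
  rw [Finset.sum_congr rfl fun i _ => h i, Finset.sum_comm]
  simp

theorem sum_of_mem_words [Fintype ι] {r : ι → ℕ} {w : Fin N → ι} (hw : w ∈ words N r) :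
    ∑ i, r i = N := by
  have := card_letters w fun _ => True
  simpa [mem_words.1 hw] using this.symm

/-- The number of inversions of a word. -/
def inv (lt : ι → ι → Prop) [DecidableRel lt] (w : Fin N → ι) : ℕ :=
  (Finset.univ.filter fun t : Fin N × Fin N => t.1 < t.2 ∧ lt (w t.2) (w t.1)).card

omit [DecidableEq ι] in
theorem inv_eq_sum (lt : ι → ι → Prop) [DecidableRel lt] (w : Fin N → ι) :
    inv lt w = ∑ t, ∑ u, if u < t ∧ lt (w t) (w u) then 1 else 0 := by
  rw [inv, Finset.card_filter, Fintype.sum_prod_type, Finset.sum_comm]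

/-- The sign of the permutation that sorts the letters of a word. -/
def wsign (lt : ι → ι → Prop) [DecidableRel lt] (w : Fin N → ι) : ℤ := (-1) ^ inv lt w

/-! ### Faces of shuffles -/

theorem cnt_removeNth_of_le (w : Fin (N + 1) → ι) (k : Fin (N + 1)) (i : ι) {t : ℕ}
    (ht : t ≤ k.val) : cnt (w ∘ k.succAbove) i t = cnt w i t := by
  induction t with
  | zero => simp
  | succ t ih =>
    have h1 : t < N := by omega
    have h2 : k.succAbove ⟨t, h1⟩ = ⟨t, by omega⟩ :=
      Fin.succAbove_of_castSucc_lt _ _ (Fin.lt_def.2 (by simpa using ht))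
    rw [cnt_succ _ _ h1, cnt_succ _ _ (by omega : t < N + 1), ih (by omega), Function.comp, h2]

/-- Beyond the removed position the indices shift by one and the removed letter is no longer
counted. The additive form avoids truncated subtraction. -/
theorem cnt_removeNth_of_ge (w : Fin (N + 1) → ι) (k : Fin (N + 1)) (i : ι) {t : ℕ}
    (ht : k.val ≤ t) (hN : t ≤ N) :
    cnt (w ∘ k.succAbove) i t + (if w k = i then 1 else 0) = cnt w i (t + 1) := by
  induction t, ht using Nat.le_induction with
  | base => rw [cnt_removeNth_of_le _ _ _ le_rfl, cnt_succ _ _ k.2]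
  | succ t ht ih =>
    have h1 : t < N := by omega
    have h2 : k.succAbove ⟨t, h1⟩ = ⟨t + 1, by omega⟩ :=
      Fin.succAbove_of_le_castSucc _ _ (Fin.le_def.2 (by simpa using ht))
    rw [cnt_succ _ _ h1, cnt_succ _ _ (by omega : t + 1 < N + 1), ← ih (by omega),
      Function.comp, h2]
    omega

omit [DecidableEq ι] in
-- Inversions are sorted by whether they avoid the position `k`, have it as their later position, or
-- have it as their earlier one.
theorem inv_removeNth (lt : ι → ι → Prop) [DecidableRel lt] (w : Fin (N + 1) → ι)
    (k : Fin (N + 1)) :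
    inv lt w = inv lt (w ∘ k.succAbove) + (∑ u, if u < k ∧ lt (w k) (w u) then 1 else 0) +
      ∑ u, if k < u ∧ lt (w u) (w k) then 1 else 0 := by
  rw [inv_eq_sum, inv_eq_sum, Fin.sum_univ_succAbove _ k,
    Finset.sum_congr rfl fun t _ => Fin.sum_univ_succAbove _ k, Finset.sum_add_distrib,
    Fin.sum_univ_succAbove (fun u => if k < u ∧ lt (w u) (w k) then 1 else 0) k]
  simp only [Function.comp, Fin.succAbove_lt_succAbove_iff, lt_irrefl, false_and, if_false,
    zero_add]
  omega

end Words

end IDGA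

end

/-! ### Adjacent exchanges of letters and the faces of shuffles -/

noncomputable section

namespace IDGA

section Faces

variable {ι : Type*} {N m : ℕ}

/-- An exchange of two adjacent positions preserves every initial segment except the one that
separates them. Hence counting functions change at the single vertex `b`, which is what makes the
face omitting `b` blind to the exchange. -/
theorem swap_succ_lt_iff {a b : Fin N} (hab : b.val = a.val + 1) (u : Fin N) {t : ℕ}
    (ht : t ≠ b.val) : (Equiv.swap a b u).val < t ↔ u.val < t := by
  rw [Equiv.swap_apply_def]
  split_ifs with h1 h2
  · subst h1; omega
  · subst h2; omega
  · rfl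

theorem cnt_comp_swap [DecidableEq ι] (w : Fin N → ι) {a b : Fin N} (hab : b.val = a.val + 1)
    (i : ι) {t : ℕ} (ht : t ≠ b.val) : cnt (w ∘ Equiv.swap a b) i t = cnt w i t := by
  rw [cnt_eq_sum, cnt_eq_sum, ← Equiv.sum_comp (Equiv.swap a b)]
  exact Finset.sum_congr rfl fun u _ => by
    simp only [Function.comp, Equiv.swap_apply_self, swap_succ_lt_iff hab u ht]

theorem inv_comp_swap (lt : ι → ι → Prop) [DecidableRel lt] (w : Fin N → ι) {a b : Fin N}
    (hab : b.val = a.val + 1) :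
    inv lt (w ∘ Equiv.swap a b) + (if lt (w b) (w a) then 1 else 0) =
      inv lt w + if lt (w a) (w b) then 1 else 0 := by
  -- After reindexing both positions by the exchange, the indicators of inversions agree for all
  -- pairs except the exchanged one; the extra summands record that pair on either side.
  have key : ∀ t u : Fin N,
      ((if Equiv.swap a b u < Equiv.swap a b t ∧ lt (w t) (w u) then 1 else 0) +
        if t = b then (if u = a then (if lt (w b) (w a) then 1 else 0) else 0) else 0) =
      (if u < t ∧ lt (w t) (w u) then 1 else 0) +
        if t = a then (if u = b then (if lt (w a) (w b) then 1 else 0) else 0) else 0 := by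
    intro t u
    have hne : a ≠ b := fun h => by rw [h] at hab; omega
    by_cases hta : t = a
    · subst hta
      by_cases hub : u = b
      · subst hub
        have h1 : ¬ u < t := by rw [Fin.lt_def]; omega
        have h2 : t < u := by rw [Fin.lt_def]; omega
        simp [hne, h1, h2]
      · by_cases hua : u = t
        · subst hua; simp [hub]
        · have h1 : b > u ↔ u < t := by
            have := Fin.val_ne_of_ne hub
            have := Fin.val_ne_of_ne hua
            rw [gt_iff_lt, Fin.lt_def, Fin.lt_def]; omega
          simp [hub, hne, Equiv.swap_apply_of_ne_of_ne hua hub, h1]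
    · by_cases htb : t = b
      · subst htb
        by_cases hua : u = a
        · subst hua
          have h1 : ¬ t < u := by rw [Fin.lt_def]; omega
          have h2 : u < t := by rw [Fin.lt_def]; omega
          simp [hta, h1, h2]
        · by_cases hub : u = t
          · subst hub; simp [hta]
          · have h1 : a > u ↔ u < t := by
              have := Fin.val_ne_of_ne hub
              have := Fin.val_ne_of_ne hua
              rw [gt_iff_lt, Fin.lt_def, Fin.lt_def]; omega
            simp [hua, hta, Equiv.swap_apply_of_ne_of_ne hua hub, h1]
      · have h1 : Equiv.swap a b u < t ↔ u < t :=
          swap_succ_lt_iff hab u (Fin.val_ne_of_ne htb)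
        simp [hta, htb, Equiv.swap_apply_of_ne_of_ne hta htb, h1]
  have h := Finset.sum_congr rfl fun t (_ : t ∈ Finset.univ) =>
    Finset.sum_congr rfl fun u (_ : u ∈ Finset.univ) => key t u
  simp only [Finset.sum_add_distrib] at h
  rw [← inv_eq_sum] at h
  have h' : inv lt (w ∘ Equiv.swap a b) = ∑ t, ∑ u,
      if Equiv.swap a b u < Equiv.swap a b t ∧ lt (w t) (w u) then 1 else 0 := by
    rw [inv_eq_sum, ← Equiv.sum_comp (Equiv.swap a b)]
    refine Finset.sum_congr rfl fun t _ => ?_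
    rw [← Equiv.sum_comp (Equiv.swap a b)]
    simp only [Function.comp, Equiv.swap_apply_self]
  rw [← h'] at h
  simpa using h

theorem wsign_comp_swap (w : Fin N → Fin m) {a b : Fin N} (hab : b.val = a.val + 1)
    (hw : w a ≠ w b) : wsign (· < ·) (w ∘ Equiv.swap a b) = - wsign (· < ·) w := by
  have h := inv_comp_swap (· < ·) w hab
  unfold wsign
  rcases lt_or_gt_of_ne hw with h1 | h1
  · rw [if_neg (by exact h1.not_gt), if_pos (by exact h1)] at h
    rw [add_zero] at h
    rw [h, pow_succ, mul_neg_one]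
  · rw [if_pos (by exact h1), if_neg (by exact h1.not_gt)] at h
    rw [add_zero] at h
    rw [← h, pow_succ, mul_neg_one, neg_neg]

/-- The coface map that omits `k`. -/
def face (k t : ℕ) : ℕ := if t < k then t else t + 1

/-- The `k` letters before the vertex `k` are smaller than, equal to or larger than the removed
letter. The larger ones cancel modulo 2 against their inversions with it. The smaller ones, together
with the smaller letters after it, make up all smaller letters. The equal ones give the sign of the
face of the single factor. -/
theorem wsign_removeNth (w : Fin (N + 1) → Fin m) (k' : Fin (N + 1)) {k : ℕ}
    (h : k = k'.val ∨ k = k'.val + 1) :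
    wsign (· < ·) w * (-1) ^ k = sgn (∑ i ∈ Finset.Iio (w k'), (cnt w i (N + 1) : ℤ)) *
      ((-1) ^ cnt w (w k') k * wsign (· < ·) (w ∘ k'.succAbove)) := by
  have h0 := inv_removeNth (· < ·) w k'
  set i0 := w k'
  have h1 : (∑ u : Fin (N + 1), if u.val < k ∧ w u < i0 then 1 else 0) + cnt w i0 k +
      (∑ u : Fin (N + 1), if u < k' ∧ i0 < w u then 1 else 0) = k := by
    have hc : (Finset.univ.filter fun u : Fin (N + 1) => u.val < k).card = k := by
      rw [Fin.card_filter_val_lt]; have := k'.2; omega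
    rw [Finset.card_filter] at hc
    rw [cnt_eq_sum, ← Finset.sum_add_distrib, ← Finset.sum_add_distrib]
    refine Eq.trans (Finset.sum_congr rfl fun u _ => ?_) hc
    by_cases hu : u = k'
    · subst hu
      rcases h with rfl | rfl <;> simp [i0]
    · have h2 : u < k' ↔ u.val < k := by
        have := Fin.val_ne_of_ne hu
        rw [Fin.lt_def]; omega
      rcases lt_trichotomy (w u) i0 with h3 | h3 | h3
      · simp [h2, h3, h3.ne, h3.not_gt]
      · simp [h3]
      · simp [h2, h3, h3.ne', h3.not_gt]
  have h2 : (∑ u : Fin (N + 1), if u.val < k ∧ w u < i0 then 1 else 0) +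
      (∑ u : Fin (N + 1), if k' < u ∧ w u < i0 then 1 else 0) =
      ∑ i ∈ Finset.Iio i0, cnt w i (N + 1) := by
    have hc := card_letters w (· < i0)
    rw [Finset.card_filter] at hc
    rw [← Finset.sum_add_distrib]
    refine Eq.trans (Finset.sum_congr rfl fun u _ => ?_) (hc.trans ?_)
    · by_cases hu : u = k'
      · subst hu; simp [i0]
      · have h2 : u < k' ↔ u.val < k := by
          have := Fin.val_ne_of_ne hu
          rw [Fin.lt_def]; omega
        by_cases h4 : u < k'
        · simp [h2.1 h4, h4.not_gt]
        · simp [mt h2.2 h4, lt_of_le_of_ne (not_lt.1 h4) (Ne.symm hu)]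
    · rw [← Finset.sum_filter]
      exact Finset.sum_congr (by ext; simp) fun _ _ => rfl
  rw [← Nat.cast_sum, sgn_natCast, wsign, wsign, ← pow_add, ← pow_add, ← pow_add]
  refine neg_one_pow_congr ?_
  rw [h0]
  -- The larger letters in earlier positions are counted twice: once among the inversions of `w` and
  -- once in `k`.
  refine ⟨∑ u : Fin (N + 1), if u < k' ∧ i0 < w u then 1 else 0, ?_⟩
  push_cast at h1 h2 ⊢
  zify at h1 h2
  linarith

theorem removeNth_mem_words {r : Fin m → ℕ} {w : Fin (N + 1) → Fin m} (hw : w ∈ words (N + 1) r)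
    (k : Fin (N + 1)) :
    w ∘ k.succAbove ∈ words N (Function.update r (w k) (r (w k) - 1)) := by
  rw [mem_words] at hw ⊢
  intro i
  have h := cnt_removeNth_of_ge w k i (Nat.lt_succ_iff.1 k.2) le_rfl
  rw [hw] at h
  by_cases hi : i = w k
  · subst hi; simp at h ⊢; omega
  · simpa [hi, Ne.symm hi] using h

/-- The position `k' = min k N` is that of the letter following the vertex `k`, or of the last
letter if `k` is the last vertex. For the other factors, passing to the face just deletes this
letter. -/
theorem cnt_face_of_ne {w : Fin (N + 1) → Fin m} {k : ℕ} {k' : Fin (N + 1)}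
    (hk' : k'.val = min k N) {i : Fin m} (hi : i ≠ w k') {t : ℕ} (ht : t ≤ N) :
    cnt w i (face k t) = cnt (w ∘ k'.succAbove) i t := by
  unfold face
  split_ifs with h
  · rw [cnt_removeNth_of_le _ _ _ (by omega)]
  · rw [← cnt_removeNth_of_ge _ k' i (by omega) ht, if_neg (Ne.symm hi), add_zero]

/-- The hypothesis `hg` says that the letters on the two sides of an inner vertex `k` agree.
Omitting `k` then merges two steps of the same factor, which amounts to omitting one vertex of that
factor. -/
theorem cnt_face_self {w : Fin (N + 1) → Fin m} {k : ℕ} {k' : Fin (N + 1)}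
    (hk' : k'.val = min k N) (hk : k ≤ N + 1)
    (hg : ∀ t (h : t + 1 < N + 1), k = t + 1 → w ⟨t, by omega⟩ = w ⟨t + 1, h⟩)
    {t : ℕ} (ht : t ≤ N) :
    cnt w (w k') (face k t) = face (cnt w (w k') k) (cnt (w ∘ k'.succAbove) (w k') t) := by
  by_cases h : t < k
  · rw [face, if_pos h, cnt_removeNth_of_le _ _ _ (by omega), face, if_pos]
    obtain ⟨j, rfl⟩ : ∃ j, k = j + 1 := ⟨k - 1, by omega⟩
    have h1 : w ⟨j, by omega⟩ = w k' := by
      by_cases hj : j + 1 < N + 1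
      · rw [hg j hj rfl]
        exact congrArg w (Fin.ext (by simp only; omega))
      · exact congrArg w (Fin.ext (by simp only; omega))
    exact (cnt_mono w _ (by omega : t ≤ j)).trans_lt
      (cnt_lt_of_eq w ⟨j, by omega⟩ h1 (Nat.lt_succ_self j))
  · have h1 : k = k'.val := by omega
    have h2 := cnt_removeNth_of_ge w k' (w k') (by omega : k'.val ≤ t) ht
    rw [if_pos rfl] at h2
    have h3 : ¬ cnt (w ∘ k'.succAbove) (w k') t < cnt w (w k') k := by
      rw [not_lt, h1, ← cnt_removeNth_of_le w k' _ le_rfl]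
      exact cnt_mono _ _ (by omega)
    rw [face, if_neg h, ← h2, face, if_neg h3]

/-- If two vertices `k₁ < k₂` led to the same remaining word and the same face of the same factor,
the letter would occur equally often before both of them. This fails since a copy of the letter
stands directly before `k₂`. -/
theorem face_data_inj {r : Fin m → ℕ} {w₁ w₂ : Fin (N + 1) → Fin m}
    (hw₂ : w₂ ∈ words (N + 1) r) {k₁ k₂ : ℕ} {k₁' k₂' : Fin (N + 1)} (h₁ : k₁'.val = min k₁ N)
    (h₂ : k₂'.val = min k₂ N) (hk₁ : k₁ ≤ N + 1) (hk₂ : k₂ ≤ N + 1)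
    (hg₂ : ∀ t (h : t + 1 < N + 1), k₂ = t + 1 → w₂ ⟨t, by omega⟩ = w₂ ⟨t + 1, h⟩)
    (hi : w₁ k₁' = w₂ k₂') (hl : cnt w₁ (w₁ k₁') k₁ = cnt w₂ (w₂ k₂') k₂)
    (hw : w₁ ∘ k₁'.succAbove = w₂ ∘ k₂'.succAbove) : ¬ k₁ < k₂ := by
  intro hlt
  have e₁ := cnt_removeNth_of_le w₁ k₁' (w₁ k₁') (t := k₁) (by omega)
  rw [← e₁, hw, hi] at hl
  have hr := mem_words.1 hw₂ (w₂ k₂')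
  -- At the last vertex all copies of the letter are counted, one more than are left after the
  -- removal.
  by_cases h : k₂ = N + 1
  · have h3 := cnt_removeNth_of_ge w₂ k₂' (w₂ k₂') (Nat.lt_succ_iff.1 k₂'.2) le_rfl
    rw [if_pos rfl] at h3
    subst h
    have h4 := cnt_le_self (w₂ ∘ k₂'.succAbove) (w₂ k₂') k₁
    omega
  · have e₂ := cnt_removeNth_of_le w₂ k₂' (w₂ k₂') (t := k₂) (by omega)
    rw [← e₂] at hl
    obtain ⟨j, rfl⟩ : ∃ j, k₂ = j + 1 := ⟨k₂ - 1, by omega⟩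
    have h3 := hg₂ j (by omega) rfl
    have h4 : (w₂ ∘ k₂'.succAbove) ⟨j, by omega⟩ = w₂ k₂' := by
      have : k₂'.succAbove ⟨j, by omega⟩ = ⟨j, by omega⟩ :=
        Fin.succAbove_of_castSucc_lt _ _ (Fin.lt_def.2 (by simp only [Fin.castSucc_mk]; omega))
      rw [Function.comp, this, h3]
      exact congrArg w₂ (Fin.ext (by simp only; omega))
    have h5 := cnt_lt_of_eq (w₂ ∘ k₂'.succAbove) ⟨j, by omega⟩ h4 (by simp : j < j + 1)
    have h6 := cnt_mono (w₂ ∘ k₂'.succAbove) (w₂ k₂') (by omega : k₁ ≤ j)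
    simp only at h5
    omega

theorem face_data_surj {r : Fin m → ℕ} {i : Fin m} (hi : r i ≠ 0) {l : ℕ} (hl : l ≤ r i)
    {w' : Fin N → Fin m} (hw' : w' ∈ words N (Function.update r i (r i - 1))) :
    ∃ (w : Fin (N + 1) → Fin m) (k : ℕ) (k' : Fin (N + 1)), w ∈ words (N + 1) r ∧ k ≤ N + 1 ∧
      k'.val = min k N ∧
      (∀ t (h : t + 1 < N + 1), k = t + 1 → w ⟨t, by omega⟩ = w ⟨t + 1, h⟩) ∧
      w k' = i ∧ cnt w i k = l ∧ w ∘ k'.succAbove = w' := by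
  have hmem : ∀ k' : Fin (N + 1), Fin.insertNth (α := fun _ => Fin m) k' i w' ∈ words (N + 1) r := by
    intro k'
    rw [mem_words] at hw' ⊢
    intro a
    have h := cnt_removeNth_of_ge (Fin.insertNth (α := fun _ => Fin m) k' i w') k' a
      (Nat.lt_succ_iff.1 k'.2) le_rfl
    rw [← h]
    have h2 : Fin.insertNth (α := fun _ => Fin m) k' i w' ∘ k'.succAbove = w' := by
      ext; simp
    rw [h2, hw']
    by_cases ha : a = i
    · subst ha; simp; omega
    · simp [ha, Ne.symm ha]
  have hrem : ∀ k' : Fin (N + 1), Fin.insertNth (α := fun _ => Fin m) k' i w' ∘ k'.succAbove = w' :=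
    fun k' => by ext; simp
  have htot : cnt w' i N = r i - 1 := by simpa using mem_words.1 hw' i
  -- The letter `i` is inserted at the first vertex with at least `l` copies of `i` before it; by
  -- minimality the preceding letter, if there is one, is `i` and the count is exactly `l`. If no
  -- vertex qualifies, then `l = r i`, and the letter is appended with `k` the last vertex.
  by_cases h : l ≤ cnt w' i N
  · let p : ℕ → Prop := fun t => l ≤ cnt w' i t
    have hex : ∃ t, p t := ⟨N, h⟩
    have hk : Nat.find hex ≤ N := Nat.find_min' hex h
    have hkl : l ≤ cnt w' i (Nat.find hex) := Nat.find_spec hex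
    have hmin : ∀ t, t < Nat.find hex → ¬ l ≤ cnt w' i t := fun t ht => Nat.find_min hex ht
    generalize Nat.find hex = k at hk hkl hmin
    have hlast : ∀ t (ht : t < N), k = t + 1 → w' ⟨t, ht⟩ = i ∧ cnt w' i k = l := by
      rintro t ht rfl
      have h1 := hmin t (Nat.lt_succ_self t)
      rw [cnt_succ _ _ ht] at hkl ⊢
      split_ifs at hkl ⊢ with h2
      · exact ⟨h2, by omega⟩
      · omega
    refine ⟨Fin.insertNth (α := fun _ => Fin m) ⟨k, by omega⟩ i w', k, ⟨k, by omega⟩, hmem _,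
      by omega, by simp only; omega, ?_, by simp, ?_, hrem _⟩
    · rintro t ht rfl
      have h1 : (⟨t + 1, by omega⟩ : Fin (N + 1)).succAbove ⟨t, by omega⟩ = ⟨t, by omega⟩ :=
        Fin.succAbove_of_castSucc_lt _ _ (Fin.lt_def.2 (by simp))
      rw [← h1, Fin.insertNth_apply_succAbove, Fin.insertNth_apply_same]
      exact (hlast t (by omega) rfl).1
    · rw [← cnt_removeNth_of_le _ ⟨k, by omega⟩ _ le_rfl, hrem]
      rcases k with _ | k
      · have : l ≤ 0 := by simpa using hkl
        simp; omega
      · exact (hlast k (by omega) rfl).2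
  · refine ⟨Fin.insertNth (α := fun _ => Fin m) (Fin.last N) i w', N + 1, Fin.last N, hmem _, le_rfl,
      by simp, fun t ht h => by omega, by simp, ?_, hrem _⟩
    rw [mem_words.1 (hmem _)]
    omega

/-- The combinatorial core of the fact that the shuffle map is a chain map: the faces of the
simplices of a product of simplices, indexed by shuffles. -/
theorem sum_words_faces {M : Type*} [AddCommGroup M] (r : Fin m → ℕ)
    (φ : (Fin m → Fin (N + 1) → ℕ) → M) :
    ∑ w ∈ words (N + 1) r, wsign (· < ·) w • ∑ k : Fin (N + 2),
      (-1 : ℤ) ^ k.val • φ (fun i t => cnt w i (face k t)) =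
    ∑ i, sgn (∑ i' ∈ Finset.Iio i, (r i' : ℤ)) • if r i = 0 then 0 else
      ∑ l ∈ Finset.range (r i + 1), (-1 : ℤ) ^ l •
        ∑ w ∈ words N (Function.update r i (r i - 1)), wsign (· < ·) w •
          φ (Function.update (fun i t => cnt w i t) i fun t => face l (cnt w i t)) := by
  -- The pair is good if the vertex is an end vertex or lies between two equal letters.
  let good : (Fin (N + 1) → Fin m) × Fin (N + 2) → Prop := fun x =>
    ∀ t (h : t + 1 < N + 1), x.2.val = t + 1 → x.1 ⟨t, by omega⟩ = x.1 ⟨t + 1, h⟩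
  let lo : Fin (N + 2) → Fin (N + 1) := fun k => ⟨min k N, by omega⟩
  let f : (Fin (N + 1) → Fin m) × Fin (N + 2) → M := fun x =>
    (wsign (· < ·) x.1 * (-1) ^ x.2.val) • φ (fun i t => cnt x.1 i (face x.2 t))
  classical
  have hL : ∑ w ∈ words (N + 1) r, wsign (· < ·) w • ∑ k : Fin (N + 2),
      (-1 : ℤ) ^ k.val • φ (fun i t => cnt w i (face k t)) =
      ∑ x ∈ words (N + 1) r ×ˢ Finset.univ, f x := by
    rw [Finset.sum_product]
    simp only [f, Finset.smul_sum, mul_smul]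
  -- Exchanging the two different letters around the omitted vertex is a fixed-point free involution
  -- of the bad pairs; it preserves the face and reverses the sign.
  have hbad : ∑ x ∈ (words (N + 1) r ×ˢ Finset.univ).filter (fun x => ¬ good x), f x = 0 := by
    have hspec : ∀ x, ¬ good x → ∃ a b : Fin (N + 1), b.val = a.val + 1 ∧ x.2.val = b.val ∧
        x.1 a ≠ x.1 b := by
      intro x hx
      simp only [good, not_forall] at hx
      obtain ⟨t, h, h1, h2⟩ := hx
      exact ⟨⟨t, by omega⟩, ⟨t + 1, h⟩, rfl, h1, h2⟩
    -- The positions before and after the vertex, as total functions; the truncations play no role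
    -- for bad pairs, whose vertex is an inner one.
    let pa : Fin (N + 2) → Fin (N + 1) := fun k => ⟨min (k - 1) N, by omega⟩
    have hpa : ∀ (k : Fin (N + 2)) (a b : Fin (N + 1)), b.val = a.val + 1 → k.val = b.val →
        pa k = a ∧ lo k = b := fun k a b h1 h2 =>
      ⟨Fin.ext (by simp only [pa]; omega), Fin.ext (by simp only [lo]; omega)⟩
    refine Finset.sum_involution (fun x _ => (x.1 ∘ Equiv.swap (pa x.2) (lo x.2), x.2)) ?_ ?_ ?_ ?_
    · rintro ⟨w, k⟩ hx
      obtain ⟨a, b, h1, h2, h3⟩ := hspec _ (Finset.mem_filter.1 hx).2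
      obtain ⟨e1, e2⟩ := hpa k a b h1 h2
      simp only [f, e1, e2, wsign_comp_swap w h1 h3]
      rw [show (fun i (t : Fin (N + 1)) => cnt (w ∘ Equiv.swap a b) i (face k t)) =
        fun i (t : Fin (N + 1)) => cnt w i (face k t) from by
          funext i t
          refine cnt_comp_swap w h1 i ?_
          simp only at h2
          unfold face; split_ifs <;> omega]
      rw [← add_smul]
      simp
    · rintro ⟨w, k⟩ hx _ he
      obtain ⟨a, b, h1, h2, h3⟩ := hspec _ (Finset.mem_filter.1 hx).2
      obtain ⟨e1, e2⟩ := hpa k a b h1 h2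
      have := congrFun (congrArg Prod.fst he) a
      simp only [e1, e2, Function.comp, Equiv.swap_apply_left] at this
      exact h3 this.symm
    · rintro ⟨w, k⟩ hx
      obtain ⟨h0, hx'⟩ := Finset.mem_filter.1 hx
      obtain ⟨a, b, h1, h2, h3⟩ := hspec _ hx'
      obtain ⟨e1, e2⟩ := hpa k a b h1 h2
      simp only [Finset.mem_product, Finset.mem_univ, and_true] at h0
      simp only [Finset.mem_filter, Finset.mem_product, Finset.mem_univ, and_true, e1, e2]
      refine ⟨mem_words.2 fun i => ?_, fun hg => h3 ?_⟩
      · rw [cnt_comp_swap w h1 i (by omega), mem_words.1 h0]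
      · have hb : a.val + 1 < N + 1 := by omega
        have h4 := hg a.val hb (by simp only at h2 ⊢; omega)
        have h5 : (⟨a.val + 1, hb⟩ : Fin (N + 1)) = b := Fin.ext h1.symm
        simpa [h5] using h4.symm
    · rintro ⟨w, k⟩ hx
      refine Prod.ext ?_ rfl
      ext t
      simp [Function.comp]
  let B : Finset ((_ : Fin m) × (ℕ × (Fin N → Fin m))) :=
    (Finset.univ.filter fun i => r i ≠ 0).sigma fun i =>
      Finset.range (r i + 1) ×ˢ words N (Function.update r i (r i - 1))
  let g : ((_ : Fin m) × (ℕ × (Fin N → Fin m))) → M := fun y =>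
    (sgn (∑ i' ∈ Finset.Iio y.1, (r i' : ℤ)) * ((-1) ^ y.2.1 * wsign (· < ·) y.2.2)) •
      φ (Function.update (fun i t => cnt y.2.2 i t) y.1 fun t => face y.2.1 (cnt y.2.2 y.1 t))
  have hR : (∑ i, sgn (∑ i' ∈ Finset.Iio i, (r i' : ℤ)) • if r i = 0 then 0 else
      ∑ l ∈ Finset.range (r i + 1), (-1 : ℤ) ^ l •
        ∑ w ∈ words N (Function.update r i (r i - 1)), wsign (· < ·) w •
          φ (Function.update (fun i t => cnt w i t) i fun t => face l (cnt w i t))) =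
      ∑ y ∈ B, g y := by
    rw [Finset.sum_sigma, Finset.sum_filter]
    refine Finset.sum_congr rfl fun i _ => ?_
    by_cases h : r i = 0
    · simp [h]
    · rw [if_neg h, if_pos h, Finset.sum_product]
      simp only [g, Finset.smul_sum, mul_smul]
  rw [hL, hR, ← Finset.sum_filter_add_sum_filter_not _ good, hbad, add_zero]
  have hlo : ∀ k : Fin (N + 2), (lo k).val = min k.val N := fun k => rfl
  -- A good pair is determined by the factor in which the face is taken, the index of that face, and
  -- the word that remains.
  refine Finset.sum_bij (fun x _ => ⟨x.1 (lo x.2), cnt x.1 (x.1 (lo x.2)) x.2,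
    x.1 ∘ (lo x.2).succAbove⟩) ?_ ?_ ?_ ?_
  · rintro ⟨w, k⟩ hx
    simp only [Finset.mem_filter, Finset.mem_product, Finset.mem_univ, and_true] at hx
    have hr := mem_words.1 hx.1 (w (lo k))
    simp only [B, Finset.mem_sigma, Finset.mem_filter, Finset.mem_univ, true_and,
      Finset.mem_product, Finset.mem_range]
    refine ⟨?_, ?_, removeNth_mem_words hx.1 _⟩
    · have := cnt_lt_of_eq w (lo k) rfl (lo k).2
      omega
    · have := cnt_le_self w (w (lo k)) k
      omega
  · rintro ⟨w₁, k₁⟩ hx₁ ⟨w₂, k₂⟩ hx₂ he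
    simp only [Finset.mem_filter, Finset.mem_product, Finset.mem_univ, and_true] at hx₁ hx₂
    simp only [Sigma.mk.injEq, heq_eq_eq, Prod.mk.injEq] at he
    obtain ⟨h1, h2, h3⟩ := he
    have hk : k₁ = k₂ := by
      have a1 := face_data_inj hx₂.1 (hlo k₁) (hlo k₂) (by omega) (by omega) hx₂.2 h1 h2 h3
      have a2 := face_data_inj hx₁.1 (hlo k₂) (hlo k₁) (by omega) (by omega) hx₁.2
        h1.symm h2.symm h3.symm
      omega
    subst hk
    refine Prod.ext ?_ rfl
    funext t
    by_cases ht : t = lo k₁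
    · subst ht; exact h1
    · obtain ⟨t', rfl⟩ := Fin.exists_succAbove_eq ht
      exact congrFun h3 t'
  · rintro ⟨i, l, w'⟩ hy
    simp only [B, Finset.mem_sigma, Finset.mem_filter, Finset.mem_univ, true_and,
      Finset.mem_product, Finset.mem_range] at hy
    obtain ⟨w, k, k', hw, hk, hk', hg, h1, h2, h3⟩ :=
      face_data_surj hy.1 (Nat.lt_succ_iff.1 hy.2.1) hy.2.2
    have hlo' : lo ⟨k, by omega⟩ = k' := Fin.ext (by rw [hlo, hk'])
    refine ⟨(w, ⟨k, by omega⟩), ?_, ?_⟩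
    · simp only [Finset.mem_filter, Finset.mem_product, Finset.mem_univ, and_true]
      exact ⟨hw, hg⟩
    · simp only [hlo', h1, h2, h3]
  · rintro ⟨w, k⟩ hx
    simp only [Finset.mem_filter, Finset.mem_product, Finset.mem_univ, and_true] at hx
    have hk : k.val = (lo k).val ∨ k.val = (lo k).val + 1 := by rw [hlo]; omega
    have hs := wsign_removeNth w (lo k) hk
    rw [Finset.sum_congr rfl fun i _ => by rw [mem_words.1 hx.1 i]] at hs
    simp only [f, g]
    rw [hs]
    congr 2
    funext i t
    by_cases hi : i = w (lo k)
    · subst hi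
      rw [Function.update_self]
      exact cnt_face_self (hlo k) (by omega) hx.2 (by omega)
    · rw [Function.update_of_ne hi]
      exact cnt_face_of_ne (hlo k) hi (by omega)

end Faces

end IDGA

end

/-! ### Change of the order of letters, and nested words -/

noncomputable section

namespace IDGA

section Nested

variable {I K J L L' : Type*} [DecidableEq I] [DecidableEq K] [DecidableEq J] [Fintype I]
  [Fintype K] [Fintype J] [LinearOrder L] [LinearOrder L'] {N : ℕ}

theorem sum_letters {r : K → ℕ} {w : Fin N → K} (hw : w ∈ words N r) (F : K → ℤ) :
    ∑ t, F (w t) = ∑ i, r i * F i := by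
  rw [← Finset.sum_fiberwise Finset.univ w]
  refine Finset.sum_congr rfl fun i _ => ?_
  rw [Finset.sum_congr rfl fun t ht => by rw [(Finset.mem_filter.1 ht).2], Finset.sum_const,
    ← cnt_self, mem_words.1 hw]
  simp

/-- The effect on signs of words of a change of the order of the letters. -/
theorem wsign_change {r : K → ℕ} {w : Fin N → K} (hw : w ∈ words N r) {f : K → L} {g : K → L'}
    (hf : Function.Injective f) (hg : Function.Injective g) :
    wsign (fun i j => f i < f j) w =
      sgn (∑ i, ∑ j, if f i < f j ∧ g j < g i then (r i : ℤ) * r j else 0) *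
        wsign (fun i j => g i < g j) w := by
  have h1 : (∑ i, ∑ j, if f i < f j ∧ g j < g i then (r i : ℤ) * r j else 0) =
      ∑ t, ∑ u, if f (w t) < f (w u) ∧ g (w u) < g (w t) then 1 else 0 := by
    rw [sum_letters hw fun i => ∑ u, if f i < f (w u) ∧ g (w u) < g i then 1 else 0]
    refine Finset.sum_congr rfl fun i _ => ?_
    rw [sum_letters hw fun j => if f i < f j ∧ g j < g i then 1 else 0, Finset.mul_sum]
    refine Finset.sum_congr rfl fun j _ => ?_
    split_ifs <;> simp
  -- Ordered pairs of positions are folded onto the pairs with `u < t`, over which inversions are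
  -- counted.
  have h2 : (∑ t, ∑ u, if f (w t) < f (w u) ∧ g (w u) < g (w t) then (1 : ℤ) else 0) =
      ∑ t, ∑ u, if u < t then
        ((if f (w t) < f (w u) ∧ g (w u) < g (w t) then (1 : ℤ) else 0) +
          if f (w u) < f (w t) ∧ g (w t) < g (w u) then (1 : ℤ) else 0) else 0 := by
    have : ∀ t u, (if f (w t) < f (w u) ∧ g (w u) < g (w t) then (1 : ℤ) else 0) =
        (if u < t then (if f (w t) < f (w u) ∧ g (w u) < g (w t) then (1 : ℤ) else 0) else 0) +
        (if t < u then (if f (w t) < f (w u) ∧ g (w u) < g (w t) then (1 : ℤ) else 0) else 0) := by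
      intro t u
      rcases lt_trichotomy t u with h | h | h
      · simp [h, h.not_gt]
      · subst h; simp
      · simp [h, h.not_gt]
    rw [Finset.sum_congr rfl fun t _ => Finset.sum_congr rfl fun u _ => this t u]
    simp only [Finset.sum_add_distrib]
    rw [Finset.sum_comm (f := fun t u => if t < u then _ else _), ← Finset.sum_add_distrib]
    refine Finset.sum_congr rfl fun t _ => ?_
    rw [← Finset.sum_add_distrib]
    exact Finset.sum_congr rfl fun u _ => by split_ifs <;> simp
  rw [wsign, wsign, ← sgn_natCast, ← sgn_natCast, ← sgn_add]
  refine sgn_congr ?_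
  rw [h1, h2, inv_eq_sum, inv_eq_sum]
  push_cast
  rw [← Finset.sum_add_distrib, ← Finset.sum_sub_distrib]
  refine Finset.even_sum _ fun t _ => ?_
  rw [← Finset.sum_add_distrib, ← Finset.sum_sub_distrib]
  refine Finset.even_sum _ fun u _ => ?_
  -- For different letters, the pair is an inversion for exactly one of the two orders precisely
  -- when the orders disagree on it.
  by_cases h : u < t
  · by_cases he : w t = w u
    · simp [h, he]
    · rcases lt_or_gt_of_ne (hf.ne he) with h3 | h3 <;> rcases lt_or_gt_of_ne (hg.ne he) with h4 | h4 <;>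
        simp [h, h3, h4, h3.not_gt, h4.not_gt, parity_simps]
  · simp [h]

theorem words_single (k : K) : words N (fun i => if i = k then N else 0) = {fun _ => k} := by
  ext w
  rw [mem_words, Finset.mem_singleton]
  constructor
  · intro h
    funext t
    by_contra hne
    have h1 := h (w t)
    rw [if_neg hne] at h1
    have := cnt_lt_of_eq w t rfl t.2
    omega
  · rintro rfl i
    rw [cnt_self]
    split_ifs with h
    · subst h; simp
    · simp [Ne.symm h]

omit [Fintype K] in
theorem cnt_const (k : K) {t : ℕ} (ht : t ≤ N) (i : K) :
    cnt (fun _ : Fin N => k) i t = if i = k then t else 0 := by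
  induction t with
  | zero => simp
  | succ t ih =>
    rw [cnt_succ _ _ (by omega), ih (by omega)]
    by_cases h : i = k
    · simp [h]
    · simp [h, Ne.symm h]

omit [DecidableEq K] [Fintype K] in
theorem wsign_const (f : K → L) (k : K) : wsign (fun i j => f i < f j) (fun _ : Fin N => k) = 1 := by
  simp [wsign, inv]

omit [Fintype K] [Fintype J] in
theorem cnt_comp_injective {e : J → K} (he : Function.Injective e) (w : Fin N → J) (j : J) (t : ℕ) :
    cnt (e ∘ w) (e j) t = cnt w j t := by
  simp [cnt, he.eq_iff]

/-- Letters of multiplicity zero do not occur, so the alphabet can be shrunk or relabelled along an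
injection. -/
theorem words_eq_image {e : J → K} (he : Function.Injective e) {r : J → ℕ} {r' : K → ℕ}
    (h : ∀ j, r' (e j) = r j) (h0 : ∀ k, k ∉ Set.range e → r' k = 0) :
    words N r' = (words N r).image fun w => e ∘ w := by
  ext v
  rw [Finset.mem_image]
  constructor
  · intro hv
    have hmem : ∀ t, v t ∈ Set.range e := by
      intro t
      by_contra hne
      have h1 := mem_words.1 hv (v t)
      rw [h0 _ hne] at h1
      have := cnt_lt_of_eq v t rfl t.2
      omega
    choose w hw using hmem
    refine ⟨w, mem_words.2 fun j => ?_, funext hw⟩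
    rw [← cnt_comp_injective he, ← h j, ← mem_words.1 hv]
    exact congrArg (fun v => cnt v (e j) N) (funext hw)
  · rintro ⟨w, hw, rfl⟩
    rw [mem_words] at hw ⊢
    intro k
    by_cases hk : k ∈ Set.range e
    · obtain ⟨j, rfl⟩ := hk
      rw [cnt_comp_injective he, hw, h]
    · rw [h0 k hk, cnt_self, Finset.card_eq_zero, Finset.filter_eq_empty_iff]
      exact fun t _ ht => hk ⟨w t, ht⟩

variable {R : I → ℕ}

/-- The position of a letter of a word among the letters that are equal to it. -/
def letterEquiv (W : Fin N → I) (hW : W ∈ words N R) : Fin N ≃ (i : I) × Fin (R i) :=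
  Equiv.ofBijective (fun t => ⟨W t, cnt W (W t) t, by
      rw [← mem_words.1 hW]; exact cnt_lt_of_eq W t rfl t.2⟩) <| by
    rw [Fintype.bijective_iff_injective_and_card]
    refine ⟨fun t t' h => ?_, ?_⟩
    · simp only [Sigma.mk.injEq] at h
      obtain ⟨h1, h2⟩ := h
      refine cnt_inj W h1 rfl ?_
      have : ∀ (i j : I) (a : Fin (R i)) (b : Fin (R j)), i = j → HEq a b → a.val = b.val := by
        rintro i _ a _ rfl h; rw [eq_of_heq h]
      have := this _ _ _ _ h1 h2
      simpa [h1] using this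
    · simp [sum_of_mem_words hW]

theorem letterEquiv_fst {W : Fin N → I} (hW : W ∈ words N R) (t : Fin N) :
    (letterEquiv W hW t).1 = W t := rfl

/-- The word obtained from `W` by replacing the letters `i` of `W` by those of the word `w i`. -/
def nest (W : Fin N → I) (hW : W ∈ words N R) (w : ∀ i, Fin (R i) → K) : Fin N → K :=
  fun t => w (letterEquiv W hW t).1 (letterEquiv W hW t).2

omit [Fintype K] in
-- Here `π` sends a letter to the outer letter it refines. Counting functions of a nested word are
-- composites, so that nesting words models the composition of degeneracies.
theorem cnt_nest (π : K → I) {W : Fin N → I} (hW : W ∈ words N R) {w : ∀ i, Fin (R i) → K}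
    (hw : ∀ i a, π (w i a) = i) (k : K) {t : ℕ} (ht : t ≤ N) :
    cnt (nest W hW w) k t = cnt (w (π k)) k (cnt W (π k) t) := by
  induction t with
  | zero => simp
  | succ t ih =>
    rw [cnt_succ _ _ (by omega : t < N), cnt_succ _ _ (by omega : t < N), ih (by omega)]
    by_cases h : W ⟨t, by omega⟩ = π k
    · have hlt : cnt W (π k) t < R (π k) := by
        rw [← mem_words.1 hW]
        exact cnt_lt_of_eq W ⟨t, by omega⟩ h (by simp only; omega)
      rw [if_pos h, cnt_succ _ _ hlt]
      have : nest W hW w ⟨t, by omega⟩ = w (π k) ⟨cnt W (π k) t, hlt⟩ := by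
        have e : letterEquiv W hW ⟨t, by omega⟩ = ⟨π k, cnt W (π k) t, hlt⟩ := by
          refine Eq.symm ?_
          have : ∀ (i : I) (a : Fin (R i)) (h : i = π k), a.val = cnt W i t →
              (⟨π k, cnt W (π k) t, hlt⟩ : (i : I) × Fin (R i)) = ⟨i, a⟩ := by
            rintro _ a rfl ha
            exact Sigma.ext rfl (heq_of_eq (Fin.ext ha.symm))
          exact this _ _ h rfl
        rw [nest, e]
      rw [this]
    · have : nest W hW w ⟨t, by omega⟩ ≠ k := by
        intro he
        rw [← he] at h
        exact h (hw _ _).symm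
      rw [if_neg h, if_neg this]
      rfl

omit [DecidableEq K] [Fintype K] in
-- By `hfg`, two letters refining different outer letters compare as these do, which gives the
-- inversions of `W`. Two positions with the same outer letter are compared within one inner word.
theorem inv_nest (π : K → I) {W : Fin N → I} (hW : W ∈ words N R) {w : ∀ i, Fin (R i) → K}
    (hw : ∀ i a, π (w i a) = i) {f : K → L} {g : I → L'} (hg : Function.Injective g)
    (hfg : ∀ k k', g (π k) < g (π k') → f k < f k') :
    inv (fun k k' => f k < f k') (nest W hW w) =
      inv (fun i i' => g i < g i') W + ∑ i, inv (fun k k' => f k < f k') (w i) := by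
  let e := letterEquiv W hW
  let y : (i : I) × Fin (R i) → K := fun x => w x.1 x.2
  have hy : ∀ x, π (y x) = x.1 := fun x => hw _ _
  -- Inversions of the inner words, transported along `letterEquiv` to pairs of positions with equal
  -- outer letters.
  have h1 : ∑ i, inv (fun k k' => f k < f k') (w i) =
      ∑ t, ∑ u, if u < t ∧ W t = W u ∧ f (y (e t)) < f (y (e u)) then 1 else 0 := by
    have h2 : ∀ t u, (if u < t ∧ W t = W u ∧ f (y (e t)) < f (y (e u)) then 1 else 0) =
        if (e u).2.val < (e t).2.val ∧ (e t).1 = (e u).1 ∧ f (y (e t)) < f (y (e u)) then 1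
          else 0 := by
      intro t u
      refine if_congr ?_ rfl rfl
      have h3 : W t = W u → (u < t ↔ (e u).2.val < (e t).2.val) := by
        intro h
        change _ ↔ cnt W (W u) u < cnt W (W t) t
        rw [h]
        refine ⟨fun h' => cnt_lt_of_eq W u rfl h', fun h' => ?_⟩
        by_contra hne
        exact absurd (cnt_mono W (W u) (not_lt.1 hne)) (not_le.2 h')
      constructor
      · rintro ⟨a, b, c⟩; exact ⟨(h3 b).1 a, b, c⟩
      · rintro ⟨a, b, c⟩; exact ⟨(h3 b).2 a, b, c⟩
    rw [Finset.sum_congr rfl fun t _ => Finset.sum_congr rfl fun u _ => h2 t u]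
    rw [Equiv.sum_comp e fun x => ∑ u, if (e u).2.val < x.2.val ∧ x.1 = (e u).1 ∧
      f (y x) < f (y (e u)) then 1 else 0]
    rw [Fintype.sum_sigma]
    refine Finset.sum_congr rfl fun i _ => ?_
    rw [inv_eq_sum]
    refine Finset.sum_congr rfl fun a _ => ?_
    rw [Equiv.sum_comp e fun x => if x.2.val < a.val ∧ i = x.1 ∧ f (y ⟨i, a⟩) < f (y x) then 1 else 0]
    rw [Fintype.sum_sigma, Finset.sum_eq_single i]
    · exact Finset.sum_congr rfl fun b _ => if_congr (by simp [y]) rfl rfl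
    · intro j _ hj
      exact Finset.sum_eq_zero fun b _ => if_neg (by rintro ⟨_, h, _⟩; exact hj h.symm)
    · simp
  rw [h1, inv_eq_sum, inv_eq_sum, ← Finset.sum_add_distrib]
  refine Finset.sum_congr rfl fun t _ => ?_
  rw [← Finset.sum_add_distrib]
  refine Finset.sum_congr rfl fun u _ => ?_
  have ht : π (y (e t)) = W t := hy _
  have hu : π (y (e u)) = W u := hy _
  change (if u < t ∧ f (y (e t)) < f (y (e u)) then 1 else 0) = _
  by_cases h : u < t
  · rcases lt_trichotomy (g (W t)) (g (W u)) with h2 | h2 | h2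
    · have := hfg (y (e t)) (y (e u)) (by rw [ht, hu]; exact h2)
      have h3 : W t ≠ W u := fun h => by rw [h] at h2; exact lt_irrefl _ h2
      simp [h, this, h2, h3]
    · simp [h, hg h2]
    · have := hfg (y (e u)) (y (e t)) (by rw [ht, hu]; exact h2)
      have h3 : W t ≠ W u := fun h => by rw [h] at h2; exact lt_irrefl _ h2
      simp [h, this.not_gt, h2.not_gt, h3]
  · simp [h]

/-- Sums over words are sums over nested words. -/
theorem sum_words_nest {M : Type*} [AddCommGroup M] (π : K → I) {r : K → ℕ}
    (hR : ∀ i, R i = ∑ k, if π k = i then r k else 0) {f : K → L} {g : I → L'}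
    (hg : Function.Injective g) (hfg : ∀ k k', g (π k) < g (π k') → f k < f k')
    (φ : (K → Fin (N + 1) → ℕ) → M) :
    ∑ W ∈ words N R, ∑ w ∈ Fintype.piFinset fun i => words (R i) fun k => if π k = i then r k else 0,
      (wsign (fun i i' => g i < g i') W * ∏ i, wsign (fun k k' => f k < f k') (w i)) •
        φ (fun k t => cnt (w (π k)) k (cnt W (π k) t)) =
    ∑ v ∈ words N r, wsign (fun k k' => f k < f k') v • φ fun k t => cnt v k t := by
  -- Letters that do not refine `i` have multiplicity zero in the `i`-th inner word.
  have hπ : ∀ w ∈ Fintype.piFinset fun i => words (R i) fun k => if π k = i then r k else 0,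
      ∀ i a, π (w i a) = i := by
    intro w hw i a
    by_contra hne
    have h1 := mem_words.1 (Fintype.mem_piFinset.1 hw i) (w i a)
    rw [if_neg hne] at h1
    have := cnt_lt_of_eq (w i) a rfl a.2
    omega
  rw [← Finset.sum_product']
  refine Finset.sum_bij (fun x hx => nest x.1 (Finset.mem_product.1 hx).1 x.2) ?_ ?_ ?_ ?_
  · rintro ⟨W, w⟩ hx
    obtain ⟨hW, hw⟩ := Finset.mem_product.1 hx
    refine mem_words.2 fun k => ?_
    rw [cnt_nest π hW (hπ w hw) k le_rfl, mem_words.1 hW,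
      mem_words.1 (Fintype.mem_piFinset.1 hw (π k)), if_pos rfl]
  · rintro ⟨W, w⟩ hx ⟨W', w'⟩ hx' he
    obtain ⟨hW, hw⟩ := Finset.mem_product.1 hx
    obtain ⟨hW', hw'⟩ := Finset.mem_product.1 hx'
    simp only at hW hw hW' hw' he
    have h1 : W = W' := funext fun t => by
      have := congrArg π (congrFun he t)
      rwa [nest, nest, hπ w hw, hπ w' hw'] at this
    subst h1
    refine Prod.ext rfl (funext fun i => funext fun a => ?_)
    have h2 := congrFun he ((letterEquiv W hW).symm ⟨i, a⟩)
    change w (letterEquiv W hW ((letterEquiv W hW).symm ⟨i, a⟩)).1 _ =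
      w' (letterEquiv W hW ((letterEquiv W hW).symm ⟨i, a⟩)).1 _ at h2
    rwa [Equiv.apply_symm_apply] at h2
  · intro v hv
    -- The inverse of nesting: the outer word forgets the refinement, and each inner word is the
    -- subword of the letters over one outer letter.
    let W : Fin N → I := π ∘ v
    have hW : W ∈ words N R := by
      refine mem_words.2 fun i => ?_
      rw [cnt_self, hR]
      refine (card_letters v fun k => π k = i).trans ?_
      exact Finset.sum_congr rfl fun k _ => by rw [mem_words.1 hv]
    let w : ∀ i, Fin (R i) → K := fun i a => v ((letterEquiv W hW).symm ⟨i, a⟩)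
    have hw : ∀ i a, π (w i a) = i := fun i a => by
      change W _ = i
      rw [← letterEquiv_fst hW, Equiv.apply_symm_apply]
    have hv' : nest W hW w = v := funext fun t => by simp [nest, w]
    refine ⟨(W, w), Finset.mem_product.2 ⟨hW, Fintype.mem_piFinset.2 fun i => mem_words.2 fun k => ?_⟩,
      hv'⟩
    split_ifs with h
    · subst h
      have := cnt_nest π hW hw k le_rfl
      rw [hv', mem_words.1 hv, mem_words.1 hW] at this
      exact this.symm
    · rw [cnt_self, Finset.card_eq_zero, Finset.filter_eq_empty_iff]
      exact fun a _ ha => h (by rw [← ha]; exact hw i a)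
  · rintro ⟨W, w⟩ hx
    obtain ⟨hW, hw⟩ := Finset.mem_product.1 hx
    have hs : wsign (fun k k' => f k < f k') (nest W hW w) =
        wsign (fun i i' => g i < g i') W * ∏ i, wsign (fun k k' => f k < f k') (w i) := by
      rw [wsign, inv_nest π hW (hπ w hw) hg hfg, pow_add, ← Finset.prod_pow_eq_pow_sum]
      rfl
    rw [hs]
    congr 2
    funext k t
    exact (cnt_nest π hW (hπ w hw) k (by omega)).symm

end Nested

end IDGA

end

noncomputable section

namespace IDGA

theorem finSigma_val {s : ℕ} {n : Fin s → ℕ} (x : (i : Fin s) × Fin (n i)) :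
    (finSigmaFinEquiv x).val = (∑ i, if i < x.1 then n i else 0) + x.2.val := by
  rw [finSigmaFinEquiv_apply]
  congr 1
  rw [← Finset.sum_filter]
  refine Finset.sum_bij (fun i _ => Fin.castLE x.1.2.le i) ?_ ?_ ?_ ?_
  · exact fun i _ => by rw [Finset.mem_filter]; exact ⟨Finset.mem_univ _, i.2⟩
  · exact fun i _ i' _ h => Fin.castLE_injective _ h
  · intro i hi
    exact ⟨⟨i, by simpa using hi⟩, by simp, rfl⟩
  · exact fun _ _ => rfl

theorem finSigma_lt {s : ℕ} {n : Fin s → ℕ} {x y : (i : Fin s) × Fin (n i)} (h : x.1 < y.1) :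
    finSigmaFinEquiv x < finSigmaFinEquiv y := by
  rw [Fin.lt_def, finSigma_val, finSigma_val]
  have h1 : (∑ i, if i < x.1 then n i else 0) + n x.1 ≤ ∑ i, if i < y.1 then n i else 0 := by
    have h2 : n x.1 = ∑ i, if i = x.1 then n i else 0 := by simp
    rw [h2, ← Finset.sum_add_distrib]
    refine Finset.sum_le_sum fun i _ => ?_
    rcases lt_trichotomy i x.1 with h3 | h3 | h3
    · simp [h3, h3.ne, h3.trans h]
    · subst h3; simp [h]
    · simp [h3.ne', h3.not_gt]
  have := x.2.2
  omega

theorem finSigma_lt_iff {s : ℕ} {n : Fin s → ℕ} {x y : (i : Fin s) × Fin (n i)} :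
    finSigmaFinEquiv x < finSigmaFinEquiv y ↔ x.1 < y.1 ∨ x.1 = y.1 ∧ x.2.val < y.2.val := by
  rcases lt_trichotomy x.1 y.1 with h | h | h
  · simp [h, finSigma_lt h]
  · rcases x with ⟨i, a⟩
    rcases y with ⟨j, b⟩
    obtain rfl : i = j := h
    rw [Fin.lt_def, finSigma_val, finSigma_val]; simp
  · simp [h.not_gt, h.ne', (finSigma_lt h).le]

/-! ### Simplicial sets and sums over shuffles -/

/-- Simplicial sets, with simplicial operators indexed by monotone maps. -/
structure SSimp where
  X : ℕ → Type v
  pull {p q : ℕ} : (Fin (q + 1) →o Fin (p + 1)) → X p → X q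
  pull_id {p : ℕ} (x : X p) : pull OrderHom.id x = x
  pull_pull {p q r : ℕ} (f : Fin (q + 1) →o Fin (p + 1)) (g : Fin (r + 1) →o Fin (q + 1)) (x : X p) :
    pull g (pull f x) = pull (f.comp g) x

/-- A monotone map with values at most `r`, as a morphism of simplices. -/
def degHom {N : ℕ} (r : ℕ) (f : Fin (N + 1) → ℕ) : Fin (N + 1) →o Fin (r + 1) :=
  -- The cap and the constant default make the construction total, so counting functions can be
  -- inserted without carrying proofs. Neither is active for the words that occur in `shSum`.
  if h : Monotone f then ⟨fun t => ⟨min (f t) r, by omega⟩, fun t t' htt => by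
    have := h htt
    exact Fin.mk_le_mk.2 (by omega)⟩
  else ⟨fun _ => 0, fun _ _ _ => le_rfl⟩

theorem degHom_val {N : ℕ} {r : ℕ} {f : Fin (N + 1) → ℕ} (hf : Monotone f) (t : Fin (N + 1)) :
    (degHom r f t).val = min (f t) r := by
  rw [degHom, dif_pos hf]; rfl

/-- The degeneracy given by the occurrences of the letter `i` in a word. -/
def wdeg {ι : Type*} [DecidableEq ι] {N : ℕ} (w : Fin N → ι) (i : ι) (r : ℕ) :
    Fin (N + 1) →o Fin (r + 1) :=
  degHom r fun t => cnt w i t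

theorem cnt_fin_mono {ι : Type*} [DecidableEq ι] {N : ℕ} (w : Fin N → ι) (i : ι) :
    Monotone fun t : Fin (N + 1) => cnt w i t := fun _ _ h => cnt_mono w i h

theorem wdeg_val {ι : Type*} [DecidableEq ι] {N : ℕ} (w : Fin N → ι) (i : ι) (r : ℕ)
    (t : Fin (N + 1)) : (wdeg w i r t).val = min (cnt w i t) r :=
  degHom_val (cnt_fin_mono w i) t

/-- The coface map that omits `k`. -/
def coface {n : ℕ} (k : Fin (n + 2)) : Fin (n + 1) →o Fin (n + 2) := (Fin.succAboveOrderEmb k).toOrderHom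

theorem coface_val {n : ℕ} (k : Fin (n + 2)) (t : Fin (n + 1)) : (coface k t).val = face k t := by
  change (k.succAbove t).val = _
  rw [face]
  split_ifs with h
  · rw [Fin.succAbove_of_castSucc_lt _ _ (Fin.lt_def.2 (by simpa using h))]; rfl
  · rw [Fin.succAbove_of_le_castSucc _ _ (Fin.le_def.2 (by simpa using h))]; rfl

theorem monotone_face (k : ℕ) : Monotone (face k) := fun t t' h => by
  unfold face; split_ifs <;> omega

theorem wdeg_comp_coface {ι : Type*} [DecidableEq ι] {N : ℕ} (w : Fin (N + 1) → ι) (i : ι) (r : ℕ)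
    (k : Fin (N + 2)) : (wdeg w i r).comp (coface k) = degHom r fun t => cnt w i (face k t) := by
  ext t
  rw [OrderHom.comp_coe, Function.comp, wdeg_val, degHom_val, coface_val]
  exact fun t t' h => cnt_mono w i (monotone_face k h)

theorem coface_comp_wdeg {ι : Type*} [DecidableEq ι] {N : ℕ} (w : Fin N → ι) (i : ι) (n : ℕ)
    (hw : cnt w i N ≤ n) (l : Fin (n + 2)) :
    (coface l).comp (wdeg w i n) = degHom (n + 1) fun t => face l (cnt w i t) := by
  ext t
  have h1 : min (cnt w i t) n = cnt w i t := min_eq_left ((cnt_le_self w i t).trans hw)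
  rw [OrderHom.comp_coe, Function.comp, coface_val, wdeg_val, h1, degHom_val]
  · have := (cnt_le_self w i t).trans hw
    unfold face; split_ifs <;> omega
  · exact fun t t' h => monotone_face l (cnt_mono w i h)

namespace SSimp

/-- The simplex of dimension `N` obtained from a simplex by the degeneracy of `wdeg`. -/
def degen (S : SSimp.{v}) {ι : Type*} [DecidableEq ι] {N : ℕ} (w : Fin N → ι) (i : ι)
    (z : (r : ℕ) × S.X r) : S.X N :=
  S.pull (wdeg w i z.1) z.2

theorem degen_comp (S : SSimp.{v}) {ι κ : Type*} [DecidableEq ι] [DecidableEq κ] {e : ι → κ}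
    (he : Function.Injective e) {N : ℕ} (w : Fin N → ι) (i : ι) (z : (r : ℕ) × S.X r) :
    S.degen (e ∘ w) (e i) z = S.degen w i z := by
  simp only [degen, wdeg, cnt_comp_injective he]

/-- The alternating sum of the values of `F` on the faces of a simplex. -/
def bdry (S : SSimp.{v}) {M : Type*} [AddCommGroup M] (F : (r : ℕ) × S.X r → M) :
    (r : ℕ) × S.X r → M := fun z => match z with
  | ⟨0, _⟩ => 0
  | ⟨n + 1, x⟩ => ∑ l : Fin (n + 2), (-1 : ℤ) ^ l.val • F ⟨n, S.pull (coface l) x⟩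

end SSimp

section Shuffles

universe v₁ v₂ v₃

variable {M : Type*} [AddCommGroup M] {s : ℕ} {C : SSimp.{v₁}} {S : Fin s → SSimp.{v₂}}

/-- The signed sum of the values of `Φ` on the degeneracies of a simplex `c` and a family of
simplices `y` that are given by shuffles. -/
def shSum (Φ : ∀ N, C.X N → (∀ i, (S i).X N) → M) (N : ℕ) (c : (p : ℕ) × C.X p)
    (y : ∀ i, (r : ℕ) × (S i).X r) : M :=
  ∑ w ∈ words N (Fin.cons c.1 (fun i => (y i).1) : Fin (s + 1) → ℕ),
    wsign (· < ·) w • Φ N (C.degen w 0 c) (fun i => (S i).degen w i.succ (y i))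

theorem sum_Iio_succ (F : Fin (s + 1) → ℤ) (i : Fin s) :
    ∑ i' ∈ Finset.Iio i.succ, F i' = F 0 + ∑ i' ∈ Finset.Iio i, F i'.succ := by
  have h : ∀ (n : ℕ) (i : Fin n), Finset.Iio i = Finset.univ.filter (· < i) := by
    intro n i; ext; simp
  rw [h, h, Finset.sum_filter, Finset.sum_filter, Fin.sum_univ_succ]
  simp

/-- The faces of a sum over shuffles. -/
theorem shSum_faces (Φ : ∀ N, C.X N → (∀ i, (S i).X N) → M) (N : ℕ) (c : (p : ℕ) × C.X p)
    (y : ∀ i, (r : ℕ) × (S i).X r) :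
    ∑ w ∈ words (N + 1) (Fin.cons c.1 (fun i => (y i).1) : Fin (s + 1) → ℕ),
      wsign (· < ·) w • ∑ k : Fin (N + 2), (-1 : ℤ) ^ k.val •
        Φ N (C.pull (coface k) (C.degen w 0 c))
          (fun i => (S i).pull (coface k) ((S i).degen w i.succ (y i))) =
    C.bdry (fun c => shSum Φ N c y) c + ∑ i, sgn (c.1 + ∑ i' ∈ Finset.Iio i, ((y i').1 : ℤ)) •
      (S i).bdry (fun z => shSum Φ N c (Function.update y i z)) (y i) := by
  -- The summand depends on the word only through its counting functions, which puts it into the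
  -- form required by `sum_words_faces`.
  let φ : (Fin (s + 1) → Fin (N + 1) → ℕ) → M := fun f =>
    Φ N (C.pull (degHom c.1 (f 0)) c.2) fun i => (S i).pull (degHom (y i).1 (f i.succ)) (y i).2
  have h := sum_words_faces (N := N) (Fin.cons c.1 (fun i => (y i).1) : Fin (s + 1) → ℕ) φ
  refine Eq.trans (Finset.sum_congr rfl fun w _ => ?_) (h.trans ?_)
  · refine congrArg _ (Finset.sum_congr rfl fun k _ => ?_)
    simp only [φ, SSimp.degen, SSimp.pull_pull, wdeg_comp_coface]
  · rw [Fin.sum_univ_succ]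
    congr 1
    · rcases c with ⟨_ | n, c⟩
      · simp [SSimp.bdry]
      · rw [SSimp.bdry, Fin.cons_zero, if_neg (by simp), Finset.sum_range]
        rw [show Finset.Iio (0 : Fin (s + 1)) = ∅ by ext; simp, Finset.sum_empty, sgn_zero, one_smul]
        refine Finset.sum_congr rfl fun l _ => ?_
        rw [shSum, Fin.update_cons_zero, Nat.add_sub_cancel]
        refine congrArg _ (Finset.sum_congr rfl fun w hw => ?_)
        have hc := mem_words.1 hw 0
        rw [Fin.cons_zero] at hc
        simp only [φ, SSimp.degen, SSimp.pull_pull, coface_comp_wdeg w 0 n hc.le,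
          Function.update_self, Function.update_of_ne (Fin.succ_ne_zero _)]
        rfl
    · refine Finset.sum_congr rfl fun i _ => ?_
      congr 1
      · rw [sum_Iio_succ]; simp
      · rw [Fin.cons_succ]
        generalize hz : y i = z
        rcases z with ⟨_ | n, x⟩
        · simp [SSimp.bdry]
        · rw [if_neg (by simp), Finset.sum_range, SSimp.bdry]
          refine Finset.sum_congr rfl fun l _ => ?_
          have hu : (Fin.cons c.1 fun i' =>
              (Function.update y i ⟨n, (S i).pull (coface l) x⟩ i').1 : Fin (s + 1) → ℕ) =
              Function.update (Fin.cons c.1 fun i' => (y i').1) i.succ n := by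
            rw [← Fin.cons_update]
            congr 1
            funext i'
            by_cases hi : i' = i
            · subst hi; simp
            · simp [hi]
          rw [shSum, hu, Nat.add_sub_cancel]
          refine congrArg _ (Finset.sum_congr rfl fun w hw => ?_)
          have hc := mem_words.1 hw i.succ
          rw [Function.update_self] at hc
          refine congrArg _ ?_
          change Φ N _ _ = Φ N _ _
          rw [Function.update_of_ne (Fin.succ_ne_zero _).symm]
          refine congrArg _ (funext fun i' => ?_)
          by_cases hi : i' = i
          · subst hi
            rw [Function.update_self, Function.update_self, hz, SSimp.degen]
            simp only [SSimp.pull_pull, coface_comp_wdeg w i'.succ n hc.le]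
          · rw [Function.update_of_ne hi, Function.update_of_ne (by simpa using hi)]
            rfl

/-- Sums over shuffles are symmetric. -/
theorem shSum_perm (σ : Equiv.Perm (Fin s)) (Φ : ∀ N, C.X N → (∀ i, (S i).X N) → M)
    (Ψ : ∀ N, C.X N → (∀ i, (S (σ.symm i)).X N) → M)
    (h : ∀ N c y, Φ N c y = Ψ N c fun i => y (σ.symm i)) (N : ℕ) (c : (p : ℕ) × C.X p)
    (y : ∀ i, (r : ℕ) × (S i).X r) :
    shSum Φ N c y = koszul σ (fun i => ((y i).1 : ℤ)) •
      shSum (S := fun i => S (σ.symm i)) Ψ N c fun i => y (σ.symm i) := by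
  -- The relabelling keeps the letter `0`, which belongs to `c`, and permutes the letters of the
  -- simplices `y i`.
  let e : Fin (s + 1) → Fin (s + 1) := Fin.cases 0 fun i => (σ i).succ
  have he : Function.Injective e := by
    intro a b
    refine Fin.cases ?_ (fun a => ?_) a <;> refine Fin.cases ?_ (fun b => ?_) b
    · simp
    · exact fun h => absurd h.symm (Fin.succ_ne_zero _)
    · exact fun h => absurd h (Fin.succ_ne_zero _)
    · intro h
      exact congrArg Fin.succ (σ.injective (Fin.succ_injective _ h))
  have hs : ∀ i, e (σ.symm i).succ = i.succ := fun i => by simp [e]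
  have hw : words N (Fin.cons c.1 fun i => (y (σ.symm i)).1 : Fin (s + 1) → ℕ) =
      (words N (Fin.cons c.1 fun i => (y i).1 : Fin (s + 1) → ℕ)).image fun w => e ∘ w := by
    refine words_eq_image he (fun i => ?_) fun i hi => absurd ?_ hi
    · refine Fin.cases ?_ (fun i => ?_) i
      · rfl
      · exact congrArg (fun i => (y i).1) (σ.symm_apply_apply i)
    · refine Fin.cases ⟨0, rfl⟩ (fun i => ⟨(σ.symm i).succ, hs i⟩) i
  have hinj : Function.Injective fun w : Fin N → Fin (s + 1) => e ∘ w := he.comp_left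
  rw [shSum, shSum, hw, Finset.sum_image hinj.injOn, Finset.smul_sum]
  refine Finset.sum_congr rfl fun w hw => ?_
  have h1 := wsign_change hw Function.injective_id he
  -- The letter `0` stays the smallest one, so only pairs of letters of the `y i` contribute to the
  -- change of sign.
  have h2 : (∑ i, ∑ j, if id i < id j ∧ e j < e i then
      (((Fin.cons c.1 fun i => (y i).1 : Fin (s + 1) → ℕ) i : ℕ) : ℤ) *
        ((Fin.cons c.1 fun i => (y i).1 : Fin (s + 1) → ℕ) j : ℕ) else 0) =
      ∑ i, ∑ j, if i < j ∧ σ j < σ i then ((y i).1 : ℤ) * (y j).1 else 0 := by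
    rw [Fin.sum_univ_succ]
    simp only [Fin.sum_univ_succ]
    simp [e]
  rw [h2] at h1
  change wsign (fun i j => i < j) w = koszul σ _ * wsign (fun i j => i < j) (e ∘ w) at h1
  change wsign (fun i j => i < j) w • _ = koszul σ _ • wsign (fun i j => i < j) (e ∘ w) • _
  rw [h1, mul_smul, h]
  have hd0 : C.degen (e ∘ w) 0 c = C.degen w 0 c := C.degen_comp he w 0 c
  rw [hd0]
  refine congrArg _ (congrArg _ (congrArg _ (funext fun i => ?_)))
  rw [← SSimp.degen_comp _ he, hs]

theorem sum_piFinset_succ {α : Fin (s + 1) → Type*} (S : ∀ i, Finset (α i)) (F : (∀ i, α i) → M) :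
    ∑ w ∈ Fintype.piFinset S, F w =
      ∑ w₀ ∈ S 0, ∑ w ∈ Fintype.piFinset fun i => S (Fin.succ i), F (Fin.cons w₀ w) := by
  rw [← Finset.sum_product']
  refine Finset.sum_bij' (fun w _ => (w 0, fun i => w i.succ)) (fun x _ => Fin.cons x.1 x.2)
    ?_ ?_ ?_ ?_ ?_
  · intro w hw
    rw [Fintype.mem_piFinset] at hw
    exact Finset.mem_product.2 ⟨hw 0, Fintype.mem_piFinset.2 fun i => hw _⟩
  · rintro ⟨w₀, w⟩ hx
    obtain ⟨h1, h2⟩ := Finset.mem_product.1 hx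
    rw [Fintype.mem_piFinset] at h2 ⊢
    exact Fin.cases h1 h2
  · exact fun w _ => Fin.cons_self_tail w
  · exact fun x _ => rfl
  · exact fun w _ => congrArg F (Fin.cons_self_tail w).symm

/-! ### The two orders of the letters of nested shuffles -/

section Assoc

variable (j : Fin s → ℕ) (p₀ : ℕ) (p : Fin s → ℕ) (r : Fin (∑ i, j i) → ℕ)

/-- The order of the letters of the words for the composite of a family of shuffles of
`a i, x (i, t)` with a shuffle of `c` and the resulting words. -/
def rankOuter : Fin (s + 1) ⊕ Fin (∑ i, j i) → ℕ ×ₗ ℕ :=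
  Sum.elim (fun i => toLex (i.val, 0)) fun t =>
    toLex ((finSigmaFinEquiv.symm t).1.val + 1, (finSigmaFinEquiv.symm t).2.val + 1)

/-- The order of the letters of the words for the composite of a shuffle of `c, a i` with a
shuffle of the resulting word and `x (i, t)`. -/
def rankInner : Fin (s + 1) ⊕ Fin (∑ i, j i) → ℕ ×ₗ ℕ :=
  Sum.elim (fun i => toLex (0, i.val)) fun t => toLex (t.val + 1, 0)

theorem rankOuter_injective : Function.Injective (rankOuter j) := by
  rintro (a | a) (b | b) h
  · have h1 := congrArg (fun x => (ofLex x).1) h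
    exact congrArg _ (Fin.ext h1)
  · have h1 := congrArg (fun x => (ofLex x).2) h
    simp [rankOuter] at h1
  · have h1 := congrArg (fun x => (ofLex x).2) h
    simp [rankOuter] at h1
  · have h1 := congrArg (fun x => (ofLex x).1) h
    have h2 := congrArg (fun x => (ofLex x).2) h
    simp only [rankOuter, Sum.elim_inr, ofLex_toLex, add_left_inj] at h1 h2
    refine congrArg _ (finSigmaFinEquiv.symm.injective ?_)
    generalize finSigmaFinEquiv.symm a = x at *
    generalize finSigmaFinEquiv.symm b = y at *
    rcases x with ⟨i, x⟩
    rcases y with ⟨i', y⟩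
    obtain rfl : i = i' := Fin.ext h1
    exact Sigma.ext rfl (heq_of_eq (Fin.ext h2))

theorem rankInner_injective : Function.Injective (rankInner j) := by
  rintro (a | a) (b | b) h
  · have h1 := congrArg (fun x => (ofLex x).2) h
    exact congrArg _ (Fin.ext h1)
  · have h1 := congrArg (fun x => (ofLex x).1) h
    simp [rankInner] at h1
  · have h1 := congrArg (fun x => (ofLex x).1) h
    simp [rankInner] at h1
  · have h1 := congrArg (fun x => (ofLex x).1) h
    simp only [rankInner, Sum.elim_inr, ofLex_toLex, add_left_inj] at h1
    exact congrArg _ (Fin.ext h1)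

/-- The outer order is `c, a 0, x (0, -), a 1, x (1, -), …`, the inner order lists `c`, then all `a
i`, then all `x (i, t)`. They disagree exactly on the pairs `x (i', t)`, `a i` with `i' < i`. This
is the sign of moving the operations `a i` past the arguments of the earlier ones. -/
theorem rank_disagreement :
    (∑ k, ∑ k', if rankOuter j k < rankOuter j k' ∧ rankInner j k' < rankInner j k then
      ((Sum.elim (Fin.cons p₀ p) r k : ℕ) : ℤ) * (Sum.elim (Fin.cons p₀ p) r k' : ℕ) else 0) =
    ∑ i, (p i : ℤ) * ∑ i' ∈ Finset.Iio i, ∑ t, (r (finSigmaFinEquiv ⟨i', t⟩) : ℤ) := by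
  have hLL : ∀ a b : Fin (s + 1), ¬ (rankOuter j (.inl a) < rankOuter j (.inl b) ∧
      rankInner j (.inl b) < rankInner j (.inl a)) := by
    rintro a b ⟨h1, h2⟩
    simp only [rankOuter, rankInner, Sum.elim_inl, Prod.Lex.toLex_lt_toLex] at h1 h2
    omega
  have hRR : ∀ a b : Fin (∑ i, j i), ¬ (rankOuter j (.inr a) < rankOuter j (.inr b) ∧
      rankInner j (.inr b) < rankInner j (.inr a)) := by
    rintro a b ⟨h1, h2⟩
    simp only [rankOuter, rankInner, Sum.elim_inr, Prod.Lex.toLex_lt_toLex] at h1 h2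
    obtain ⟨x, rfl⟩ := finSigmaFinEquiv.surjective a
    obtain ⟨y, rfl⟩ := finSigmaFinEquiv.surjective b
    rw [Equiv.symm_apply_apply, Equiv.symm_apply_apply] at h1
    have : finSigmaFinEquiv x < finSigmaFinEquiv y := by
      rw [finSigma_lt_iff, Fin.lt_def, Fin.ext_iff]; omega
    rw [Fin.lt_def] at this
    omega
  have hLR : ∀ (a : Fin (s + 1)) (b : Fin (∑ i, j i)), ¬ (rankOuter j (.inl a) < rankOuter j (.inr b) ∧
      rankInner j (.inr b) < rankInner j (.inl a)) := by
    rintro a b ⟨h1, h2⟩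
    simp only [rankInner, Sum.elim_inl, Sum.elim_inr, Prod.Lex.toLex_lt_toLex] at h2
    omega
  have hR0 : ∀ b : Fin (∑ i, j i), ¬ (rankOuter j (.inr b) < rankOuter j (.inl 0) ∧
      rankInner j (.inl 0) < rankInner j (.inr b)) := by
    rintro b ⟨h1, h2⟩
    simp only [rankOuter, Sum.elim_inl, Sum.elim_inr, Prod.Lex.toLex_lt_toLex, Fin.val_zero] at h1
    omega
  have hRS : ∀ (b : Fin (∑ i, j i)) (i : Fin s), (rankOuter j (.inr b) < rankOuter j (.inl i.succ) ∧
      rankInner j (.inl i.succ) < rankInner j (.inr b)) ↔ (finSigmaFinEquiv.symm b).1 < i := by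
    intro b i
    simp only [rankOuter, rankInner, Sum.elim_inl, Sum.elim_inr, Prod.Lex.toLex_lt_toLex, Fin.val_succ,
      Fin.lt_def]
    omega
  simp only [Fintype.sum_sum_type, hLL, hLR, hRR, if_false, Finset.sum_const_zero, zero_add, add_zero,
    Fin.sum_univ_succ, hR0, hRS, Sum.elim_inl, Sum.elim_inr, Fin.cons_succ]
  rw [Finset.sum_comm]
  refine Finset.sum_congr rfl fun i _ => ?_
  rw [← Equiv.sum_comp finSigmaFinEquiv, Fintype.sum_sigma, Finset.mul_sum,
    show Finset.Iio i = Finset.univ.filter (· < i) by ext; simp, Finset.sum_filter]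
  refine Finset.sum_congr rfl fun i' _ => ?_
  simp only [Equiv.symm_apply_apply]
  split_ifs with h
  · rw [Finset.mul_sum]
    exact Finset.sum_congr rfl fun t _ => mul_comm _ _
  · simp

end Assoc

end Shuffles

end IDGA

end

/-! ### Associativity of sums over shuffles -/

noncomputable section

namespace IDGA

section Assoc

variable {M : Type*} [AddCommGroup M] {s : ℕ} (j : Fin s → ℕ) (p₀ : ℕ) (p : Fin s → ℕ)
  (r : Fin (∑ i, j i) → ℕ) (N : ℕ)

theorem sum_finSigma {A : Type*} [AddCommMonoid A] {j : Fin s → ℕ} (F : Fin (∑ i, j i) → A) :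
    ∑ t, F t = ∑ i, ∑ t, F (finSigmaFinEquiv ⟨i, t⟩) := by
  rw [← Equiv.sum_comp finSigmaFinEquiv, Fintype.sum_sigma]

/-- The letters of the words with values in `a i, x (i, t)`. -/
def letterOuter (i : Fin s) : Fin (j i + 1) → Fin (s + 1) ⊕ Fin (∑ i, j i) :=
  Fin.cases (.inl i.succ) fun t => .inr (finSigmaFinEquiv ⟨i, t⟩)

theorem rankOuter_letterOuter (i : Fin s) (a b : Fin (j i + 1)) :
    rankOuter j (letterOuter j i a) < rankOuter j (letterOuter j i b) ↔ a < b := by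
  have h : ∀ a, rankOuter j (letterOuter j i a) = toLex (i.val + 1, a.val) := by
    intro a
    refine Fin.cases ?_ (fun t => ?_) a
    · rfl
    · change toLex ((finSigmaFinEquiv.symm (finSigmaFinEquiv ⟨i, t⟩)).1.val + 1,
        (finSigmaFinEquiv.symm (finSigmaFinEquiv ⟨i, t⟩)).2.val + 1) = _
      rw [Equiv.symm_apply_apply, Fin.val_succ]
  rw [h, h, Prod.Lex.toLex_lt_toLex, Fin.lt_def]
  simp

theorem letterOuter_injective (i : Fin s) : Function.Injective (letterOuter j i) := by
  intro a b h
  have h1 := rankOuter_letterOuter j i a b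
  have h2 := rankOuter_letterOuter j i b a
  rw [h] at h1 h2
  simp only [lt_self_iff_false, false_iff, not_lt] at h1 h2
  exact le_antisymm h2 h1

/-- An instance of `sum_words_nest`: the outer letter `0` stands for `c`, and the outer letter `i +
1` is refined by `a i` and its arguments `x (i, t)`. -/
theorem sum_words_outer {R : Fin s → ℕ}
    (hR : ∀ i, R i = p i + ∑ t, r (finSigmaFinEquiv ⟨i, t⟩))
    (φ : (Fin (s + 1) ⊕ Fin (∑ i, j i) → Fin (N + 1) → ℕ) → M) :
    ∑ W ∈ words N (Fin.cons p₀ R : Fin (s + 1) → ℕ),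
      ∑ w ∈ Fintype.piFinset fun i => words (R i)
        (Fin.cons (p i) (fun t => r (finSigmaFinEquiv ⟨i, t⟩)) : Fin (j i + 1) → ℕ),
        (wsign (· < ·) W * ∏ i, wsign (· < ·) (w i)) •
          φ (Sum.elim
            (Fin.cases (fun t => cnt W 0 t) fun i t => cnt (w i) 0 (cnt W i.succ t))
            fun a t => cnt (w (finSigmaFinEquiv.symm a).1) (finSigmaFinEquiv.symm a).2.succ
              (cnt W (finSigmaFinEquiv.symm a).1.succ t)) =
    ∑ v ∈ words N (Sum.elim (Fin.cons p₀ p) r),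
      wsign (fun k k' => rankOuter j k < rankOuter j k') v • φ fun k t => cnt v k t := by
  let π : Fin (s + 1) ⊕ Fin (∑ i, j i) → Fin (s + 1) :=
    Sum.elim id fun t => (finSigmaFinEquiv.symm t).1.succ
  let ρ : Fin (s + 1) ⊕ Fin (∑ i, j i) → ℕ := Sum.elim (Fin.cons p₀ p) r
  have hπ0 : ∀ k, (if π k = 0 then ρ k else 0) = if k = .inl 0 then p₀ else 0 := by
    rintro (i | t)
    · by_cases h : i = 0
      · subst h; simp [π, ρ]
      · simp [π, h]
    · simp [π]
  have hπs : ∀ i k, k ∉ Set.range (letterOuter j i) → (if π k = i.succ then ρ k else 0) = 0 := by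
    rintro i (a | t) h
    · refine if_neg fun h' => h ⟨0, ?_⟩
      exact congrArg Sum.inl h'.symm
    · refine if_neg fun h' => h ?_
      obtain ⟨⟨i', t⟩, rfl⟩ := finSigmaFinEquiv.surjective t
      simp only [π, Sum.elim_inr, Equiv.symm_apply_apply, Fin.succ_inj] at h'
      subst h'
      exact ⟨t.succ, rfl⟩
  have hπl : ∀ i a, (if π (letterOuter j i a) = i.succ then ρ (letterOuter j i a) else 0) =
      (Fin.cons (p i) (fun t => r (finSigmaFinEquiv ⟨i, t⟩)) : Fin (j i + 1) → ℕ) a := by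
    intro i a
    refine Fin.cases ?_ (fun t => ?_) a
    · exact if_pos rfl
    · exact if_pos (by simp [π, letterOuter])
  have hR' : ∀ i, (Fin.cons p₀ R : Fin (s + 1) → ℕ) i = ∑ k, if π k = i then ρ k else 0 := by
    intro i
    refine Fin.cases ?_ (fun i => ?_) i
    · rw [Finset.sum_congr rfl fun k _ => hπ0 k]; simp
    · rw [Fin.cons_succ, hR, Fintype.sum_sum_type]
      congr 1
      · change p i = ∑ a, if a = i.succ then (Fin.cons p₀ p : Fin (s + 1) → ℕ) a else 0
        rw [Finset.sum_ite_eq']; simp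
      · refine Eq.symm ((sum_finSigma _).trans ((Finset.sum_eq_single i ?_ ?_).trans ?_))
        · intro i' _ hi
          exact Finset.sum_eq_zero fun t _ => if_neg (by simpa [π] using hi)
        · simp
        · simp [π, ρ]
  have hfg : ∀ k k', id (π k) < id (π k') → rankOuter j k < rankOuter j k' := by
    have h : ∀ k, (ofLex (rankOuter j k)).1 = (π k).val := by rintro (i | t) <;> rfl
    intro k k' hk
    refine Prod.Lex.lt_iff.2 (Or.inl ?_)
    rw [h, h]
    exact hk
  rw [← sum_words_nest π hR' Function.injective_id hfg φ]
  refine Finset.sum_congr rfl fun W hW => ?_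
  rw [sum_piFinset_succ]
  -- The outer letter of `c` has a single refinement, so its inner word is constant and has sign 1.
  have h0 : words ((Fin.cons p₀ R : Fin (s + 1) → ℕ) 0) (fun k => if π k = 0 then ρ k else 0) =
      {fun _ => .inl 0} := by
    rw [funext hπ0]; exact words_single _
  have hs : (Fintype.piFinset fun i : Fin s => words (R i)
      (fun k => if π k = i.succ then ρ k else 0)) = (Fintype.piFinset fun i => words (R i)
        (Fin.cons (p i) (fun t => r (finSigmaFinEquiv ⟨i, t⟩)) : Fin (j i + 1) → ℕ)).image
          fun w i => letterOuter j i ∘ w i :=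
    (congrArg Fintype.piFinset (funext fun i =>
      words_eq_image (letterOuter_injective j i) (hπl i) (hπs i))).trans (Fintype.piFinset_image _ _)
  rw [h0, Finset.sum_singleton]
  refine Eq.trans (Eq.trans ?_ (Finset.sum_image ?_).symm) (Finset.sum_congr hs.symm fun _ _ => rfl)
  · refine Finset.sum_congr rfl fun w hw => ?_
    congr 1
    · rw [Fin.prod_univ_succ]
      change _ = wsign (· < ·) W * (wsign (fun k k' => rankOuter j k < rankOuter j k')
        (fun _ : Fin p₀ => .inl 0) * ∏ i, wsign (fun k k' => rankOuter j k < rankOuter j k')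
          (letterOuter j i ∘ w i))
      rw [wsign_const, one_mul]
      refine congrArg _ (Finset.prod_congr rfl fun i _ => ?_)
      change _ = (-1) ^ (Finset.univ.filter _).card
      simp only [Function.comp, rankOuter_letterOuter]
      rfl
    · congr 1
      funext k t
      rcases k with i | a
      · refine Fin.cases ?_ (fun i => ?_) i
        · have h1 : cnt W 0 t ≤ p₀ := (cnt_le_self W 0 t).trans_eq (mem_words.1 hW 0)
          exact ((cnt_const (Sum.inl 0) h1 (Sum.inl 0)).trans (if_pos rfl)).symm
        · exact (cnt_comp_injective (letterOuter_injective j i) (w i) 0 _).symm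
      · have h1 := (cnt_comp_injective (letterOuter_injective j (finSigmaFinEquiv.symm a).1)
          (w (finSigmaFinEquiv.symm a).1) (finSigmaFinEquiv.symm a).2.succ
            (cnt W (finSigmaFinEquiv.symm a).1.succ t)).symm
        rw [show letterOuter j (finSigmaFinEquiv.symm a).1 (finSigmaFinEquiv.symm a).2.succ = .inr a from
          congrArg Sum.inr (finSigmaFinEquiv.apply_symm_apply a)] at h1
        exact h1
  · intro w _ w' _ h
    funext i
    exact (letterOuter_injective j i).comp_left (congrFun h i)

/-- The opposite nesting: the outer letter `0` is refined by `c` and all `a i`, while each `x (i,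
t)` is an outer letter with only one refinement. -/
theorem sum_words_inner {P : ℕ} (hP : P = p₀ + ∑ i, p i)
    (φ : (Fin (s + 1) ⊕ Fin (∑ i, j i) → Fin (N + 1) → ℕ) → M) :
    ∑ V ∈ words N (Fin.cons P r : Fin (∑ i, j i + 1) → ℕ),
      ∑ u ∈ words P (Fin.cons p₀ p : Fin (s + 1) → ℕ),
        (wsign (· < ·) V * wsign (· < ·) u) •
          φ (Sum.elim (fun i t => cnt u i (cnt V 0 t)) fun a t => cnt V a.succ t) =
    ∑ v ∈ words N (Sum.elim (Fin.cons p₀ p) r),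
      wsign (fun k k' => rankInner j k < rankInner j k') v • φ fun k t => cnt v k t := by
  let π : Fin (s + 1) ⊕ Fin (∑ i, j i) → Fin (∑ i, j i + 1) := Sum.elim (fun _ => 0) Fin.succ
  let ρ : Fin (s + 1) ⊕ Fin (∑ i, j i) → ℕ := Sum.elim (Fin.cons p₀ p) r
  have hπ0 : ∀ k, k ∉ Set.range (Sum.inl : Fin (s + 1) → Fin (s + 1) ⊕ Fin (∑ i, j i)) →
      (if π k = 0 then ρ k else 0) = 0 := by
    rintro (i | t) h
    · exact absurd ⟨i, rfl⟩ h
    · simp [π]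
  have hπs : ∀ t k, (if π k = t.succ then ρ k else 0) = if k = .inr t then r t else 0 := by
    rintro t (i | t')
    · simp [π, (Fin.succ_ne_zero _).symm]
    · by_cases h : t' = t
      · subst h; simp [π, ρ]
      · simp [π, h]
  have hR' : ∀ i, (Fin.cons P r : Fin (∑ i, j i + 1) → ℕ) i = ∑ k, if π k = i then ρ k else 0 := by
    intro i
    refine Fin.cases ?_ (fun t => ?_) i
    · rw [Fintype.sum_sum_type, Finset.sum_eq_zero (s := Finset.univ)
        (f := fun x => if π (Sum.inr x) = 0 then ρ (Sum.inr x) else 0) fun t _ =>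
          if_neg (Fin.succ_ne_zero _), add_zero]
      change P = ∑ i, if (0 : Fin (∑ i, j i + 1)) = 0 then (Fin.cons p₀ p : Fin (s + 1) → ℕ) i else 0
      simp only [if_true]
      rw [Fin.sum_univ_succ, hP]
      simp
    · rw [Finset.sum_congr rfl fun k _ => hπs t k]; simp
  have hfg : ∀ k k', id (π k) < id (π k') → rankInner j k < rankInner j k' := by
    have h : ∀ k, (ofLex (rankInner j k)).1 = (π k).val := by rintro (i | t) <;> rfl
    intro k k' hk
    refine Prod.Lex.lt_iff.2 (Or.inl ?_)
    rw [h, h]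
    exact hk
  rw [← sum_words_nest π hR' Function.injective_id hfg φ]
  refine Finset.sum_congr rfl fun V hV => ?_
  rw [sum_piFinset_succ]
  have h0 : words P (fun k => if π k = 0 then ρ k else 0) =
      (words P (Fin.cons p₀ p : Fin (s + 1) → ℕ)).image fun w => Sum.inl ∘ w :=
    words_eq_image Sum.inl_injective (fun i => if_pos rfl) hπ0
  have hs : (Fintype.piFinset fun t : Fin (∑ i, j i) => words (r t)
      (fun k => if π k = t.succ then ρ k else 0)) = {fun t _ => .inr t} := by
    rw [funext fun t => show words (r t) (fun k => if π k = t.succ then ρ k else 0) =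
      {fun _ => .inr t} by rw [funext (hπs t)]; exact words_single _]
    exact Fintype.piFinset_singleton _
  refine Eq.trans (Eq.trans ?_ (Finset.sum_image ?_).symm) (Finset.sum_congr h0.symm fun w _ =>
    Eq.trans (Finset.sum_singleton _ _).symm (Finset.sum_congr hs.symm fun _ _ => rfl))
  · refine Finset.sum_congr rfl fun u _ => ?_
    congr 1
    · rw [Fin.prod_univ_succ]
      change _ = wsign (· < ·) V * (wsign (fun k k' => rankInner j k < rankInner j k')
        (Sum.inl ∘ u) * ∏ t : Fin (∑ i, j i), wsign (fun k k' => rankInner j k < rankInner j k')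
          (fun _ : Fin (r t) => .inr t))
      rw [Finset.prod_congr rfl fun t _ => wsign_const _ _, Finset.prod_const_one, mul_one]
      refine congrArg _ ?_
      change _ = (-1) ^ (Finset.univ.filter _).card
      have h : ∀ a b : Fin (s + 1), rankInner j (.inl a) < rankInner j (.inl b) ↔ a < b := by
        intro a b
        simp [rankInner, Prod.Lex.toLex_lt_toLex]
      simp only [Function.comp, h]
      rfl
    · congr 1
      funext k t
      rcases k with i | a
      · exact (cnt_comp_injective Sum.inl_injective u i _).symm
      · have h1 : cnt V a.succ t ≤ r a := (cnt_le_self V _ t).trans_eq (mem_words.1 hV a.succ)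
        exact ((cnt_const (Sum.inr a) h1 (Sum.inr a)).trans (if_pos rfl)).symm
  · exact (Function.Injective.comp_left Sum.inl_injective).injOn

/-- Both nestings enumerate the words in all letters. Their signs use the two orders, whose
disagreement is constant over all words with given multiplicities. -/
theorem sum_words_outer_eq_inner {R : Fin s → ℕ}
    (hR : ∀ i, R i = p i + ∑ t, r (finSigmaFinEquiv ⟨i, t⟩)) {P : ℕ} (hP : P = p₀ + ∑ i, p i)
    (φ : (Fin (s + 1) ⊕ Fin (∑ i, j i) → Fin (N + 1) → ℕ) → M) :
    ∑ W ∈ words N (Fin.cons p₀ R : Fin (s + 1) → ℕ),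
      ∑ w ∈ Fintype.piFinset fun i => words (R i)
        (Fin.cons (p i) (fun t => r (finSigmaFinEquiv ⟨i, t⟩)) : Fin (j i + 1) → ℕ),
        (wsign (· < ·) W * ∏ i, wsign (· < ·) (w i)) •
          φ (Sum.elim
            (Fin.cases (fun t => cnt W 0 t) fun i t => cnt (w i) 0 (cnt W i.succ t))
            fun a t => cnt (w (finSigmaFinEquiv.symm a).1) (finSigmaFinEquiv.symm a).2.succ
              (cnt W (finSigmaFinEquiv.symm a).1.succ t)) =
    sgn (∑ i, (p i : ℤ) * ∑ i' ∈ Finset.Iio i, ∑ t, (r (finSigmaFinEquiv ⟨i', t⟩) : ℤ)) •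
    ∑ V ∈ words N (Fin.cons P r : Fin (∑ i, j i + 1) → ℕ),
      ∑ u ∈ words P (Fin.cons p₀ p : Fin (s + 1) → ℕ),
        (wsign (· < ·) V * wsign (· < ·) u) •
          φ (Sum.elim (fun i t => cnt u i (cnt V 0 t)) fun a t => cnt V a.succ t) := by
  rw [sum_words_outer j p₀ p r N hR, sum_words_inner j p₀ p r N hP, Finset.smul_sum]
  refine Finset.sum_congr rfl fun v hv => ?_
  rw [wsign_change hv (rankOuter_injective j) (rankInner_injective j), rank_disagreement, mul_smul]

end Assoc

section Assoc

universe v₁ v₂ v₃ v₄ v₅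

variable {M : Type*} [AddCommGroup M] {s : ℕ} {j : Fin s → ℕ} {C : SSimp.{v₁}}
  {A : Fin s → SSimp.{v₂}} {X : Fin (∑ i, j i) → SSimp.{v₃}} {Y : Fin s → SSimp.{v₄}} {D : SSimp.{v₅}}

theorem wdeg_comp_wdeg {ι κ : Type*} [DecidableEq ι] [DecidableEq κ] {N R : ℕ} {W : Fin N → ι} {i : ι}
    (hW : cnt W i N ≤ R) (w : Fin R → κ) (k : κ) (r : ℕ) :
    (wdeg w k r).comp (wdeg W i R) = degHom r fun t => cnt w k (cnt W i t) := by
  ext t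
  rw [OrderHom.comp_coe, Function.comp, wdeg_val, wdeg_val, degHom_val,
    min_eq_left ((cnt_le_self W i t).trans hW)]
  exact fun t t' h => cnt_mono w k (cnt_mono W i h)

/-- Sums over shuffles are associative. -/
theorem shSum_assoc
    (f : ∀ i N, (A i).X N → (∀ t, (X (finSigmaFinEquiv ⟨i, t⟩)).X N) → (Y i).X N)
    (hf : ∀ i {N N'} (g : Fin (N' + 1) →o Fin (N + 1)) a x, (Y i).pull g (f i N a x) =
      f i N' ((A i).pull g a) fun t => (X (finSigmaFinEquiv ⟨i, t⟩)).pull g (x t))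
    (γ : ∀ N, C.X N → (∀ i, (A i).X N) → D.X N)
    (hγ : ∀ {N N'} (g : Fin (N' + 1) →o Fin (N + 1)) c a, D.pull g (γ N c a) =
      γ N' (C.pull g c) fun i => (A i).pull g (a i))
    (Φ : ∀ N, C.X N → (∀ i, (Y i).X N) → M) (Ψ : ∀ N, D.X N → (∀ t, (X t).X N) → M)
    (h : ∀ N c a x, Φ N c (fun i => f i N (a i) fun t => x (finSigmaFinEquiv ⟨i, t⟩)) =
      Ψ N (γ N c a) x)
    (c : (p : ℕ) × C.X p) (a : ∀ i, (p : ℕ) × (A i).X p) (x : ∀ t, (r : ℕ) × (X t).X r)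
    {R : Fin s → ℕ} (hR : ∀ i, R i = (a i).1 + ∑ t, (x (finSigmaFinEquiv ⟨i, t⟩)).1)
    {P : ℕ} (hP : P = c.1 + ∑ i, (a i).1) (N : ℕ) :
    ∑ w ∈ Fintype.piFinset fun i => words (R i)
        (Fin.cons (a i).1 (fun t => (x (finSigmaFinEquiv ⟨i, t⟩)).1) : Fin (j i + 1) → ℕ),
      (∏ i, wsign (· < ·) (w i)) • shSum Φ N c (fun i => ⟨R i, f i (R i) ((A i).degen (w i) 0 (a i))
        fun t => (X (finSigmaFinEquiv ⟨i, t⟩)).degen (w i) t.succ (x (finSigmaFinEquiv ⟨i, t⟩))⟩) =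
    sgn (∑ i, ((a i).1 : ℤ) * ∑ i' ∈ Finset.Iio i, ∑ t, ((x (finSigmaFinEquiv ⟨i', t⟩)).1 : ℤ)) •
      ∑ u ∈ words P (Fin.cons c.1 (fun i => (a i).1) : Fin (s + 1) → ℕ), wsign (· < ·) u •
        shSum Ψ N ⟨P, γ P (C.degen u 0 c) fun i => (A i).degen u i.succ (a i)⟩ x := by
  -- Since `f` and `γ` commute with simplicial operators, iterated degeneracies collapse to one
  -- degeneracy of each of `c`, `a i`, `x t`, and the summand depends only on composed counting
  -- functions.
  let φ : (Fin (s + 1) ⊕ Fin (∑ i, j i) → Fin (N + 1) → ℕ) → M := fun F =>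
    Ψ N (γ N (C.pull (degHom c.1 (F (.inl 0))) c.2)
      fun i => (A i).pull (degHom (a i).1 (F (.inl i.succ))) (a i).2)
      fun t => (X t).pull (degHom (x t).1 (F (.inr t))) (x t).2
  have key := sum_words_outer_eq_inner j c.1 (fun i => (a i).1) (fun t => (x t).1) N hR hP φ
  refine Eq.trans ?_ (key.trans (congrArg _ ?_))
  · simp only [shSum, Finset.smul_sum]
    rw [Finset.sum_comm]
    refine Finset.sum_congr rfl fun W hW => Finset.sum_congr rfl fun w hw => ?_
    rw [← mul_smul, mul_comm]
    congr 1
    simp only [φ, ← h]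
    refine congrArg _ (funext fun i => ?_)
    have hWi : cnt W i.succ N ≤ R i := (mem_words.1 hW i.succ).le
    simp only [SSimp.degen, hf, SSimp.pull_pull, wdeg_comp_wdeg hWi, Sum.elim_inl, Sum.elim_inr,
      Fin.cases_succ]
    refine congrArg _ (funext fun t => ?_)
    rw [Equiv.symm_apply_apply]
  · simp only [shSum, Finset.smul_sum]
    rw [Finset.sum_comm]
    refine Finset.sum_congr rfl fun u hu => Finset.sum_congr rfl fun V hV => ?_
    rw [← mul_smul, mul_comm]
    congr 1
    have hVi : cnt V 0 N ≤ P := (mem_words.1 hV 0).le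
    simp only [φ, SSimp.degen, hγ, SSimp.pull_pull, wdeg_comp_wdeg hVi, Sum.elim_inl, Sum.elim_inr]
    rfl

end Assoc

end IDGA

end

noncomputable section

namespace IDGA

/-! ### Permutations of blocks -/

section Blocks

variable {s : ℕ}

theorem blockEquiv_finSigma (σ : Equiv.Perm (Fin s)) (m : Fin s → ℕ) (i : Fin s)
    (u : Fin (m (σ.symm i))) :
    blockEquiv σ m (finSigmaFinEquiv (n := fun i => m (σ.symm i)) ⟨i, u⟩) = ⟨σ.symm i, u⟩ := by
  simp [blockEquiv]

theorem sum_lt_perm (σ : Equiv.Perm (Fin s)) (m : Fin s → ℕ) (i : Fin s) :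
    (∑ i', if i' < i then m (σ.symm i') else 0) = ∑ i', if σ i' < i then m i' else 0 := by
  rw [← Equiv.sum_comp σ]
  simp

theorem blockEquiv_val (σ : Equiv.Perm (Fin s)) (m : Fin s → ℕ) (y : Fin (∑ i, m (σ.symm i))) :
    y.val = (∑ i', if σ i' < σ (blockEquiv σ m y).1 then m i' else 0) + (blockEquiv σ m y).2.val := by
  obtain ⟨⟨i, u⟩, rfl⟩ := finSigmaFinEquiv.surjective y
  rw [blockEquiv_finSigma, finSigma_val, sum_lt_perm, Equiv.apply_symm_apply]

theorem blockEquiv_symm_val (σ : Equiv.Perm (Fin s)) (m : Fin s → ℕ) (x : (i : Fin s) × Fin (m i)) :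
    ((blockEquiv σ m).symm x).val = (∑ i', if σ i' < σ x.1 then m i' else 0) + x.2.val := by
  rw [blockEquiv_val, Equiv.apply_symm_apply]

theorem blockPerm_apply (σ : Equiv.Perm (Fin s)) (j : Fin s → ℕ) (i : Fin s)
    (t : Fin (j (σ.symm i))) : blockPerm σ j (finSigmaFinEquiv ⟨σ.symm i, t⟩) =
      finCongr (Equiv.sum_comp σ.symm j) (finSigmaFinEquiv (n := fun i => j (σ.symm i)) ⟨i, t⟩) := by
  simp only [blockPerm, Equiv.trans_apply, Equiv.symm_apply_apply]
  rw [← blockEquiv_finSigma, Equiv.symm_apply_apply]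

theorem blockPerm_val (σ : Equiv.Perm (Fin s)) (j : Fin s → ℕ) (x : (i : Fin s) × Fin (j i)) :
    (blockPerm σ j (finSigmaFinEquiv x)).val =
      (∑ i', if σ i' < σ x.1 then j i' else 0) + x.2.val := by
  simp only [blockPerm, Equiv.trans_apply, Equiv.symm_apply_apply]
  exact blockEquiv_symm_val σ j x

theorem permSum_apply {j : Fin s → ℕ} (τ : ∀ i, Equiv.Perm (Fin (j i))) (i : Fin s) (t : Fin (j i)) :
    permSum τ (finSigmaFinEquiv ⟨i, t⟩) = finSigmaFinEquiv ⟨i, τ i t⟩ := by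
  simp [permSum]

theorem permComp_val {j : Fin s → ℕ} (σ : Equiv.Perm (Fin s)) (τ : ∀ i, Equiv.Perm (Fin (j i)))
    (i : Fin s) (t : Fin (j i)) : (permComp σ τ (finSigmaFinEquiv ⟨i, t⟩)).val =
      (∑ i', if σ i' < σ i then j i' else 0) + (τ i t).val := by
  rw [permComp, Equiv.Perm.mul_apply, permSum_apply, blockPerm_val]

/-- The permuted blocks are disjoint intervals in the order given by `σ`, so positions are compared
lexicographically. -/
theorem block_val_lt_iff (σ : Equiv.Perm (Fin s)) (m : Fin s → ℕ) {i i' : Fin s} {a b : ℕ}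
    (ha : a < m i) (hb : b < m i') :
    (∑ k, if σ k < σ i then m k else 0) + a < (∑ k, if σ k < σ i' then m k else 0) + b ↔
      σ i < σ i' ∨ i = i' ∧ a < b := by
  have key : ∀ {i i' : Fin s}, σ i < σ i' → (∑ k, if σ k < σ i then m k else 0) + m i ≤
      ∑ k, if σ k < σ i' then m k else 0 := by
    intro i i' h
    have h2 : m i = ∑ k, if k = i then m k else 0 := by simp
    rw [h2, ← Finset.sum_add_distrib]
    refine Finset.sum_le_sum fun k _ => ?_
    by_cases hk : k = i
    · subst hk; simp [h]
    · by_cases h3 : σ k < σ i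
      · simp [hk, h3, h3.trans h]
      · simp [hk, h3]
  rcases lt_trichotomy (σ i) (σ i') with h | h | h
  · have := key h
    simp only [h, true_or, iff_true]; omega
  · obtain rfl := σ.injective h
    simp
  · have := key h
    have h1 : i ≠ i' := fun h' => by rw [h'] at h; exact lt_irrefl _ h
    simp only [h.not_gt, h1, false_and, or_self, iff_false]; omega

theorem permComp_lt_iff {j : Fin s → ℕ} (σ : Equiv.Perm (Fin s)) (τ : ∀ i, Equiv.Perm (Fin (j i)))
    (i i' : Fin s) (t : Fin (j i)) (t' : Fin (j i')) :
    permComp σ τ (finSigmaFinEquiv ⟨i, t⟩) < permComp σ τ (finSigmaFinEquiv ⟨i', t'⟩) ↔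
      σ i < σ i' ∨ i = i' ∧ (τ i t).val < (τ i' t').val := by
  rw [Fin.lt_def, permComp_val, permComp_val]
  exact block_val_lt_iff σ j (τ i t).2 (τ i' t').2

/-- A permutation, as a permutation of a set with the same number of elements. -/
def permCast {m n : ℕ} (h : m = n) (σ : Equiv.Perm (Fin m)) : Equiv.Perm (Fin n) :=
  (finCongr h).permCongr σ

theorem permCast_val {m n : ℕ} (h : m = n) (σ : Equiv.Perm (Fin m)) (x : Fin m) (y : Fin n)
    (hxy : x.val = y.val) : (permCast h σ y).val = (σ x).val := by
  subst h
  obtain rfl := Fin.ext hxy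
  rfl

/-- The left equivariance of the operad at a single vertex. Permuting the blocks by `ρ` first does
not change the set of blocks that `σ * ρ` puts before a given one. -/
theorem permComp_mul {j : Fin s → ℕ} (σ ρ : Equiv.Perm (Fin s)) (τ : ∀ i, Equiv.Perm (Fin (j i))) :
    permComp (σ * ρ) τ = permCast (Equiv.sum_comp ρ.symm j)
      (permComp (j := fun i => j (ρ.symm i)) σ fun i => τ (ρ.symm i)) * blockPerm ρ j := by
  ext x
  obtain ⟨⟨i, t⟩, rfl⟩ := finSigmaFinEquiv.surjective x
  obtain ⟨k, rfl⟩ := ρ.symm.surjective i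
  rw [permComp_val, Equiv.Perm.mul_apply (permCast _ _), blockPerm_apply]
  refine Eq.trans ?_ (permCast_val (Equiv.sum_comp ρ.symm j) _
    (finSigmaFinEquiv (n := fun i => j (ρ.symm i)) ⟨k, t⟩) _ rfl).symm
  rw [permComp_val, ← Equiv.sum_comp ρ fun k' => if σ k' < σ k then j (ρ.symm k') else 0]
  simp

theorem permComp_mul_permSum {j : Fin s → ℕ} (σ : Equiv.Perm (Fin s))
    (τ υ : ∀ i, Equiv.Perm (Fin (j i))) :
    permComp σ (fun i => τ i * υ i) = permComp σ τ * permSum υ := by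
  ext x
  obtain ⟨⟨i, t⟩, rfl⟩ := finSigmaFinEquiv.surjective x
  rw [permComp_val, Equiv.Perm.mul_apply (permComp σ τ), permSum_apply, permComp_val]
  rfl

/-- The small blocks preceding a given one are those of the preceding large blocks and the preceding
small ones within the same large block. This additivity of offsets is the source of all
associativity statements about blocks. -/
theorem nested_block_sum {j : Fin s → ℕ} (l : Fin (∑ i, j i) → ℕ) (σ : Equiv.Perm (Fin s))
    (τ : ∀ i, Equiv.Perm (Fin (j i))) (i : Fin s) (t : Fin (j i)) :
    (∑ u, if permComp σ τ u < permComp σ τ (finSigmaFinEquiv ⟨i, t⟩) then l u else 0) =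
      (∑ i', if σ i' < σ i then ∑ t', l (finSigmaFinEquiv ⟨i', t'⟩) else 0) +
        ∑ t', if τ i t' < τ i t then l (finSigmaFinEquiv ⟨i, t'⟩) else 0 := by
  rw [sum_finSigma]
  simp only [permComp_lt_iff]
  have h : ∀ i', (∑ t', if σ i' < σ i ∨ i' = i ∧ (τ i' t').val < (τ i t).val then
      l (finSigmaFinEquiv ⟨i', t'⟩) else 0) =
      (if σ i' < σ i then ∑ t', l (finSigmaFinEquiv ⟨i', t'⟩) else 0) +
        if i' = i then (∑ t', if (τ i' t').val < (τ i t).val then l (finSigmaFinEquiv ⟨i', t'⟩) else 0)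
          else 0 := by
    intro i'
    by_cases hi : i' = i
    · subst hi; simp
    · simp [hi]
  rw [Finset.sum_congr rfl fun i' _ => h i', Finset.sum_add_distrib, Finset.sum_ite_eq']
  simp

theorem permComp_one_one {j : Fin s → ℕ} :
    permComp (1 : Equiv.Perm (Fin s)) (fun i => (1 : Equiv.Perm (Fin (j i)))) = 1 := by
  ext x
  obtain ⟨⟨i, t⟩, rfl⟩ := finSigmaFinEquiv.surjective x
  rw [permComp_val]
  exact (finSigma_val ⟨i, t⟩).symm

/-- The case of identity permutations in `nested_block_sum`; it matches the two enumerations of a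
two-fold concatenation. -/
theorem finSigma_finSigma_val {j : Fin s → ℕ} (l : Fin (∑ i, j i) → ℕ) (i : Fin s) (t : Fin (j i))
    (b : Fin (l (finSigmaFinEquiv ⟨i, t⟩))) :
    (finSigmaFinEquiv (n := fun i => ∑ t, l (finSigmaFinEquiv ⟨i, t⟩)) ⟨i,
      finSigmaFinEquiv (n := fun t => l (finSigmaFinEquiv ⟨i, t⟩)) ⟨t, b⟩⟩).val =
    (finSigmaFinEquiv (n := l) ⟨finSigmaFinEquiv ⟨i, t⟩, b⟩).val := by
  have h := nested_block_sum l 1 (fun i => 1) i t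
  rw [permComp_one_one] at h
  rw [finSigma_val, finSigma_val, finSigma_val, ← add_assoc]
  exact congrArg (· + b.val) h.symm

theorem permComp_assoc {j : Fin s → ℕ} (l : Fin (∑ i, j i) → ℕ) (σ : Equiv.Perm (Fin s))
    (τ : ∀ i, Equiv.Perm (Fin (j i))) (υ : ∀ u, Equiv.Perm (Fin (l u))) :
    permCast (sum_blocks l) (permComp (j := fun i => ∑ t, l (finSigmaFinEquiv ⟨i, t⟩)) σ
      fun i => permComp (τ i) fun t => υ (finSigmaFinEquiv ⟨i, t⟩)) = permComp (permComp σ τ) υ := by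
  ext x
  obtain ⟨⟨u, b⟩, rfl⟩ := finSigmaFinEquiv.surjective x
  obtain ⟨⟨i, t⟩, rfl⟩ := finSigmaFinEquiv.surjective u
  rw [permCast_val _ _ _ _ (finSigma_finSigma_val l i t b), permComp_val, permComp_val, permComp_val,
    nested_block_sum, add_assoc]

theorem permComp_one_left {j : Fin 1 → ℕ} (τ : ∀ i, Equiv.Perm (Fin (j i))) :
    permCast (Fin.sum_univ_one j) (permComp 1 τ) = τ 0 := by
  ext x
  have hx : (finSigmaFinEquiv (n := j) ⟨0, x⟩).val = x.val := by rw [finSigma_val]; simp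
  rw [permCast_val _ _ _ _ hx, permComp_val]
  simp

theorem permComp_one_right (σ : Equiv.Perm (Fin s)) (h : ∑ _i : Fin s, 1 = s) :
    permCast h (permComp (j := fun _ => 1) σ fun _ => 1) = σ := by
  have hcard : ∀ a : Fin s, (∑ i, if i < a then 1 else 0) = a.val := by
    intro a
    rw [← Finset.card_filter, show Finset.univ.filter (· < a) = Finset.Iio a by ext; simp,
      Fin.card_Iio]
  ext x
  have hx : (finSigmaFinEquiv (n := fun _ : Fin s => 1) ⟨x, 0⟩).val = x.val := by
    rw [finSigma_val, hcard]; simp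
  rw [permCast_val _ _ _ _ hx, permComp_val, ← sum_lt_perm σ (fun _ => 1), hcard]
  simp

/-! ### Koszul signs -/

theorem koszul_one (q : Fin s → ℤ) : koszul 1 q = 1 := by
  rw [koszul, Finset.sum_eq_zero, sgn_zero]
  refine fun i _ => Finset.sum_eq_zero fun j _ => if_neg ?_
  rintro ⟨h1, h2⟩
  exact lt_asymm h1 h2

/-- A pair inverted by `ρ` and inverted back by `σ` contributes twice on the right and not at all on
the left; every other pair contributes equally to both sides. -/
theorem koszul_mul (σ ρ : Equiv.Perm (Fin s)) (q : Fin s → ℤ) :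
    koszul (σ * ρ) q = koszul ρ q * koszul σ fun i => q (ρ.symm i) := by
  unfold koszul
  rw [← sgn_add]
  refine sgn_congr ?_
  have h1 : (∑ i, ∑ j, if i < j ∧ σ j < σ i then q (ρ.symm i) * q (ρ.symm j) else 0) =
      ∑ i, ∑ j, if i < j then (if ρ i < ρ j ∧ σ (ρ j) < σ (ρ i) then q i * q j else 0) +
        (if ρ j < ρ i ∧ σ (ρ i) < σ (ρ j) then q j * q i else 0) else 0 := by
    -- Reindexing by `ρ` does not preserve the order of a pair, so the sum is folded onto unordered
    -- pairs first.
    have h2 : ∀ F : Fin s → Fin s → ℤ, (∀ i, F i i = 0) →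
        ∑ i, ∑ j, F i j = ∑ i, ∑ j, if i < j then F i j + F j i else 0 := by
      intro F hF
      have : ∀ i j, F i j = (if i < j then F i j else 0) + if j < i then F i j else 0 := by
        intro i j
        rcases lt_trichotomy i j with h | h | h
        · simp [h, h.not_gt]
        · subst h; simp [hF]
        · simp [h, h.not_gt]
      rw [Finset.sum_congr rfl fun i _ => Finset.sum_congr rfl fun j _ => this i j]
      simp only [Finset.sum_add_distrib]
      rw [Finset.sum_comm (f := fun i j => if j < i then F i j else 0), ← Finset.sum_add_distrib]
      refine Finset.sum_congr rfl fun i _ => ?_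
      rw [← Finset.sum_add_distrib]
      exact Finset.sum_congr rfl fun j _ => by split_ifs <;> simp
    rw [← Equiv.sum_comp ρ]
    rw [Finset.sum_congr rfl fun i _ => (Equiv.sum_comp ρ _).symm]
    simp only [Equiv.symm_apply_apply]
    exact h2 (fun i j => if ρ i < ρ j ∧ σ (ρ j) < σ (ρ i) then q i * q j else 0)
      fun i => if_neg (by simp)
  rw [h1, ← Finset.sum_add_distrib, ← Finset.sum_sub_distrib]
  refine Finset.even_sum _ fun i _ => ?_
  rw [← Finset.sum_add_distrib, ← Finset.sum_sub_distrib]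
  refine Finset.even_sum _ fun j _ => ?_
  by_cases h : i < j
  · rcases lt_or_gt_of_ne (ρ.injective.ne h.ne) with h3 | h3 <;>
      rcases lt_or_gt_of_ne (σ.injective.ne (ρ.injective.ne h.ne)) with h4 | h4 <;>
      simp [h, h3, h4, h3.not_gt, h4.not_gt, mul_comm (q j)]
  · simp [h]

/-- Letters of two different blocks are inverted exactly when `σ` inverts the blocks, and then the
products of their degrees add up to the product of the total degrees. Inversions inside a block are
those of `τ i`. -/
theorem koszul_permComp {j : Fin s → ℕ} (σ : Equiv.Perm (Fin s)) (τ : ∀ i, Equiv.Perm (Fin (j i)))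
    (q : Fin (∑ i, j i) → ℤ) : koszul (permComp σ τ) q =
      koszul σ (fun i => ∑ t, q (finSigmaFinEquiv ⟨i, t⟩)) *
        ∏ i, koszul (τ i) fun t => q (finSigmaFinEquiv ⟨i, t⟩) := by
  have hprod : ∀ F : Fin s → ℤ, ∏ i, sgn (F i) = sgn (∑ i, F i) := by
    intro F
    induction (Finset.univ : Finset (Fin s)) using Finset.induction_on with
    | empty => simp
    | insert a S ha ih => rw [Finset.prod_insert ha, Finset.sum_insert ha, sgn_add, ih]
  unfold koszul
  rw [hprod, ← sgn_add]
  congr 1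
  rw [sum_finSigma, ← Finset.sum_add_distrib]
  refine Finset.sum_congr rfl fun i _ => ?_
  have h1 : ∀ (t : Fin (j i)), (∑ u, if finSigmaFinEquiv ⟨i, t⟩ < u ∧
      permComp σ τ u < permComp σ τ (finSigmaFinEquiv ⟨i, t⟩) then
        q (finSigmaFinEquiv ⟨i, t⟩) * q u else 0) =
      (∑ i', if i < i' ∧ σ i' < σ i then ∑ t', q (finSigmaFinEquiv ⟨i, t⟩) *
        q (finSigmaFinEquiv ⟨i', t'⟩) else 0) +
        ∑ t', if t < t' ∧ τ i t' < τ i t then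
          q (finSigmaFinEquiv ⟨i, t⟩) * q (finSigmaFinEquiv ⟨i, t'⟩) else 0 := by
    intro t
    rw [sum_finSigma]
    simp only [permComp_lt_iff, finSigma_lt_iff]
    have h : ∀ i', (∑ t' : Fin (j i'), if (i < i' ∨ i = i' ∧ t.val < t'.val) ∧
        (σ i' < σ i ∨ i' = i ∧ (τ i' t').val < (τ i t).val) then
          q (finSigmaFinEquiv ⟨i, t⟩) * q (finSigmaFinEquiv ⟨i', t'⟩) else 0) =
        (if i < i' ∧ σ i' < σ i then ∑ t', q (finSigmaFinEquiv ⟨i, t⟩) *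
          q (finSigmaFinEquiv ⟨i', t'⟩) else 0) +
        if i' = i then (∑ t' : Fin (j i'), if t.val < t'.val ∧ (τ i' t').val < (τ i t).val then
          q (finSigmaFinEquiv ⟨i, t⟩) * q (finSigmaFinEquiv ⟨i', t'⟩) else 0) else 0 := by
      intro i'
      by_cases hi : i' = i
      · subst hi; simp
      · by_cases h2 : i < i' ∧ σ i' < σ i
        · simp [hi, h2]
        · have : ¬ ((i < i' ∨ i = i' ∧ False) ∧ (σ i' < σ i ∨ False)) := by simpa using h2
          simp [hi, Ne.symm hi, h2]
    rw [Finset.sum_congr rfl fun i' _ => h i', Finset.sum_add_distrib, Finset.sum_ite_eq']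
    simp
  rw [Finset.sum_congr rfl fun t _ => h1 t, Finset.sum_add_distrib]
  congr 1
  rw [Finset.sum_comm]
  refine Finset.sum_congr rfl fun i' _ => ?_
  split_ifs with h
  · rw [Finset.sum_mul_sum]
  · simp

/-- The differential has degree `-1`. Permuting the factors and then moving it to the `i`-th one
gives the same sign as moving it there first and then permuting, with the degree of that factor
lowered. -/
theorem koszul_update (σ : Equiv.Perm (Fin s)) (q : Fin s → ℤ) (i : Fin s) :
    koszul σ q * sgn (∑ j, if σ j < σ i then q j else 0) =
      sgn (∑ j ∈ Finset.Iio i, q j) * koszul σ (Function.update q i (q i - 1)) := by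
  unfold koszul
  rw [← sgn_add, ← sgn_add]
  refine sgn_congr ?_
  have h1 : (∑ a, ∑ b, if a < b ∧ σ b < σ a then q a * q b else 0) =
      (∑ a, ∑ b, if a < b ∧ σ b < σ a then
        Function.update q i (q i - 1) a * Function.update q i (q i - 1) b else 0) +
      ((∑ b, if i < b ∧ σ b < σ i then q b else 0) +
        ∑ a, if a < i ∧ σ i < σ a then q a else 0) := by
    have h2 : ∀ a b, (if a < b ∧ σ b < σ a then q a * q b else 0) =
        (if a < b ∧ σ b < σ a then
          Function.update q i (q i - 1) a * Function.update q i (q i - 1) b else 0) +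
        ((if a = i then (if i < b ∧ σ b < σ i then q b else 0) else 0) +
          if b = i then (if a < i ∧ σ i < σ a then q a else 0) else 0) := by
      intro a b
      by_cases ha : a = i
      · subst ha
        by_cases hb : b = a
        · subst hb; simp
        · simp only [hb, Function.update_self, Function.update_of_ne hb, if_true, if_false]
          split_ifs <;> ring
      · by_cases hb : b = i
        · subst hb
          simp only [ha, Function.update_self, Function.update_of_ne ha, if_true, if_false]
          split_ifs <;> ring
        · simp [ha, hb]
    rw [Finset.sum_congr rfl fun a _ => Finset.sum_congr rfl fun b _ => h2 a b]
    simp only [Finset.sum_add_distrib]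
    congr 2
    · rw [Finset.sum_comm]
      exact Finset.sum_congr rfl fun b _ => by simp
    · simp
  have h3 : (∑ j, if σ j < σ i then q j else 0) = (∑ b, if i < b ∧ σ b < σ i then q b else 0) +
      ∑ b, if b < i ∧ σ b < σ i then q b else 0 := by
    rw [← Finset.sum_add_distrib]
    refine Finset.sum_congr rfl fun b _ => ?_
    rcases lt_trichotomy b i with h | h | h
    · simp [h, h.not_gt]
    · subst h; simp
    · simp [h, h.not_gt]
  have h4 : (∑ j ∈ Finset.Iio i, q j) = (∑ a, if a < i ∧ σ i < σ a then q a else 0) +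
      ∑ b, if b < i ∧ σ b < σ i then q b else 0 := by
    rw [show Finset.Iio i = Finset.univ.filter (· < i) by ext; simp, Finset.sum_filter,
      ← Finset.sum_add_distrib]
    refine Finset.sum_congr rfl fun b _ => ?_
    by_cases h : b < i
    · rcases lt_or_gt_of_ne (σ.injective.ne h.ne) with h5 | h5 <;> simp [h, h5, h5.not_gt]
    · simp [h]
  rw [h1, h3, h4]
  -- The factors moved by `σ` from behind the `i`-th one to before it contribute once to the Koszul
  -- sign and once to the sign of the differential.
  exact ⟨∑ b, if i < b ∧ σ b < σ i then q b else 0, by ring⟩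

end Blocks

end IDGA

end

noncomputable section

namespace IDGA

/-! ### Graded modules and multilinear maps -/

namespace Gr

variable {k : Type u} [CommRing k]

@[simp]
theorem d_ι (X : Ch.{u, v} k) (n : ℤ) (x : X.X n) :
    d X (ι X n x) = ι X (n - 1) ((X.d n (n - 1)).hom x) :=
  DirectSum.toModule_lof _ _ _

theorem d_ι_of_eq (X : Ch.{u, v} k) {n m : ℤ} (h : m + 1 = n) (x : X.X n) :
    d X (ι X n x) = ι X m ((X.d n m).hom x) := by
  obtain rfl : m = n - 1 := by omega
  exact d_ι X n x

@[simp]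
theorem map_ι {X Y : Ch.{u, v} k} (f : X ⟶ Y) (n : ℤ) (x : X.X n) :
    map f (ι X n x) = ι Y n ((f.f n).hom x) :=
  DirectSum.toModule_lof _ _ _

theorem hom_ext {X : Ch.{u, v} k} {M : Type*} [AddCommGroup M] [Module k M] {f g : Gr X →ₗ[k] M}
    (h : ∀ n x, f (ι X n x) = g (ι X n x)) : f = g :=
  DirectSum.linearMap_ext _ fun n => LinearMap.ext fun x => h n x

@[simp]
theorem map_id (X : Ch.{u, v} k) : map (𝟙 X) = LinearMap.id :=
  hom_ext fun n x => by simp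

theorem map_comp {X Y Z : Ch.{u, v} k} (f : X ⟶ Y) (g : Y ⟶ Z) :
    map (f ≫ g) = map g ∘ₗ map f :=
  hom_ext fun n x => by simp

theorem map_map {X Y Z : Ch.{u, v} k} (f : X ⟶ Y) (g : Y ⟶ Z) (x : Gr X) :
    map g (map f x) = map (f ≫ g) x := by
  rw [map_comp]; rfl

theorem d_map {X Y : Ch.{u, v} k} (f : X ⟶ Y) (x : Gr X) : d Y (map f x) = map f (d X x) := by
  suffices d Y ∘ₗ map f = map f ∘ₗ d X from LinearMap.congr_fun this x
  refine hom_ext fun n x => ?_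
  simp only [LinearMap.comp_apply, map_ι, d_ι]
  exact congrArg _ (hom_congr (f.comm n (n - 1)) x)

theorem ι_injective (X : Ch.{u, v} k) (n : ℤ) : Function.Injective (ι X n) :=
  DirectSum.of_injective n

theorem map_mem_range {X Y : Ch.{u, v} k} (f : X ⟶ Y) {n : ℤ} {x : Gr X}
    (hx : x ∈ LinearMap.range (ι X n)) : map f x ∈ LinearMap.range (ι Y n) := by
  obtain ⟨x, rfl⟩ := hx
  exact ⟨_, (map_ι f n x).symm⟩

theorem d_mem_range {X : Ch.{u, v} k} {n : ℤ} {x : Gr X} (hx : x ∈ LinearMap.range (ι X n)) :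
    d X x ∈ LinearMap.range (ι X (n - 1)) := by
  obtain ⟨x, rfl⟩ := hx
  exact ⟨_, (d_ι X n x).symm⟩

end Gr

section Multi

variable (k : Type u) [CommRing k] {ι : Type*} [DecidableEq ι] {M : ι → Type*}
  [∀ i, AddCommGroup (M i)] [∀ i, Module k (M i)] {N : Type*} [AddCommGroup N] [Module k N]

/-- A function of several variables is linear in each variable. -/
def IsMulti (f : (∀ i, M i) → N) : Prop :=
  ∀ x i, ∃ g : M i →ₗ[k] N, ∀ a, f (Function.update x i a) = g a

variable {k}

theorem MultilinearMap.isMulti (f : MultilinearMap k M N) : IsMulti k f :=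
  fun x i => ⟨f.toLinearMap x i, fun _ => rfl⟩

theorem IsMulti.linear_comp {N' : Type*} [AddCommGroup N'] [Module k N'] {f : (∀ i, M i) → N}
    (hf : IsMulti k f) (g : N →ₗ[k] N') : IsMulti k fun x => g (f x) := fun x i => by
  obtain ⟨h, hh⟩ := hf x i
  exact ⟨g ∘ₗ h, fun a => by simp [hh]⟩

theorem IsMulti.zsmul {f : (∀ i, M i) → N} (hf : IsMulti k f) (n : ℤ) :
    IsMulti k fun x => n • f x := fun x i => by
  obtain ⟨h, hh⟩ := hf x i
  exact ⟨n • h, fun a => by simp [hh]⟩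

theorem IsMulti.add {f g : (∀ i, M i) → N} (hf : IsMulti k f) (hg : IsMulti k g) :
    IsMulti k fun x => f x + g x := fun x i => by
  obtain ⟨h, hh⟩ := hf x i
  obtain ⟨h', hh'⟩ := hg x i
  exact ⟨h + h', fun a => by simp [hh, hh']⟩

theorem IsMulti.sum {κ : Type*} (S : Finset κ) {f : κ → (∀ i, M i) → N}
    (hf : ∀ j, IsMulti k (f j)) : IsMulti k fun x => ∑ j ∈ S, f j x := fun x i => by
  choose h hh using fun j => hf j x i
  exact ⟨∑ j ∈ S, h j, fun a => by simp [hh]⟩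

/-- Functions that are linear in each variable agree if they agree on generators. -/
theorem IsMulti.eq_of_span [Fintype ι] {f g : (∀ i, M i) → N} (hf : IsMulti k f) (hg : IsMulti k g)
    (S : ∀ i, Set (M i)) (h : ∀ x, (∀ i, x i ∈ S i) → f x = g x) (x : ∀ i, M i)
    (hx : ∀ i, x i ∈ Submodule.span k (S i)) : f x = g x := by
  -- The induction enlarges the set `T` of coordinates that may be arbitrary elements of the span,
  -- the other ones being generators.
  suffices ∀ (T : Finset ι) (x : ∀ i, M i), (∀ i ∈ T, x i ∈ Submodule.span k (S i)) →
      (∀ i ∉ T, x i ∈ S i) → f x = g x from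
    this Finset.univ x (fun i _ => hx i) fun i hi => absurd (Finset.mem_univ i) hi
  intro T
  induction T using Finset.induction_on with
  | empty => exact fun x _ h2 => h x fun i => h2 i (Finset.notMem_empty i)
  | insert a T ha ih =>
    intro x h1 h2
    obtain ⟨f', hf'⟩ := hf x a
    obtain ⟨g', hg'⟩ := hg x a
    have key : Set.EqOn f' g' (Submodule.span k (S a)) := by
      refine LinearMap.eqOn_span fun b hb => ?_
      rw [← hf', ← hg']
      refine ih _ (fun i hi => ?_) fun i hi => ?_
      · have : i ≠ a := fun h => ha (h ▸ hi)
        rw [Function.update_of_ne this]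
        exact h1 i (Finset.mem_insert_of_mem hi)
      · by_cases hia : i = a
        · subst hia; rwa [Function.update_self]
        · rw [Function.update_of_ne hia]
          exact h2 i (by simp [hia, hi])
    have := key (h1 a (Finset.mem_insert_self a T))
    rwa [← hf', ← hg', Function.update_eq_self] at this

variable {s : ℕ} {j : Fin s → ℕ} {A : Fin s → Type*} [∀ i, AddCommGroup (A i)]
  [∀ i, Module k (A i)] {X : Fin (∑ i, j i) → Type*} [∀ t, AddCommGroup (X t)] [∀ t, Module k (X t)]

theorem IsMulti.multilinear_comp {B : Fin s → Type*} [∀ i, AddCommGroup (B i)] [∀ i, Module k (B i)]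
    (Φ : MultilinearMap k B N) (f : ∀ i, A i →ₗ[k] B i) :
    IsMulti k fun a : ∀ i, A i => Φ fun i => f i (a i) :=
  MultilinearMap.isMulti (Φ.compLinearMap f)

/-- Changing the variable at `(i₀, t₀)` affects only the argument `i₀` of `Φ`, and this argument
depends linearly on it. -/
theorem IsMulti.nested (Φ : MultilinearMap k A N)
    (f : ∀ i, MultilinearMap k (fun t => X (finSigmaFinEquiv ⟨i, t⟩)) (A i)) :
    IsMulti k fun x : ∀ t, X t => Φ fun i => f i fun t => x (finSigmaFinEquiv ⟨i, t⟩) := by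
  intro x u
  obtain ⟨⟨i₀, t₀⟩, rfl⟩ := finSigmaFinEquiv.surjective u
  refine ⟨Φ.toLinearMap (fun i => f i fun t => x (finSigmaFinEquiv ⟨i, t⟩)) i₀ ∘ₗ
    (f i₀).toLinearMap (fun t => x (finSigmaFinEquiv ⟨i₀, t⟩)) t₀, fun b => ?_⟩
  change _ = Φ (Function.update _ _ (f i₀ (Function.update _ _ _)))
  refine congrArg Φ (funext fun i => ?_)
  by_cases hi : i = i₀
  · subst hi
    rw [Function.update_self]
    congr 1
    funext t
    by_cases ht : t = t₀
    · subst ht; simp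
    · rw [Function.update_of_ne ht, Function.update_of_ne]
      simpa using ht
  · rw [Function.update_of_ne hi]
    congr 1
    funext t
    rw [Function.update_of_ne]
    intro h
    exact hi (congrArg Sigma.fst (finSigmaFinEquiv.injective h))

theorem IsMulti.perm {B : Fin s → Type*} [∀ i, AddCommGroup (B i)] [∀ i, Module k (B i)]
    (σ : Equiv.Perm (Fin s)) (Φ : MultilinearMap k (fun i => B (σ.symm i)) N) :
    IsMulti k fun x : ∀ i, B i => Φ fun i => x (σ.symm i) := by
  intro x i
  obtain ⟨i, rfl⟩ := σ.symm.surjective i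
  refine ⟨Φ.toLinearMap (fun i => x (σ.symm i)) i, fun b => ?_⟩
  change _ = Φ (Function.update _ _ _)
  refine congrArg Φ (funext fun i' => ?_)
  by_cases hi : i' = i
  · subst hi; simp
  · rw [Function.update_of_ne hi, Function.update_of_ne (by simpa using hi)]

end Multi

/-! ### Shuffles and words -/

theorem sum_shuffle {m : ℕ} {M : Type*} [AddCommMonoid M] (r : Fin m → ℕ)
    (F : (Fin (∑ i, r i) → Fin m) → M) :
    ∑ w : Shuffle r, F w.1 = ∑ w ∈ words (∑ i, r i) r, F w := by
  refine (Finset.sum_subtype (words (∑ i, r i) r) (fun w => ?_) F).symm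
  simp [words]

theorem Shuffle.sign_eq {m : ℕ} {r : Fin m → ℕ} (w : Shuffle r) : w.sign = wsign (· < ·) w.1 := rfl

theorem Shuffle.deg_eq {m : ℕ} {r : Fin m → ℕ} (w : Shuffle r) (i : Fin m) :
    w.deg i = wdeg w.1 i (r i) := by
  ext t
  rw [wdeg_val, min_eq_left]
  · rfl
  · have h := w.2 i
    rw [← cnt_self] at h
    exact (cnt_le_self w.1 i t).trans_eq h

end IDGA

end

noncomputable section

namespace IDGA

/-! ### The Barratt--Eccles operad on simplices -/

/-- The nerve of the translation category of the symmetric group. -/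
abbrev beS (s : ℕ) : SSimp.{0} where
  X := ESimplex s
  pull f a := a ∘ f
  pull_id _ := rfl
  pull_pull _ _ _ := rfl

section

variable (k : Type u) [CommRing k]

/-- The element of the Barratt--Eccles operad given by a simplex. -/
def beEl {s : ℕ} (z : (p : ℕ) × (beS s).X p) : Gr (beObj k s) :=
  Gr.ι (beObj k s) z.1 (beGen (show ESimplex s z.1 from z.2))

theorem beEl_mem_range {s : ℕ} (z : (p : ℕ) × (beS s).X p) {n : ℤ} (h : (z.1 : ℤ) = n) :
    beEl k z ∈ LinearMap.range (Gr.ι (beObj k s) n) := by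
  subst h
  exact ⟨_, rfl⟩

theorem beEl_span {s : ℕ} (n : ℤ) (x : (beObj k s).X n) :
    Gr.ι (beObj k s) n x ∈ Submodule.span k
      {y | ∃ z : (p : ℕ) × (beS s).X p, (z.1 : ℤ) = n ∧ beEl k z = y} := by
  revert x
  change ∀ x : ⨁ q : {q : ℕ // (q : ℤ) = n}, (ESimplex s q.1 →₀ k), _
  intro x
  induction x using DirectSum.induction_on with
  | zero => exact (map_zero (Gr.ι (beObj k s) n)).symm ▸ Submodule.zero_mem _
  | add x y hx hy => exact (map_add (Gr.ι (beObj k s) n) x y).symm ▸ Submodule.add_mem _ hx hy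
  | of q f =>
    obtain ⟨q, rfl⟩ := q
    let F : (ESimplex s q →₀ k) →ₗ[k] Gr (beObj k s) := Gr.ι (beObj k s) q ∘ₗ
      (DirectSum.lof k {p : ℕ // (p : ℤ) = q} (fun p => ESimplex s p.1 →₀ k) ⟨q, rfl⟩)
    change F f ∈ _
    rw [← Finsupp.sum_single f, Finsupp.sum, map_sum]
    refine Submodule.sum_mem _ fun c _ => ?_
    have : Finsupp.single c (f c) = f c • Finsupp.single c (1 : k) := by simp
    rw [this, map_smul]
    exact Submodule.smul_mem _ _ (Submodule.subset_span ⟨⟨q, c⟩, rfl, rfl⟩)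

theorem beEl_span_top {s : ℕ} (x : Gr (beObj k s)) :
    x ∈ Submodule.span k (Set.range (beEl k (s := s))) := by
  induction x using DirectSum.induction_on with
  | zero => exact Submodule.zero_mem _
  | add x y hx hy => exact Submodule.add_mem _ hx hy
  | of n x =>
    refine Submodule.span_mono ?_ (beEl_span k n x)
    rintro _ ⟨z, _, rfl⟩
    exact ⟨z, rfl⟩

theorem beCoord_beEl {s : ℕ} (z : (p : ℕ) × ESimplex s p) :
    beCoord k s (beEl k z) = DFinsupp.single z 1 := by
  refine (DirectSum.toModule_lof _ _ _).trans ?_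
  refine (DirectSum.toModule_lof _ _ _).trans ?_
  refine (Finsupp.linearCombination_single _ _ _).trans ?_
  exact one_smul _ _

theorem map_beAct_beEl {s : ℕ} (σ : Equiv.Perm (Fin s)) (p : ℕ) (a : ESimplex s p) :
    Gr.map (beAct k s σ) (beEl k ⟨p, a⟩) = beEl k ⟨p, fun t => a t * σ⟩ := by
  refine (Gr.map_ι _ _ _).trans ?_
  refine congrArg (Gr.ι (beObj k s) p) ?_
  refine (DirectSum.lmap_lof _ _ _).trans ?_
  exact congrArg (DirectSum.lof k {q : ℕ // (q : ℤ) = p} (fun q => ESimplex s q.1 →₀ k) ⟨p, rfl⟩)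
    Finsupp.mapDomain_single

/-- The identification of the terms of equal arities of the Barratt--Eccles operad. -/
def beCast {m n : ℕ} (h : m = n) : Gr (beObj k m) →ₗ[k] Gr (beObj k n) := (barrattEccles k).cast h

theorem beCast_beEl {m n : ℕ} (h : m = n) (p : ℕ) (a : ESimplex m p) :
    beCast k h (beEl k ⟨p, a⟩) = beEl k ⟨p, fun t => permCast h (a t)⟩ := by
  subst h
  change Gr.map (𝟙 _) _ = _
  rw [Gr.map_id]
  rfl

theorem extendZ_d (C : ChainComplex (ModuleCat.{v} k) ℕ) (n : ℤ) :
    ((extendZ k).obj C).d (n + 1) n = ModuleCat.ofHom (extD C n) :=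
  ChainComplex.of_d (fun n : ℤ => ModuleCat.of k (ExtX C n)) (fun n => ModuleCat.ofHom (extD C n)) n

variable {k} in
theorem extD_lof (C : ChainComplex (ModuleCat.{v} k) ℕ) (p : ℕ) (x : C.X (p + 1)) :
    extD C p (DirectSum.lof k {q : ℕ // (q : ℤ) = p + 1} (fun q => C.X q.1) ⟨p + 1, by simp⟩ x) =
      DirectSum.lof k {q : ℕ // (q : ℤ) = p} (fun q => C.X q.1) ⟨p, rfl⟩ ((C.d (p + 1) p).hom x) :=
  DirectSum.toModule_lof _ _ _

variable {k} in
theorem hom_sum_zsmul {M N : ModuleCat.{v} k} {ι : Type*} (S : Finset ι) (z : ι → ℤ)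
    (f : ι → (M ⟶ N)) (x : M) : (∑ i ∈ S, z i • f i).hom x = ∑ i ∈ S, z i • (f i).hom x := by
  rw [ModuleCat.hom_sum, LinearMap.sum_apply]
  rfl

theorem linNerve_d {s p : ℕ} (a : ESimplex s (p + 1)) :
    (((AlgebraicTopology.alternatingFaceMapComplex (ModuleCat.{u} k)).obj (linNerve k s)).d
      (p + 1) p).hom (Finsupp.single a 1 : ESimplex s (p + 1) →₀ k) =
    ∑ l : Fin (p + 2), (-1 : ℤ) ^ l.val • (Finsupp.single (a ∘ coface l) 1 : ESimplex s p →₀ k) := by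
  refine (hom_congr (AlgebraicTopology.alternatingFaceMapComplex_obj_d (linNerve k s) p) _).trans ?_
  refine (hom_sum_zsmul _ _ _ _).trans (Finset.sum_congr rfl fun l _ => congrArg _ ?_)
  exact Finsupp.mapDomain_single

theorem d_beEl {s : ℕ} (z : (p : ℕ) × (beS s).X p) :
    Gr.d (beObj k s) (beEl k z) = (beS s).bdry (beEl k) z := by
  obtain ⟨_ | p, a⟩ := z
  · obtain ⟨x, hx⟩ := Gr.d_mem_range (beEl_mem_range k (s := s) ⟨0, a⟩ (n := 0) rfl)
    have h := beEl_span k _ x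
    rw [Set.eq_empty_of_forall_notMem (s := {y | ∃ z : (p : ℕ) × (beS s).X p, _ ∧ beEl k z = y}),
      Submodule.span_empty] at h
    · rw [← hx]
      exact (Submodule.mem_bot k).1 h
    · rintro _ ⟨z, hz, _⟩
      omega
  · refine (Gr.d_ι_of_eq (beObj k s) (m := p) (by push_cast; rfl) _).trans ?_
    let G : (ESimplex s p →₀ k) →ₗ[k] (beObj k s).X p :=
      DirectSum.lof k {q : ℕ // (q : ℤ) = p} (fun q => ESimplex s q.1 →₀ k) ⟨p, rfl⟩
    have h : ((beObj k s).d (p + 1 : ℕ) p).hom (beGen a) = ∑ l : Fin (p + 2), (-1 : ℤ) ^ l.val •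
        G (Finsupp.single (a ∘ coface l) 1) := by
      refine (hom_congr (extendZ_d k ((AlgebraicTopology.alternatingFaceMapComplex
        (ModuleCat.{u} k)).obj (linNerve k s)) p) (beGen a)).trans ?_
      have h := congrArg G (linNerve_d k a)
      rw [map_sum] at h
      simp only [map_zsmul] at h
      exact (extD_lof ((AlgebraicTopology.alternatingFaceMapComplex
        (ModuleCat.{u} k)).obj (linNerve k s)) p _).trans h
    refine (congrArg (Gr.ι (beObj k s) p) h).trans ?_
    simp only [map_sum, map_zsmul]
    rfl

theorem beComp_beEl {s : ℕ} (j : Fin s → ℕ) (c : (p : ℕ) × ESimplex s p)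
    (a : ∀ i, (p : ℕ) × ESimplex (j i) p) :
    beComp k j (beEl k c) (fun i => beEl k (a i)) = beCompSimplex k j c a := by
  rw [beComp, LinearMap.comp_apply, beCoord_beEl, DFinsupp.lsum_apply_apply,
    DFinsupp.sumAddHom_single]
  change ((1 : k) • (_ : MultilinearMap k _ _)) _ = _
  rw [one_smul, MultilinearMap.compLinearMap_apply]
  simp only [beCoord_beEl]
  rw [MultilinearMap.fromDFinsuppEquiv_single]
  simp

/-- The values of the composition on simplices of the same dimension. -/
def beLevel {s : ℕ} (j : Fin s → ℕ) (N : ℕ) (c : (beS s).X N) (a : ∀ i, (beS (j i)).X N) :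
    (beS (∑ i, j i)).X N :=
  fun t => permComp (c t) fun i => a i t

/-- The dimension `N` is free with a propositional equation, so that sums whose dimensions agree
only after rearrangement can be compared without transports. -/
theorem beComp_eq_shSum {s : ℕ} (j : Fin s → ℕ) (c : (p : ℕ) × (beS s).X p)
    (a : ∀ i, (p : ℕ) × (beS (j i)).X p) {N : ℕ} (hN : N = c.1 + ∑ i, (a i).1) :
    beComp k j (beEl k c) (fun i => beEl k (a i)) =
      shSum (C := beS s) (S := fun i => beS (j i)) (fun N c a => beEl k ⟨N, beLevel j N c a⟩) N c a := by
  obtain rfl : N = ∑ i, (Fin.cons c.1 (fun i => (a i).1) : Fin (s + 1) → ℕ) i := by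
    rw [hN, Fin.sum_univ_succ]; simp
  refine (beComp_beEl k j c a).trans ?_
  rw [shSum, ← sum_shuffle _ fun w => wsign (· < ·) w • beEl k ⟨_, beLevel j _
    ((beS s).degen w 0 c) fun i => (beS (j i)).degen w i.succ (a i)⟩]
  refine Finset.sum_congr rfl fun w _ => ?_
  rw [Shuffle.sign_eq]
  refine congrArg _ ?_
  simp only [Shuffle.deg_eq]
  rfl

end

end IDGA

end

noncomputable section

namespace IDGA

/-! ### Reduction to generators -/

section Span

variable {k : Type u} [CommRing k] {C : Type*} [AddCommGroup C] [Module k C]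
  {N : Type*} [AddCommGroup N] [Module k N]

theorem eq_of_span {f g : C → N} (hf : IsLinearMap k f) (hg : IsLinearMap k g) {S : Set C}
    (h : ∀ c ∈ S, f c = g c) {c : C} (hc : c ∈ Submodule.span k S) : f c = g c :=
  LinearMap.eqOn_span (f := hf.mk' f) (g := hg.mk' g) h hc

section

variable {ι : Type*} [DecidableEq ι] [Fintype ι] {M : ι → Type*} [∀ i, AddCommGroup (M i)]
  [∀ i, Module k (M i)]

omit [Fintype ι] in
theorem IsMulti.const_zero : IsMulti k fun _ : ∀ i, M i => (0 : N) := fun _ _ => ⟨0, fun _ => rfl⟩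

/-- Membership in `p` is vanishing in the quotient by `p`, an equality of functions linear in each
variable. -/
theorem IsMulti.mem_of_span {f : (∀ i, M i) → N} (hf : IsMulti k f) (p : Submodule k N)
    (S : ∀ i, Set (M i)) (h : ∀ x, (∀ i, x i ∈ S i) → f x ∈ p) (x : ∀ i, M i)
    (hx : ∀ i, x i ∈ Submodule.span k (S i)) : f x ∈ p := by
  have := (hf.linear_comp p.mkQ).eq_of_span IsMulti.const_zero S
    (fun x hx => (Submodule.Quotient.mk_eq_zero p).2 (h x hx)) x hx
  exact (Submodule.Quotient.mk_eq_zero p).1 this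

omit [Fintype ι] in
theorem IsMulti.update (Φ : MultilinearMap k M N) (i : ι) (D : M i →ₗ[k] M i) :
    IsMulti k fun x => Φ (Function.update x i (D (x i))) := by
  have h : (fun x => Φ (Function.update x i (D (x i)))) = Φ.compLinearMap
      (Function.update (fun _ => LinearMap.id) i D) := by
    funext x
    refine congrArg Φ (funext fun i' => ?_)
    by_cases hi : i' = i
    · subst hi; simp
    · simp [hi]
  rw [h]
  exact MultilinearMap.isMulti _

omit [DecidableEq ι] in
theorem MultilinearMap.map_zsmul_univ (Φ : MultilinearMap k M N) (z : ι → ℤ) (x : ∀ i, M i) :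
    Φ (fun i => z i • x i) = (∏ i, z i) • Φ x := by
  have := Φ.map_smul_univ (fun i => (z i : k)) x
  simpa only [Int.cast_smul_eq_zsmul, ← Int.cast_prod] using this

theorem MultilinearMap.map_sum_zsmul (Φ : MultilinearMap k M N) {α : ι → Type*}
    (W : ∀ i, Finset (α i)) (z : ∀ i, α i → ℤ) (e : ∀ i, α i → M i) :
    Φ (fun i => ∑ w ∈ W i, z i w • e i w) =
      ∑ w ∈ Fintype.piFinset W, (∏ i, z i (w i)) • Φ fun i => e i (w i) := by
  rw [_root_.MultilinearMap.map_sum_finset]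
  exact Finset.sum_congr rfl fun w _ => map_zsmul_univ Φ _ _

end

/-- Evaluation of a family of multilinear maps. -/
def evalAt {ι : Type*} {M : ι → Type*} [∀ i, AddCommGroup (M i)] [∀ i, Module k (M i)]
    (Φ : C →ₗ[k] MultilinearMap k M N) (x : ∀ i, M i) : C →ₗ[k] N where
  toFun c := Φ c x
  map_add' := by simp
  map_smul' := by simp

theorem evalAt_apply {ι : Type*} {M : ι → Type*} [∀ i, AddCommGroup (M i)] [∀ i, Module k (M i)]
    (Φ : C →ₗ[k] MultilinearMap k M N) (x : ∀ i, M i) (c : C) : evalAt Φ x c = Φ c x := rfl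

theorem sum_zsmul_apply {ι : Type*} {M : ι → Type*} [∀ i, AddCommGroup (M i)] [∀ i, Module k (M i)]
    (Φ : C →ₗ[k] MultilinearMap k M N) {α : Type*} (W : Finset α) (z : α → ℤ) (e : α → C)
    (x : ∀ i, M i) : Φ (∑ w ∈ W, z w • e w) x = ∑ w ∈ W, z w • Φ (e w) x := by
  rw [← evalAt_apply, map_sum]
  exact Finset.sum_congr rfl fun w _ => map_zsmul _ _ _

variable {s : ℕ}

/-- Nested compositions are determined by their values on generators. -/
theorem nested_eq_of_span {j : Fin s → ℕ} {A B : Fin s → Type*} [∀ i, AddCommGroup (A i)]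
    [∀ i, Module k (A i)] [∀ i, AddCommGroup (B i)] [∀ i, Module k (B i)]
    {X : Fin (∑ i, j i) → Type*} [∀ t, AddCommGroup (X t)] [∀ t, Module k (X t)]
    {D : Type*} [AddCommGroup D] [Module k D] (Φ : C →ₗ[k] MultilinearMap k B N)
    (θ : ∀ i, A i →ₗ[k] MultilinearMap k (fun t => X (finSigmaFinEquiv ⟨i, t⟩)) (B i))
    (γ : C →ₗ[k] MultilinearMap k A D) (Ψ : D →ₗ[k] MultilinearMap k X N) (z : ℤ)
    (SC : Set C) (SA : ∀ i, Set (A i)) (SX : ∀ t, Set (X t))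
    (h : ∀ c ∈ SC, ∀ a, (∀ i, a i ∈ SA i) → ∀ x, (∀ t, x t ∈ SX t) →
      Φ c (fun i => θ i (a i) fun t => x (finSigmaFinEquiv ⟨i, t⟩)) = z • Ψ (γ c a) x)
    (c : C) (hc : c ∈ Submodule.span k SC) (a : ∀ i, A i) (ha : ∀ i, a i ∈ Submodule.span k (SA i))
    (x : ∀ t, X t) (hx : ∀ t, x t ∈ Submodule.span k (SX t)) :
    Φ c (fun i => θ i (a i) fun t => x (finSigmaFinEquiv ⟨i, t⟩)) = z • Ψ (γ c a) x := by
  refine eq_of_span (f := fun c => Φ c (fun i => θ i (a i) fun t => x (finSigmaFinEquiv ⟨i, t⟩)))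
    (g := fun c => z • Ψ (γ c a) x) ⟨by simp, by simp⟩ ⟨by simp, by simp [smul_comm z]⟩
    (fun c hc => ?_) hc
  refine IsMulti.eq_of_span (IsMulti.multilinear_comp (Φ c) fun i => evalAt (θ i) _)
    (((MultilinearMap.isMulti (γ c)).linear_comp (evalAt Ψ x)).zsmul z) SA (fun a ha => ?_) a ha
  exact IsMulti.eq_of_span (IsMulti.nested (Φ c) fun i => θ i (a i))
    ((MultilinearMap.isMulti (Ψ (γ c a))).zsmul z) SX (fun x hx => h c hc a ha x hx) x hx

/-- The generating sets are indexed by degrees because the signs in the Leibniz rule depend on the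
degrees. -/
theorem isChainMap_of_span {C : Ch.{u, u} k} {X : Fin s → Ch.{u, v} k} {Y : Ch.{u, v} k}
    {Φ : Gr C →ₗ[k] MultilinearMap k (fun i => Gr (X i)) (Gr Y)} (SC : ℤ → Set (Gr C))
    (SX : ∀ i, ℤ → Set (Gr (X i))) (hC : ∀ n c, Gr.ι C n c ∈ Submodule.span k (SC n))
    (hX : ∀ i n x, Gr.ι (X i) n x ∈ Submodule.span k (SX i n))
    (degree : ∀ p₀, ∀ c ∈ SC p₀, ∀ (p : Fin s → ℤ) x, (∀ i, x i ∈ SX i (p i)) →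
      Φ c x ∈ LinearMap.range (Gr.ι Y (p₀ + ∑ i, p i)))
    (differential : ∀ p₀, ∀ c ∈ SC p₀, ∀ (p : Fin s → ℤ) x, (∀ i, x i ∈ SX i (p i)) →
      Gr.d Y (Φ c x) = Φ (Gr.d C c) x + ∑ i, sgn (p₀ + ∑ j ∈ Finset.Iio i, p j) •
        Φ c (Function.update x i (Gr.d (X i) (x i)))) : IsChainMap Φ where
  degree p₀ c p x := by
    have hc := hC p₀ c
    generalize Gr.ι C p₀ c = c at hc
    refine IsMulti.mem_of_span (MultilinearMap.isMulti (Φ c)) _ (fun i => SX i (p i))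
      (fun x hx => ?_) _ fun i => hX i (p i) (x i)
    have h : Submodule.span k (SC p₀) ≤
        Submodule.comap (evalAt Φ x) (LinearMap.range (Gr.ι Y (p₀ + ∑ i, p i))) :=
      Submodule.span_le.2 fun c hc => degree p₀ c hc p x hx
    exact h hc
  differential p₀ c p x := by
    have hc := hC p₀ c
    generalize Gr.ι C p₀ c = c at hc
    refine IsMulti.eq_of_span (f := fun x => Gr.d Y (Φ c x)) (g := fun x => Φ (Gr.d C c) x +
        ∑ i, sgn (p₀ + ∑ j ∈ Finset.Iio i, p j) • Φ c (Function.update x i (Gr.d (X i) (x i))))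
      ((MultilinearMap.isMulti (Φ c)).linear_comp _) ((MultilinearMap.isMulti _).add (IsMulti.sum _
        fun i => (IsMulti.update (Φ c) i (Gr.d (X i))).zsmul _)) (fun i => SX i (p i))
      (fun x hx => ?_) _ fun i => hX i (p i) (x i)
    refine eq_of_span (f := fun c => Gr.d Y (Φ c x)) (g := fun c => Φ (Gr.d C c) x +
        ∑ i, sgn (p₀ + ∑ j ∈ Finset.Iio i, p j) • Φ c (Function.update x i (Gr.d (X i) (x i))))
      ⟨by simp, by simp⟩ ⟨fun c c' => ?_, fun r c => ?_⟩
      (fun c hc => differential p₀ c hc p x hx) hc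
    · simp only [map_add, add_apply, smul_add, Finset.sum_add_distrib]
      abel
    · simp only [map_smul, smul_apply, smul_add, Finset.smul_sum]
      simp only [smul_comm r]

end Span

/-! ### Sums over shuffles -/

namespace SSimp

variable (S : SSimp.{v}) {M M' : Type*} [AddCommGroup M] [AddCommGroup M']

theorem bdry_of_eq_zero (F : (r : ℕ) × S.X r → M) {z : (r : ℕ) × S.X r} (hz : z.1 = 0) :
    S.bdry F z = 0 := by
  obtain ⟨_ | n, x⟩ := z
  · rfl
  · cases hz

theorem bdry_congr {F G : (r : ℕ) × S.X r → M} {z : (r : ℕ) × S.X r}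
    (h : ∀ z' : (r : ℕ) × S.X r, z'.1 + 1 = z.1 → F z' = G z') : S.bdry F z = S.bdry G z := by
  obtain ⟨_ | n, x⟩ := z
  · rfl
  · exact Finset.sum_congr rfl fun l _ => congrArg _ (h _ rfl)

theorem map_bdry {L : Type*} [FunLike L M M'] [AddMonoidHomClass L M M'] (f : L)
    (F : (r : ℕ) × S.X r → M) (z : (r : ℕ) × S.X r) :
    f (S.bdry F z) = S.bdry (fun z => f (F z)) z := by
  obtain ⟨_ | n, x⟩ := z
  · exact map_zero f
  · simp [bdry]

theorem degen_const {ι : Type*} [DecidableEq ι] (i : ι) (z : (r : ℕ) × S.X r) :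
    S.degen (fun _ : Fin z.1 => i) i z = z.2 := by
  rw [degen]
  convert S.pull_id z.2
  ext t
  rw [wdeg_val, cnt_const _ (by omega), if_pos rfl, min_eq_left (by omega)]
  rfl

end SSimp

section Shuffles

universe v₁ v₂

variable {M M' : Type*} [AddCommGroup M] [AddCommGroup M'] {s : ℕ} {C : SSimp.{v₁}}
  {S : Fin s → SSimp.{v₂}}

theorem map_shSum {L : Type*} [FunLike L M M'] [AddMonoidHomClass L M M'] (f : L)
    (Φ : ∀ N, C.X N → (∀ i, (S i).X N) → M) (N : ℕ) (c : (p : ℕ) × C.X p)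
    (y : ∀ i, (r : ℕ) × (S i).X r) :
    f (shSum Φ N c y) = shSum (fun N c y => f (Φ N c y)) N c y := by
  simp [shSum]

/-- Only one letter occurs, hence there is one shuffle, of sign 1, and it leaves `c` unchanged. This
and the following variant reduce the unit axioms to a fixed dimension. -/
theorem shSum_of_right_eq_zero (Φ : ∀ N, C.X N → (∀ i, (S i).X N) → M) (c : (p : ℕ) × C.X p)
    (y : ∀ i, (r : ℕ) × (S i).X r) (hy : ∀ i, (y i).1 = 0) :
    shSum Φ c.1 c y = Φ c.1 c.2 fun i => (S i).degen (fun _ => (0 : Fin (s + 1))) i.succ (y i) := by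
  have h : (Fin.cons c.1 (fun i => (y i).1) : Fin (s + 1) → ℕ) =
      fun i => if i = 0 then c.1 else 0 := by
    funext i
    refine Fin.cases ?_ (fun i => ?_) i
    · simp
    · simp [hy, Fin.succ_ne_zero]
  rw [shSum, h, words_single, Finset.sum_singleton, SSimp.degen_const]
  simp [wsign, inv]

theorem shSum_of_left_eq_zero {S : Fin 1 → SSimp.{v₂}} (Φ : ∀ N, C.X N → (∀ i, (S i).X N) → M)
    (c : (p : ℕ) × C.X p) (hc : c.1 = 0) (y : ∀ i, (r : ℕ) × (S i).X r) :
    shSum Φ (y 0).1 c y = Φ (y 0).1 (C.degen (fun _ => (1 : Fin 2)) 0 c)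
      fun i => (S i).degen (fun _ => (1 : Fin 2)) i.succ (y i) := by
  have h : (Fin.cons c.1 (fun i => (y i).1) : Fin 2 → ℕ) = fun i => if i = 1 then (y 0).1 else 0 := by
    funext i
    fin_cases i
    · simp [hc]
    · rfl
  rw [shSum, h, words_single, Finset.sum_singleton]
  simp [wsign, inv]

end Shuffles

end IDGA

end

noncomputable section

namespace IDGA

/-! ### The Barratt--Eccles operad is an operad -/

section

variable (k : Type u) [CommRing k] {s : ℕ}

/-- The simplices of dimension `n`, as elements of the operad. -/
def beGens (s : ℕ) (n : ℤ) : Set (Gr (beObj k s)) :=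
  {y | ∃ z : (p : ℕ) × (beS s).X p, (z.1 : ℤ) = n ∧ beEl k z = y}

theorem beEl_degree {s : ℕ} (j : Fin s → ℕ) (c : (p : ℕ) × (beS s).X p)
    (a : ∀ i, (p : ℕ) × (beS (j i)).X p) :
    beComp k j (beEl k c) (fun i => beEl k (a i)) ∈
      LinearMap.range (Gr.ι (beObj k (∑ i, j i)) (c.1 + ∑ i, ((a i).1 : ℤ))) := by
  rw [beComp_eq_shSum k j c a rfl]
  refine Submodule.sum_mem _ fun w _ => Submodule.smul_of_tower_mem _ _ (beEl_mem_range k _ ?_)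
  simp

/-- The operation `beLevel` is applied vertex by vertex and so commutes with faces definitionally;
the Leibniz rule is then `shSum_faces`. -/
theorem beComp_d (j : Fin s → ℕ) (c : (p : ℕ) × (beS s).X p)
    (a : ∀ i, (p : ℕ) × (beS (j i)).X p) :
    Gr.d _ (beComp k j (beEl k c) fun i => beEl k (a i)) =
      beComp k j (Gr.d _ (beEl k c)) (fun i => beEl k (a i)) +
      ∑ i, sgn (c.1 + ∑ i' ∈ Finset.Iio i, ((a i').1 : ℤ)) •
        beComp k j (beEl k c) (Function.update (fun i => beEl k (a i)) i (Gr.d _ (beEl k (a i)))) := by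
  obtain ⟨N, hN⟩ : ∃ N, N = c.1 + ∑ i, (a i).1 := ⟨_, rfl⟩
  have hc : beComp k j (Gr.d _ (beEl k c)) (fun i => beEl k (a i)) =
      (beS s).bdry (fun c => beComp k j (beEl k c) fun i => beEl k (a i)) c := by
    rw [d_beEl]
    exact SSimp.map_bdry _ (evalAt (beComp k j) fun i => beEl k (a i)) _ _
  have ha : ∀ i, beComp k j (beEl k c)
      (Function.update (fun i => beEl k (a i)) i (Gr.d _ (beEl k (a i)))) =
      (beS (j i)).bdry (fun z => beComp k j (beEl k c)
        fun i' => beEl k (Function.update a i z i')) (a i) := by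
    intro i
    rw [d_beEl]
    refine (SSimp.map_bdry _ ((beComp k j (beEl k c)).toLinearMap _ i) _ _).trans ?_
    refine SSimp.bdry_congr _ fun z _ => congrArg (beComp k j (beEl k c)) (funext fun i' => ?_)
    by_cases hi : i' = i
    · subst hi; simp
    · simp [hi]
  rw [hc]
  simp only [ha]
  rw [beComp_eq_shSum k j c a hN, shSum, map_sum]
  simp only [map_zsmul, d_beEl]
  -- In total dimension zero all simplices are vertices and all boundaries vanish; `shSum_faces`
  -- covers positive dimensions.
  rcases N with _ | N
  · have h0 : c.1 = 0 ∧ ∀ i, (a i).1 = 0 := by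
      have : ∑ i, (a i).1 = 0 := by omega
      exact ⟨by omega, fun i => Finset.sum_eq_zero_iff.1 this i (Finset.mem_univ i)⟩
    rw [SSimp.bdry_of_eq_zero _ _ h0.1, zero_add]
    refine (Finset.sum_eq_zero fun w _ => ?_).trans (Finset.sum_eq_zero fun i _ => ?_).symm
    · exact smul_zero _
    · rw [SSimp.bdry_of_eq_zero _ _ (h0.2 i), smul_zero]
  · have key := shSum_faces (C := beS s) (S := fun i => beS (j i))
      (fun N c a => beEl k ⟨N, beLevel j N c a⟩) N c a
    have hb : ∀ (c : (beS s).X (N + 1)) (a : ∀ i, (beS (j i)).X (N + 1)),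
        (beS (∑ i, j i)).bdry (beEl k) ⟨N + 1, beLevel j (N + 1) c a⟩ =
          ∑ l : Fin (N + 2), (-1 : ℤ) ^ l.val • beEl k ⟨N, beLevel j N ((beS s).pull (coface l) c)
            fun i => (beS (j i)).pull (coface l) (a i)⟩ := fun _ _ => rfl
    simp only [hb]
    rw [key]
    refine congrArg₂ (· + ·) ?_ ?_
    · refine SSimp.bdry_congr _ fun c' hc' => ?_
      rw [beComp_eq_shSum k j c' a (N := N) (by omega)]
    · refine Finset.sum_congr rfl fun i _ => congrArg _ (SSimp.bdry_congr _ fun z hz => ?_)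
      rw [beComp_eq_shSum k j c _ (N := N)]
      -- Separating the `i`-th summand shows that lowering one dimension by one lowers the total
      -- dimension to `N`.
      have h1 := Finset.sum_erase_add Finset.univ (fun i => (a i).1) (Finset.mem_univ i)
      have h2 := Finset.sum_erase_add Finset.univ (fun i' => (Function.update a i z i').1)
        (Finset.mem_univ i)
      have h3 : ∑ x ∈ Finset.univ.erase i, (Function.update a i z x).1 =
          ∑ x ∈ Finset.univ.erase i, (a x).1 :=
        Finset.sum_congr rfl fun x hx => by rw [Function.update_of_ne (Finset.ne_of_mem_erase hx)]
      simp only [Function.update_self] at h2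
      omega

theorem beComp_chain (j : Fin s → ℕ) : IsChainMap (beComp k j) := by
  refine isChainMap_of_span (beGens k s) (fun i => beGens k (j i)) (fun n => beEl_span k n)
    (fun i n => beEl_span k n) ?_ ?_
  · rintro _ _ ⟨c, rfl, rfl⟩ p x hx
    choose a ha hax using hx
    obtain rfl : p = fun i => ((a i).1 : ℤ) := funext fun i => (ha i).symm
    obtain rfl : x = fun i => beEl k (a i) := funext fun i => (hax i).symm
    exact beEl_degree k j c a
  · rintro _ _ ⟨c, rfl, rfl⟩ p x hx
    choose a ha hax using hx
    obtain rfl : p = fun i => ((a i).1 : ℤ) := funext fun i => (ha i).symm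
    obtain rfl : x = fun i => beEl k (a i) := funext fun i => (hax i).symm
    exact beComp_d k j c a

theorem beLevel_assoc (j : Fin s → ℕ) (l : Fin (∑ i, j i) → ℕ) (N : ℕ) (c : (beS s).X N)
    (a : ∀ i, (beS (j i)).X N) (x : ∀ t, (beS (l t)).X N) :
    (fun t => permCast (sum_blocks l) (beLevel (fun i => ∑ t, l (finSigmaFinEquiv ⟨i, t⟩)) N c
      (fun i => beLevel (fun t => l (finSigmaFinEquiv ⟨i, t⟩)) N (a i)
        fun t => x (finSigmaFinEquiv ⟨i, t⟩)) t)) = beLevel l N (beLevel j N c a) x :=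
  funext fun t => permComp_assoc l (c t) (fun i => a i t) fun u => x u t

/-- Expanding both sides into double sums over shuffles gives the two sides of `shSum_assoc`, with
`beLevel_assoc` as the identity in a fixed dimension. -/
theorem beComp_assoc (j : Fin s → ℕ) (l : Fin (∑ i, j i) → ℕ) (c : (p : ℕ) × (beS s).X p)
    (a : ∀ i, (p : ℕ) × (beS (j i)).X p) (b : ∀ t, (p : ℕ) × (beS (l t)).X p) :
    beCast k (sum_blocks l)
      (beComp k (fun i => ∑ t, l (finSigmaFinEquiv ⟨i, t⟩)) (beEl k c) fun i =>
        beComp k (fun t => l (finSigmaFinEquiv ⟨i, t⟩)) (beEl k (a i)) fun t =>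
          beEl k (b (finSigmaFinEquiv ⟨i, t⟩))) =
    sgn (∑ i, ((a i).1 : ℤ) * ∑ i' ∈ Finset.Iio i, ∑ t, ((b (finSigmaFinEquiv ⟨i', t⟩)).1 : ℤ)) •
      beComp k l (beComp k j (beEl k c) fun i => beEl k (a i)) fun t => beEl k (b t) := by
  let R : Fin s → ℕ := fun i => (a i).1 + ∑ t, (b (finSigmaFinEquiv ⟨i, t⟩)).1
  let P : ℕ := c.1 + ∑ i, (a i).1
  have hN : P + ∑ t, (b t).1 = c.1 + ∑ i, R i := by
    simp only [R, P, Finset.sum_add_distrib, ← sum_finSigma fun t => (b t).1]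
    omega
  have hin : ∀ i, beComp k (fun t => l (finSigmaFinEquiv ⟨i, t⟩)) (beEl k (a i))
      (fun t => beEl k (b (finSigmaFinEquiv ⟨i, t⟩))) = _ := fun i =>
    beComp_eq_shSum k (fun t => l (finSigmaFinEquiv ⟨i, t⟩)) (a i)
      (fun t => b (finSigmaFinEquiv ⟨i, t⟩)) (N := R i) rfl
  have h1 : (fun i => beComp k (fun t => l (finSigmaFinEquiv ⟨i, t⟩)) (beEl k (a i))
      (fun t => beEl k (b (finSigmaFinEquiv ⟨i, t⟩)))) = _ := funext hin
  have key := shSum_assoc (C := beS s) (A := fun i => beS (j i)) (D := beS (∑ i, j i))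
    (X := fun t => beS (l t)) (Y := fun i => beS (∑ t, l (finSigmaFinEquiv ⟨i, t⟩)))
    (fun i => beLevel fun t => l (finSigmaFinEquiv ⟨i, t⟩)) (fun _ _ _ _ _ _ => rfl)
    (beLevel j) (fun _ _ _ => rfl)
    (fun N c y => beEl k ⟨N, fun t => permCast (sum_blocks l) (beLevel _ N c y t)⟩)
    (fun N c y => beEl k ⟨N, beLevel l N c y⟩)
    (fun N c a x => congrArg (fun y => beEl k (⟨N, y⟩ : (p : ℕ) × (beS (∑ u, l u)).X p))
      (beLevel_assoc j l N c a x))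
    c a b (R := R) (fun _ => rfl) (P := P) rfl (P + ∑ t, (b t).1)
  rw [h1, beComp_eq_shSum k j c a (N := P) rfl]
  unfold shSum
  rw [MultilinearMap.map_sum_zsmul, sum_zsmul_apply, map_sum]
  refine Eq.trans (Finset.sum_congr rfl fun w hw => ?_) (key.trans (congrArg _
    (Finset.sum_congr rfl fun u hu => ?_)))
  · rw [map_zsmul]
    refine congrArg _ ?_
    rw [beComp_eq_shSum k _ _ _ (N := P + ∑ t, (b t).1) hN, map_shSum]
    simp only [beCast_beEl]
  · rw [beComp_eq_shSum k l _ b (N := P + ∑ t, (b t).1) rfl]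

theorem beComp_equivariant_left (σ : Equiv.Perm (Fin s)) (j : Fin s → ℕ)
    (c : (p : ℕ) × (beS s).X p) (a : ∀ i, (p : ℕ) × (beS (j i)).X p) :
    beComp k j (Gr.map (beAct k s σ) (beEl k c)) (fun i => beEl k (a i)) =
    koszul σ (fun i => ((a i).1 : ℤ)) • Gr.map (beAct k _ (blockPerm σ j))
      (beCast k (Equiv.sum_comp σ.symm j)
        (beComp k (fun i => j (σ.symm i)) (beEl k c) fun i => beEl k (a (σ.symm i)))) := by
  have hN : c.1 + ∑ i, (a i).1 = c.1 + ∑ i, (a (σ.symm i)).1 := by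
    rw [Equiv.sum_comp σ.symm fun i => (a i).1]
  rw [map_beAct_beEl k σ c.1 c.2, beComp_eq_shSum k j _ a rfl,
    beComp_eq_shSum k (fun i => j (σ.symm i)) c _ hN, map_shSum, map_shSum]
  simp only [beCast_beEl, map_beAct_beEl]
  exact shSum_perm (C := beS s) (S := fun i => beS (j i)) σ
    (fun N c a => beEl k ⟨N, beLevel j N (fun t => c t * σ) a⟩)
    (fun N c a => beEl k ⟨N, fun t => permCast (Equiv.sum_comp σ.symm j)
      (beLevel (fun i => j (σ.symm i)) N c a t) * blockPerm σ j⟩)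
    (fun N c a => congrArg (fun y => beEl k (⟨N, y⟩ : (p : ℕ) × (beS (∑ u, j u)).X p))
      (funext fun t => permComp_mul (c t) σ fun i => a i t)) _ c a

theorem beComp_equivariant_right (j : Fin s → ℕ) (τ : ∀ i, Equiv.Perm (Fin (j i)))
    (c : (p : ℕ) × (beS s).X p) (a : ∀ i, (p : ℕ) × (beS (j i)).X p) :
    beComp k j (beEl k c) (fun i => Gr.map (beAct k _ (τ i)) (beEl k (a i))) =
    Gr.map (beAct k _ (permSum τ)) (beComp k j (beEl k c) fun i => beEl k (a i)) := by
  have h : (fun i => Gr.map (beAct k _ (τ i)) (beEl k (a i))) =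
      fun i => beEl k ⟨(a i).1, fun t => (a i).2 t * τ i⟩ :=
    funext fun i => map_beAct_beEl k (τ i) (a i).1 (a i).2
  rw [h, beComp_eq_shSum k j c a rfl, map_shSum,
    beComp_eq_shSum k j c (fun i => ⟨(a i).1, fun t => (a i).2 t * τ i⟩) rfl]
  simp only [map_beAct_beEl]
  unfold shSum
  refine Finset.sum_congr rfl fun w _ => congrArg _ ?_
  exact congrArg (fun y => beEl k (⟨_, y⟩ : (p : ℕ) × (beS (∑ u, j u)).X p))
    (funext fun t => permComp_mul_permSum _ _ τ)

theorem beComp_one_left (j : Fin 1 → ℕ) (a : ∀ i, (p : ℕ) × (beS (j i)).X p) :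
    beCast k (Fin.sum_univ_one j) (beComp k j (beEl k ⟨0, fun _ => 1⟩) fun i => beEl k (a i)) =
      beEl k (a 0) := by
  rw [beComp_eq_shSum k j ⟨0, fun _ => 1⟩ a (N := (a 0).1) (by simp)]
  rw [shSum_of_left_eq_zero (C := beS 1) (S := fun i => beS (j i)) _ ⟨0, fun _ => 1⟩ rfl a,
    beCast_beEl]
  refine congrArg (fun y => beEl k (⟨_, y⟩ : (p : ℕ) × (beS (j 0)).X p)) (funext fun t => ?_)
  refine (permComp_one_left (fun i =>
    (beS (j i)).degen (fun _ : Fin (a 0).1 => (1 : Fin 2)) i.succ (a i) t)).trans ?_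
  exact congrFun ((beS (j 0)).degen_const (1 : Fin 2) (a 0)) t

theorem beComp_one_right (c : (p : ℕ) × (beS s).X p) (h : ∑ _i : Fin s, 1 = s) :
    beCast k h (beComp k (fun _ : Fin s => 1) (beEl k c) fun _ => beEl k ⟨0, fun _ => 1⟩) =
      beEl k c := by
  rw [beComp_eq_shSum k (fun _ => 1) c (fun _ => ⟨0, fun _ => 1⟩) (N := c.1) (by simp)]
  rw [shSum_of_right_eq_zero (C := beS s) (S := fun _ => beS 1) _ c _ fun _ => rfl, beCast_beEl]
  exact congrArg (fun y => beEl k (⟨_, y⟩ : (p : ℕ) × (beS s).X p))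
    (funext fun t => permComp_one_right (c.2 t) h)

theorem beMap_ext {m : ℕ} {Y : Ch.{u, u} k} {f g : beObj k m ⟶ Y}
    (h : ∀ p (a : ESimplex m p), Gr.map f (beEl k ⟨p, a⟩) = Gr.map g (beEl k ⟨p, a⟩)) : f = g := by
  ext n x
  refine Gr.ι_injective Y n ?_
  have := LinearMap.eqOn_span (f := Gr.map f) (g := Gr.map g)
    (fun y (hy : y ∈ Set.range (beEl k)) => by obtain ⟨z, rfl⟩ := hy; exact h z.1 z.2)
    (beEl_span_top k (Gr.ι (beObj k m) n x))
  rwa [Gr.map_ι, Gr.map_ι] at this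

/-- The Barratt--Eccles operad is an operad. -/
theorem barrattEccles_isOperad : (barrattEccles k).IsOperad where
  act_one n := beMap_ext k fun p a => by
    refine (map_beAct_beEl k 1 p a).trans ?_
    simp only [mul_one]
    exact (LinearMap.congr_fun (Gr.map_id (beObj k n)) _).symm
  act_mul n σ τ := beMap_ext k fun p a => by
    refine (map_beAct_beEl k (σ * τ) p a).trans ?_
    refine Eq.trans ?_ (Gr.map_map (beAct k n σ) (beAct k n τ) _)
    rw [map_beAct_beEl, map_beAct_beEl]
    simp only [mul_assoc]
  one_cycle := d_beEl k ⟨0, fun _ => 1⟩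
  comp_chain j := beComp_chain k j
  one_comp j x := by
    refine IsMulti.eq_of_span (k := k) (M := fun i => Gr (beObj k (j i)))
      (f := fun x => beCast k (Fin.sum_univ_one j) (beComp k j (beEl k ⟨0, fun _ => 1⟩) x))
      (g := fun x => x 0) ((MultilinearMap.isMulti _).linear_comp _)
      (fun x i => by
        obtain rfl := Subsingleton.elim i 0
        exact ⟨LinearMap.id, fun a => by simp⟩) (fun i => Set.range (beEl k))
      (fun x hx => ?_) x fun i => beEl_span_top k (x i)
    choose a ha using hx
    obtain rfl : (fun i => beEl k (a i)) = x := funext ha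
    exact beComp_one_left k j a
  comp_one s c := by
    refine eq_of_span (k := k) (C := Gr (beObj k s)) (f := fun c => beCast k (by simp)
      (beComp k (fun _ : Fin s => 1) c fun _ => beEl k ⟨0, fun _ => 1⟩)) (g := fun c => c)
      ⟨by simp, by simp⟩ ⟨by simp, by simp⟩ ?_ (beEl_span_top k c)
    rintro _ ⟨c, rfl⟩
    exact beComp_one_right k c _
  assoc {s} j l p₀ c p a q b := by
    refine nested_eq_of_span (k := k) (C := Gr (beObj k s)) (A := fun i => Gr (beObj k (j i)))
      (X := fun t => Gr (beObj k (l t)))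
      ((LinearMap.compMultilinearMapₗ k (beCast k (sum_blocks l))).comp (beComp k _))
      (fun i => beComp k _) (beComp k j) (beComp k l) _ (beGens k s p₀) (fun i => beGens k (j i) (p i))
      (fun t => beGens k (l t) (q t)) ?_ _ (beEl_span k p₀ c) _ (fun i => beEl_span k (p i) (a i)) _
      fun t => beEl_span k (q t) (b t)
    clear a b c
    rintro _ ⟨c, rfl, rfl⟩ x hx y hy
    choose a ha hax using hx
    choose b hb hby using hy
    obtain rfl : p = fun i => ((a i).1 : ℤ) := funext fun i => (ha i).symm
    obtain rfl : x = fun i => beEl k (a i) := funext fun i => (hax i).symm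
    obtain rfl : q = fun i => ((b i).1 : ℤ) := funext fun i => (hb i).symm
    obtain rfl : y = fun i => beEl k (b i) := funext fun i => (hby i).symm
    exact beComp_assoc k j l c a b
  equivariant_left {s} σ j c p a := by
    refine eq_of_span (k := k) (C := Gr (beObj k s)) (f := fun c =>
        beComp k j (Gr.map (beAct k s σ) c) fun i => Gr.ι (beObj k (j i)) (p i) (a i))
      (g := fun c => koszul σ p • Gr.map (beAct k _ (blockPerm σ j))
        (beCast k (Equiv.sum_comp σ.symm j) (beComp k (fun i => j (σ.symm i)) c fun i =>
          Gr.ι (beObj k (j (σ.symm i))) (p (σ.symm i)) (a (σ.symm i)))))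
      ⟨by simp, by simp⟩ ⟨by simp, by simp [smul_comm (koszul σ p)]⟩ ?_ (beEl_span_top k c)
    rintro _ ⟨c, rfl⟩
    refine IsMulti.eq_of_span (k := k) (M := fun i => Gr (beObj k (j i)))
      (f := fun x => beComp k j (Gr.map (beAct k s σ) (beEl k c)) x)
      (g := fun x => koszul σ p • Gr.map (beAct k _ (blockPerm σ j))
        (beCast k (Equiv.sum_comp σ.symm j) (beComp k (fun i => j (σ.symm i)) (beEl k c) fun i =>
          x (σ.symm i)))) (MultilinearMap.isMulti _)
      ((((IsMulti.perm (B := fun i => Gr (beObj k (j i))) σ _).linear_comp _).linear_comp _).zsmul _)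
      (fun i => beGens k (j i) (p i)) ?_ _ fun i => beEl_span k (p i) (a i)
    clear a
    intro x hx
    choose a ha hax using hx
    obtain rfl : p = fun i => ((a i).1 : ℤ) := funext fun i => (ha i).symm
    obtain rfl : x = fun i => beEl k (a i) := funext fun i => (hax i).symm
    exact beComp_equivariant_left k σ j c a
  equivariant_right {s} j τ c a := by
    refine eq_of_span (k := k) (C := Gr (beObj k s)) (f := fun c =>
        beComp k j c fun i => Gr.map (beAct k _ (τ i)) (a i))
      (g := fun c => Gr.map (beAct k _ (permSum τ)) (beComp k j c a))
      (evalAt (beComp k j) _).isLinear (Gr.map (beAct k _ (permSum τ)) ∘ₗ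
        evalAt (beComp k j) a).isLinear ?_ (beEl_span_top k c)
    rintro _ ⟨c, rfl⟩
    refine IsMulti.eq_of_span (k := k) (M := fun i => Gr (beObj k (j i)))
      (f := fun a => beComp k j (beEl k c) fun i => Gr.map (beAct k _ (τ i)) (a i))
      (g := fun a => Gr.map (beAct k _ (permSum τ)) (beComp k j (beEl k c) a))
      (IsMulti.multilinear_comp _ fun i => Gr.map (beAct k _ (τ i)))
      ((MultilinearMap.isMulti _).linear_comp _) (fun i => Set.range (beEl k))
      (fun x hx => ?_) a fun i => beEl_span_top k (a i)
    choose a ha using hx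
    obtain rfl : (fun i => beEl k (a i)) = x := funext ha
    exact beComp_equivariant_right k j τ c a

end

end IDGA

end

noncomputable section

namespace IDGA

/-! ### Products in commutative `𝓘`-dgas -/

namespace ICat

theorem eq_of_card {m n : ICat} (h : m.card = n.card) : m = n := by
  cases m; cases n; cases h; rfl

theorem hom_ext {m n : ICat} {f g : m ⟶ n} (h : ∀ t, (toEmb f t).val = (toEmb g t).val) : f = g :=
  Function.Embedding.ext fun t => Fin.ext (h t)

theorem comp_val {l m n : ICat} (f : l ⟶ m) (g : m ⟶ n) (t : Fin l.card) :
    toEmb (f ≫ g) t = toEmb g (toEmb f t) := rfl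

theorem addHom_val {m m' n n' : ICat} (f : m ⟶ m') (g : n ⟶ n') (φ ψ : ℕ → ℕ)
    (hf : ∀ t, (toEmb f t).val = φ t.val) (hg : ∀ t, (toEmb g t).val = ψ t.val)
    (t : Fin (add m n).card) : (toEmb (addHom f g) t).val =
      if t.val < m.card then φ t.val else m'.card + ψ (t.val - m.card) := by
  change (finSumFinEquiv (Sum.map (toEmb f) (toEmb g) (finSumFinEquiv.symm t))).val = _
  obtain ⟨t | t, rfl⟩ := finSumFinEquiv.surjective t
  · rw [Equiv.symm_apply_apply]
    simp [hf]
  · rw [Equiv.symm_apply_apply]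
    simp [hg]

theorem swap_val (m n : ICat) (t : Fin (add m n).card) : (toEmb (swap m n) t).val =
    if t.val < m.card then n.card + t.val else t.val - m.card := by
  change (finSumFinEquiv (Sum.swap (finSumFinEquiv.symm t))).val = _
  obtain ⟨t | t, rfl⟩ := finSumFinEquiv.surjective t
  · rw [Equiv.symm_apply_apply]
    simp
  · rw [Equiv.symm_apply_apply]
    simp

end ICat

namespace CommIDGA

variable {k : Type u} [CommRing k] (E : CommIDGA.{u, v} k)

/-- The elements of the values of a commutative `𝓘`-dga. -/
abbrev El : Type v := (m : ICat) × Gr (E.toFunctor.obj m)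

variable {E}

/-- Objects with equally many elements are equal and the comparison morphism becomes an identity. In
the set of all elements the identifications in the associativity and unit laws thus turn into plain
equalities. -/
theorem El.ext_cast {a b : E.El} (h : a.1.card = b.1.card)
    (hx : Gr.map (E.toFunctor.map (ICat.castHom h)) a.2 = b.2) : a = b := by
  obtain ⟨m, x⟩ := a
  obtain ⟨n, y⟩ := b
  obtain rfl := ICat.eq_of_card h
  have h1 : E.toFunctor.map (ICat.castHom h) = 𝟙 _ := E.toFunctor.map_id m
  change Gr.map (E.toFunctor.map (ICat.castHom h)) x = y at hx
  rw [h1, Gr.map_id] at hx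
  exact congrArg _ hx

variable (E) in
/-- The products of a commutative `𝓘`-dga define an associative and unital product on the set of all
elements. -/
instance : Monoid E.El where
  mul a b := ⟨a.1.add b.1, E.mul a.1 b.1 a.2 b.2⟩
  one := ⟨⟨0⟩, Gr.ι _ 0 E.one⟩
  mul_assoc a b c := El.ext_cast (Nat.add_assoc _ _ _) (E.mul_assoc _ _ _ _ _ _)
  one_mul a := El.ext_cast (Nat.zero_add _) (E.one_mul _ _)
  mul_one a := El.ext_cast (Nat.add_zero _) (E.mul_one _ _)

theorem El.mul_def (a b : E.El) : a * b = ⟨a.1.add b.1, E.mul a.1 b.1 a.2 b.2⟩ := rfl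

-- Elements over different objects cannot be added, but multiplication by integers is enough to
-- carry the Koszul signs.
variable (E) in
instance : SMul ℤ E.El where
  smul z a := ⟨a.1, z • a.2⟩

theorem El.smul_def (z : ℤ) (a : E.El) : z • a = ⟨a.1, z • a.2⟩ := rfl

theorem El.smul_smul (z z' : ℤ) (a : E.El) : z • z' • a = (z * z') • a := by
  simp only [smul_def, _root_.smul_smul]

theorem El.one_smul (a : E.El) : (1 : ℤ) • a = a := by
  rw [smul_def, _root_.one_smul]

theorem El.smul_mul (z : ℤ) (a b : E.El) : (z • a) * b = z • (a * b) := by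
  simp [smul_def, mul_def]

theorem El.mul_smul (z : ℤ) (a b : E.El) : a * (z • b) = z • (a * b) := by
  simp [smul_def, mul_def]

/-- The product of a finite family of elements. -/
def El.prod {s : ℕ} (a : Fin s → E.El) : E.El := (List.ofFn a).prod

theorem El.prod_succ {s : ℕ} (a : Fin (s + 1) → E.El) :
    El.prod a = a 0 * El.prod fun i => a i.succ := by
  rw [prod, List.ofFn_succ, List.prod_cons]; rfl

theorem El.prod_zero (a : Fin 0 → E.El) : El.prod a = 1 := by
  rw [prod, List.ofFn_zero, List.prod_nil]

theorem El.card_prod {s : ℕ} (a : Fin s → E.El) : (El.prod a).1.card = ∑ i, (a i).1.card := by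
  induction s with
  | zero => rw [prod_zero]; rfl
  | succ s ih => rw [prod_succ, Fin.sum_univ_succ, ← ih]; rfl

theorem El.prod_smul {s : ℕ} (z : Fin s → ℤ) (a : Fin s → E.El) :
    El.prod (fun i => z i • a i) = (∏ i, z i) • El.prod a := by
  induction s with
  | zero => rw [prod_zero, prod_zero, Fin.prod_univ_zero, one_smul]
  | succ s ih => rw [prod_succ, ih, prod_succ a, smul_mul, mul_smul, smul_smul, Fin.prod_univ_succ]

theorem prod_succ {s : ℕ} (m : Fin (s + 1) → ICat) (x : ∀ i, Gr (E.toFunctor.obj (m i)))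
    (h : (m 0).card + (ICat.sum fun i => m i.succ).card = (ICat.sum m).card) :
    E.prod (s + 1) m x = Gr.map (E.toFunctor.map (ICat.castHom (m := (m 0).add _) h))
      (E.mul (m 0) (ICat.sum fun i => m i.succ) (x 0) (E.prod s (fun i => m i.succ) fun i => x i.succ)) :=
  rfl

/-- Iterated products become products of lists in a monoid, for which regrouping is automatic. -/
theorem prod_eq {s : ℕ} (m : Fin s → ICat) (x : ∀ i, Gr (E.toFunctor.obj (m i))) :
    (⟨ICat.sum m, E.prod s m x⟩ : E.El) = El.prod fun i => ⟨m i, x i⟩ := by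
  induction s with
  | zero =>
    rw [El.prod_zero]
    exact (El.ext_cast (a := 1) (b := ⟨ICat.sum m, E.prod 0 m x⟩) (by simp [ICat.sum]; rfl) rfl).symm
  | succ s ih =>
    rw [El.prod_succ]
    have h : (m 0).card + (ICat.sum fun i => m i.succ).card = (ICat.sum m).card := by
      simp [ICat.sum, Fin.sum_univ_succ]
    rw [← ih (fun i => m i.succ) fun i => x i.succ]
    exact (El.ext_cast (a := ⟨(m 0).add (ICat.sum fun i => m i.succ), E.mul (m 0) _ (x 0)
      (E.prod s (fun i => m i.succ) fun i => x i.succ)⟩) (b := ⟨ICat.sum m, E.prod (s + 1) m x⟩)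
      h (prod_succ m x h).symm).symm

end CommIDGA

end IDGA

end

/-! ### Commutativity of finite products up to block permutations -/

noncomputable section

namespace IDGA

namespace CommIDGA

variable {k : Type u} [CommRing k] {E : CommIDGA.{u, v} k}

/-- The element `b` is the image of `a` under the injection with values `φ`. -/
def Arr (φ : ℕ → ℕ) (a b : E.El) : Prop :=
  ∃ f : a.1 ⟶ b.1, (∀ t, (ICat.toEmb f t).val = φ t.val) ∧ Gr.map (E.toFunctor.map f) a.2 = b.2

namespace Arr

/-- Injections are recorded as functions on natural numbers, so that no dependent types intervene;
only the values below the cardinality matter. -/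
theorem congr {φ ψ : ℕ → ℕ} {a b : E.El} (h : Arr φ a b) (hφ : ∀ t < a.1.card, φ t = ψ t) :
    Arr ψ a b := by
  obtain ⟨f, hf, h⟩ := h
  exact ⟨f, fun t => (hf t).trans (hφ t t.2), h⟩

theorem refl (a : E.El) : Arr id a a :=
  ⟨𝟙 a.1, fun _ => rfl, by rw [E.toFunctor.map_id, Gr.map_id]; rfl⟩

theorem trans {φ ψ : ℕ → ℕ} {a b c : E.El} (h : Arr φ a b) (h' : Arr ψ b c) :
    Arr (fun t => ψ (φ t)) a c := by
  obtain ⟨f, hf, h⟩ := h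
  obtain ⟨g, hg, h'⟩ := h'
  refine ⟨f ≫ g, fun t => ?_, ?_⟩
  · rw [ICat.comp_val, hg, hf]
  · rw [E.toFunctor.map_comp, ← Gr.map_map, h, h']

theorem smul {φ : ℕ → ℕ} {a b : E.El} (h : Arr φ a b) (z : ℤ) : Arr φ (z • a) (z • b) := by
  obtain ⟨f, hf, h⟩ := h
  exact ⟨f, hf, (map_zsmul _ _ _).trans (congrArg _ h)⟩

theorem mul {φ ψ : ℕ → ℕ} {a b c d : E.El} (h : Arr φ a b) (h' : Arr ψ c d) :
    Arr (fun t => if t < a.1.card then φ t else b.1.card + ψ (t - a.1.card)) (a * c) (b * d) := by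
  obtain ⟨f, hf, h⟩ := h
  obtain ⟨g, hg, h'⟩ := h'
  refine ⟨ICat.addHom f g, ICat.addHom_val f g φ ψ hf hg, ?_⟩
  refine (E.mul_natural f g a.2 c.2).trans ?_
  rw [h, h']
  rfl

theorem swap {a b : E.El} {p q : ℤ} (ha : a.2 ∈ LinearMap.range (Gr.ι _ p))
    (hb : b.2 ∈ LinearMap.range (Gr.ι _ q)) :
    Arr (fun t => if t < a.1.card then b.1.card + t else t - a.1.card) (a * b)
      (sgn (p * q) • (b * a)) := by
  obtain ⟨m, x⟩ := a
  obtain ⟨n, y⟩ := b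
  change x ∈ LinearMap.range (Gr.ι (E.toFunctor.obj m) p) at ha
  change y ∈ LinearMap.range (Gr.ι (E.toFunctor.obj n) q) at hb
  obtain ⟨x, rfl⟩ := ha
  obtain ⟨y, rfl⟩ := hb
  exact ⟨ICat.swap m n, ICat.swap_val m n, E.mul_comm m n p q x y⟩

theorem map_eq {φ : ℕ → ℕ} {a b : E.El} (h : Arr φ a b) (f : a.1 ⟶ b.1)
    (hf : ∀ t, (ICat.toEmb f t).val = φ t.val) : Gr.map (E.toFunctor.map f) a.2 = b.2 := by
  obtain ⟨g, hg, h⟩ := h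
  obtain rfl : f = g := ICat.hom_ext fun t => (hf t).trans (hg t).symm
  exact h

end Arr

/-- A number is determined by the block that contains it and its position there. -/
theorem forall_lt_sum {s : ℕ} {m : Fin s → ℕ} {P : ℕ → Prop}
    (h : ∀ i u, u < m i → P ((∑ j, if j < i then m j else 0) + u)) (t : ℕ) (ht : t < ∑ i, m i) :
    P t := by
  obtain ⟨⟨i, u⟩, hu⟩ := finSigmaFinEquiv.surjective (⟨t, ht⟩ : Fin (∑ i, m i))
  have := congrArg Fin.val hu
  rw [finSigma_val] at this
  rw [← show _ = t from this]
  exact h i u u.2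

/-- The images of a family of elements under a family of injections. -/
theorem Arr.prod {s : ℕ} {a b : Fin s → E.El} {φ : Fin s → ℕ → ℕ} (h : ∀ i, Arr (φ i) (a i) (b i))
    (Φ : ℕ → ℕ) (hΦ : ∀ i u, u < (a i).1.card → Φ ((∑ j, if j < i then (a j).1.card else 0) + u) =
      (∑ j, if j < i then (b j).1.card else 0) + φ i u) : Arr Φ (El.prod a) (El.prod b) := by
  induction s generalizing Φ with
  | zero =>
    rw [El.prod_zero, El.prod_zero]
    exact (Arr.refl 1).congr fun t ht => absurd ht (Nat.not_lt_zero t)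
  | succ s ih =>
    have h0 : ∀ u, u < (a 0).1.card → Φ u = φ 0 u := fun u hu => by
      have := hΦ 0 u hu
      simpa using this
    have h1 : ∀ (i : Fin s) u, u < (a i.succ).1.card →
        Φ ((a 0).1.card + ((∑ j : Fin s, if j < i then (a j.succ).1.card else 0) + u)) =
          (b 0).1.card + ((∑ j : Fin s, if j < i then (b j.succ).1.card else 0) + φ i.succ u) := by
      intro i u hu
      have := hΦ i.succ u hu
      simpa [Fin.sum_univ_succ, add_assoc] using this
    -- The function on the remaining blocks is shifted by the first block in source and target. The
    -- subtraction is exact there, since the values of `Φ` behind the first block lie behind the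
    -- first target block.
    have hr := ih (fun i => h i.succ) (fun t => Φ ((a 0).1.card + t) - (b 0).1.card) fun i u hu => by
      rw [h1 i u hu]; omega
    rw [El.prod_succ, El.prod_succ]
    refine ((h 0).mul hr).congr fun t ht => ?_
    split_ifs with h
    · exact (h0 t h).symm
    · obtain ⟨t, rfl⟩ := Nat.exists_eq_add_of_le (not_lt.1 h)
      rw [Nat.add_sub_cancel_left]
      have ht' : t < ∑ i : Fin s, (a i.succ).1.card := by
        have : (a 0 * El.prod fun i => a i.succ).1.card = (a 0).1.card + (El.prod fun i => a i.succ).1.card := rfl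
        rw [this, El.card_prod] at ht
        omega
      have : (b 0).1.card ≤ Φ ((a 0).1.card + t) := by
        refine forall_lt_sum (P := fun t => (b 0).1.card ≤ Φ ((a 0).1.card + t))
          (fun i u hu => ?_) t ht'
        rw [h1 i u hu]
        omega
      omega

/-- The values of the permutation of blocks given by `σ`. -/
def blkFun {s : ℕ} (σ : Equiv.Perm (Fin s)) (m : Fin s → ℕ) (t : ℕ) : ℕ :=
  if h : t < ∑ i, m i then (blockPerm σ m ⟨t, h⟩).val else 0

theorem blkFun_apply {s : ℕ} (σ : Equiv.Perm (Fin s)) (m : Fin s → ℕ) (i : Fin s) (u : ℕ)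
    (hu : u < m i) : blkFun σ m ((∑ j, if j < i then m j else 0) + u) =
      (∑ j, if σ j < σ i then m j else 0) + u := by
  have h := finSigma_val (n := m) ⟨i, ⟨u, hu⟩⟩
  have h2 := blockPerm_val σ m ⟨i, ⟨u, hu⟩⟩
  have ht : (∑ j, if j < i then m j else 0) + u < ∑ i, m i := h ▸ Fin.is_lt _
  rw [blkFun, dif_pos ht, ← h2]
  exact congrArg (fun x => (blockPerm σ m x).val) (Fin.ext h.symm)

/-- The product is commutative up to the symmetry given by `σ`. -/
def PermComm (E : CommIDGA.{u, v} k) {s : ℕ} (σ : Equiv.Perm (Fin s)) : Prop :=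
  ∀ (a : Fin s → E.El) (q : Fin s → ℤ), (∀ i, (a i).2 ∈ LinearMap.range (Gr.ι _ (q i))) →
    Arr (blkFun σ fun i => (a i).1.card) (El.prod a)
      (koszul σ q • El.prod fun i => a (σ.symm i))

theorem permComm_one (s : ℕ) : PermComm E (1 : Equiv.Perm (Fin s)) := by
  intro a q _
  rw [koszul_one, El.one_smul]
  refine (Arr.refl _).congr fun t ht => ?_
  rw [El.card_prod] at ht
  refine forall_lt_sum (P := fun t => id t = blkFun 1 (fun i => (a i).1.card) t)
    (fun i u hu => ?_) t ht
  rw [blkFun_apply _ _ _ _ hu]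
  rfl

theorem PermComm.mul {s : ℕ} {σ ρ : Equiv.Perm (Fin s)} (hσ : PermComm E σ) (hρ : PermComm E ρ) :
    PermComm E (σ * ρ) := by
  intro a q ha
  have h := (hρ a q ha).trans ((hσ (fun i => a (ρ.symm i)) (fun i => q (ρ.symm i))
    fun i => ha _).smul (koszul ρ q))
  rw [El.smul_smul, ← koszul_mul] at h
  refine h.congr fun t ht => ?_
  rw [El.card_prod] at ht
  refine forall_lt_sum (P := fun t => blkFun σ _ (blkFun ρ _ t) = blkFun (σ * ρ) _ t)
    (fun i u hu => ?_) t ht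
  rw [blkFun_apply _ _ _ _ hu, blkFun_apply _ _ _ _ hu]
  -- The offset of the block `i` after `ρ` is the ordinary offset of the block `ρ i` in the permuted
  -- family, so `blkFun_apply` can be used again for `σ`.
  have h1 := sum_lt_perm ρ (fun i => (a i).1.card) (ρ i)
  rw [← h1, blkFun_apply σ (fun i => (a (ρ.symm i)).1.card) (ρ i) u (by simpa using hu),
    ← Equiv.sum_comp ρ]
  simp only [Equiv.symm_apply_apply]
  rfl

theorem koszul_swap {n : ℕ} (i : Fin n) (q : Fin (n + 1) → ℤ) :
    koszul (Equiv.swap i.castSucc i.succ) q = sgn (q i.castSucc * q i.succ) := by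
  have h : ∀ a b : Fin (n + 1), (a < b ∧ Equiv.swap i.castSucc i.succ b <
      Equiv.swap i.castSucc i.succ a) ↔ (a = i.castSucc ∧ b = i.succ) := by
    intro a b
    rw [Equiv.swap_apply_def, Equiv.swap_apply_def]
    simp only [Fin.lt_def, Fin.ext_iff]
    split_ifs <;> simp <;> simp_all <;> omega
  rw [koszul]
  simp only [h, ite_and]
  simp

/-- The exchange of the first two factors is the commutativity of `E`, multiplied by the identity of
the remaining product. An exchange further back is an exchange in the tail, multiplied on the left
by the first factor. -/
theorem permComm_swap (n : ℕ) (i : Fin n) : PermComm E (Equiv.swap i.castSucc i.succ) := by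
  induction n with
  | zero => exact i.elim0
  | succ n ih =>
    intro a q ha
    rw [koszul_swap]
    refine Fin.cases ?_ (fun i => ?_) i
    · have hR := ((Arr.swap (ha 0) (ha 1)).mul (Arr.refl (El.prod fun i : Fin n => a i.succ.succ)))
      have h2 : ∀ j : Fin n, Equiv.swap (0 : Fin (n + 2)) 1 j.succ.succ = j.succ.succ := fun j =>
        Equiv.swap_apply_of_ne_of_ne (by simp [Fin.ext_iff]) (by simp [Fin.ext_iff])
      rw [El.smul_mul, _root_.mul_assoc, _root_.mul_assoc] at hR
      simp only [Fin.castSucc_zero, Fin.succ_zero_eq_one]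
      have hp : El.prod a = a 0 * (a 1 * El.prod fun i : Fin n => a i.succ.succ) := by
        rw [El.prod_succ, El.prod_succ]; rfl
      have hp' : (El.prod fun i => a ((Equiv.swap (0 : Fin (n + 2)) 1).symm i)) =
          a 1 * (a 0 * El.prod fun i : Fin n => a i.succ.succ) := by
        rw [El.prod_succ, El.prod_succ]
        simp only [Fin.succ_zero_eq_one, Equiv.symm_swap, Equiv.swap_apply_left,
          Equiv.swap_apply_right, h2]
      rw [hp']
      rw [← hp] at hR
      refine hR.congr fun t ht => ?_
      rw [El.card_prod] at ht
      refine forall_lt_sum (P := fun t => (if t < (a 0).1.card + (a 1).1.card then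
          if t < (a 0).1.card then (a 1).1.card + t else t - (a 0).1.card
        else (a 1).1.card + (a 0).1.card + (t - ((a 0).1.card + (a 1).1.card))) =
          blkFun (Equiv.swap 0 1) _ t) (fun i u hu => ?_) t ht
      rw [blkFun_apply _ _ _ _ hu]
      have hl1 : ∀ l : Fin n, ¬ l.succ.succ < (1 : Fin (n + 2)) := fun l => by
        rw [Fin.lt_def]; simp
      have hl2 : ∀ l : Fin n, (1 : Fin (n + 2)) < l.succ.succ := fun l => by
        rw [Fin.lt_def]; simp
      revert hu
      refine Fin.cases (fun hu => ?_) (fun l => Fin.cases (fun hu => ?_) (fun l hu => ?_) l) i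
      · have e : (∑ j, if Equiv.swap (0 : Fin (n + 2)) 1 j < Equiv.swap (0 : Fin (n + 2)) 1 0
            then (a j).1.card else 0) = (a 1).1.card := by
          rw [Fin.sum_univ_succ, Fin.sum_univ_succ, Equiv.swap_apply_left]
          simp [h2, hl1]
        rw [e]
        simp only [Fin.not_lt_zero, if_false, Finset.sum_const_zero, zero_add]
        rw [if_pos (by omega), if_pos hu]
      · have e : (∑ j, if j < (1 : Fin (n + 2)) then (a j).1.card else 0) = (a 0).1.card := by
          rw [Fin.sum_univ_succ, Fin.sum_univ_succ]
          simp [hl1]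
        rw [Fin.succ_zero_eq_one] at hu ⊢
        rw [e, Equiv.swap_apply_right]
        simp only [Fin.not_lt_zero, if_false, Finset.sum_const_zero, zero_add]
        rw [if_pos (by omega), if_neg (by omega), Nat.add_sub_cancel_left]
      · have e : (∑ j, if j < l.succ.succ then (a j).1.card else 0) = (a 0).1.card + ((a 1).1.card +
            ∑ j : Fin n, if j < l then (a j.succ.succ).1.card else 0) := by
          rw [Fin.sum_univ_succ, Fin.sum_univ_succ]
          simp [hl2]
        have e' : (∑ j, if Equiv.swap (0 : Fin (n + 2)) 1 j < l.succ.succ then (a j).1.card else 0) =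
            (a 0).1.card + ((a 1).1.card +
              ∑ j : Fin n, if j < l then (a j.succ.succ).1.card else 0) := by
          rw [Fin.sum_univ_succ, Fin.sum_univ_succ]
          simp [hl2, h2]
        rw [h2, e, e', if_neg (by omega)]
        omega
    · have h0 : Equiv.swap i.succ.castSucc i.succ.succ 0 = 0 :=
        Equiv.swap_apply_of_ne_of_ne (by simp [Fin.ext_iff]) (by simp [Fin.ext_iff])
      have h1 : ∀ j, Equiv.swap i.succ.castSucc i.succ.succ (Fin.succ j) =
          (Equiv.swap i.castSucc i.succ j).succ := fun j => by
        rw [← Fin.succ_castSucc]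
        exact (Function.Injective.map_swap (Fin.succ_injective _) _ _ _).symm
      have hR := (Arr.refl (a 0)).mul (ih i (fun j => a j.succ) (fun j => q j.succ) fun j => ha _)
      rw [koszul_swap, El.mul_smul, ← El.prod_succ] at hR
      have hp' : (El.prod fun j => a ((Equiv.swap i.succ.castSucc i.succ.succ).symm j)) =
          a 0 * El.prod fun j => a ((Equiv.swap i.castSucc i.succ).symm j).succ := by
        rw [El.prod_succ]
        simp only [Equiv.symm_swap, h0, h1]
      rw [hp']
      refine hR.congr fun t ht => ?_
      rw [El.card_prod] at ht
      refine forall_lt_sum (P := fun t => (if t < (a 0).1.card then id t else (a 0).1.card +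
        blkFun (Equiv.swap i.castSucc i.succ) (fun j => (a j.succ).1.card) (t - (a 0).1.card)) =
          blkFun (Equiv.swap i.succ.castSucc i.succ.succ) _ t) (fun l u hu => ?_) t ht
      rw [blkFun_apply _ _ _ _ hu]
      revert hu
      refine Fin.cases (fun hu => ?_) (fun l hu => ?_) l
      · rw [h0]
        simp [hu]
      · have := blkFun_apply (Equiv.swap i.castSucc i.succ) (fun j => (a j.succ).1.card) l u hu
        have e1 : (∑ j, if j < l.succ then (a j).1.card else 0) =
            (a 0).1.card + ∑ j : Fin (n + 1), if j < l then (a j.succ).1.card else 0 := by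
          rw [Fin.sum_univ_succ]; simp
        have e2 : (∑ j, if Equiv.swap i.succ.castSucc i.succ.succ j <
              Equiv.swap i.succ.castSucc i.succ.succ l.succ then (a j).1.card else 0) =
            (a 0).1.card + ∑ j, if Equiv.swap i.castSucc i.succ j <
              Equiv.swap i.castSucc i.succ l then (a j.succ).1.card else 0 := by
          rw [Fin.sum_univ_succ, h0]
          simp only [h1, Fin.succ_lt_succ_iff, Fin.succ_pos, if_true]
        have e3 : ∀ A B : ℕ, A + B + u - A = B + u := fun A B => by omega
        rw [e1, e2, if_neg (by omega), e3, this, ← add_assoc]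

/-- Adjacent transpositions generate the symmetric group, and the property is multiplicative because
Koszul signs and block permutations compose. -/
theorem permComm {s : ℕ} (σ : Equiv.Perm (Fin s)) : PermComm E σ := by
  rcases s with _ | n
  · rw [Subsingleton.elim σ 1]
    exact permComm_one 0
  · have h : σ ∈ Submonoid.closure (Set.range fun i : Fin n => Equiv.swap i.castSucc i.succ) := by
      rw [Equiv.Perm.mclosure_swap_castSucc_succ]; trivial
    induction h using Submonoid.closure_induction with
    | mem σ h => obtain ⟨i, rfl⟩ := h; exact permComm_swap n i
    | one => exact permComm_one _
    | mul σ ρ _ _ hσ hρ => exact hσ.mul hρ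

end CommIDGA

end IDGA

end

/-! ### Morphisms that permute blocks, and the Leibniz rule and regrouping for finite products -/

noncomputable section

namespace IDGA

namespace ICat

/-- The values of a morphism. -/
def valFun {m n : ICat} (f : m ⟶ n) (t : ℕ) : ℕ :=
  if h : t < m.card then (toEmb f ⟨t, h⟩).val else 0

theorem valFun_val {m n : ICat} (f : m ⟶ n) (t : Fin m.card) : valFun f t.val = (toEmb f t).val := by
  rw [valFun, dif_pos t.2]

/-- The morphism between concatenations that is given by `f` on the blocks and permutes them. -/
def blkHom {s : ℕ} (σ τ : Equiv.Perm (Fin s)) {m m' : Fin s → ICat} (f : ∀ i, m i ⟶ m' i) :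
    sum (fun i => m (σ.symm i)) ⟶ sum (fun i => m' (τ.symm i)) :=
  ofEmb (((blockEquiv σ fun i => (m i).card).toEmbedding.trans
    (Function.Embedding.sigmaMap (Function.Embedding.refl _) fun i => toEmb (f i))).trans
      (blockEquiv τ fun i => (m' i).card).symm.toEmbedding)

theorem blkHom_val {s : ℕ} (σ τ : Equiv.Perm (Fin s)) {m m' : Fin s → ICat} (f : ∀ i, m i ⟶ m' i)
    (x : (i : Fin s) × Fin (m i).card) :
    (toEmb (blkHom σ τ f) ((blockEquiv σ fun i => (m i).card).symm x)).val =
      (∑ j, if τ j < τ x.1 then (m' j).card else 0) + (toEmb (f x.1) x.2).val := by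
  change ((blockEquiv τ fun i => (m' i).card).symm (Sigma.map id (fun i => toEmb (f i))
    (blockEquiv σ (fun i => (m i).card) ((blockEquiv σ fun i => (m i).card).symm x)))).val = _
  rw [Equiv.apply_symm_apply, blockEquiv_symm_val]
  rfl

end ICat

namespace CommIDGA

variable {k : Type u} [CommRing k] {E : CommIDGA.{u, v} k}

theorem Arr.of_map {m n : ICat} (f : m ⟶ n) (x : Gr (E.toFunctor.obj m)) :
    Arr (E := E) (ICat.valFun f) ⟨m, x⟩ ⟨n, Gr.map (E.toFunctor.map f) x⟩ :=
  ⟨f, fun t => (ICat.valFun_val f t).symm, rfl⟩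

/-- The signed products of the permutations of a family of homogeneous elements correspond to each
other under the permutations of the blocks. -/
theorem map_blkHom {s : ℕ} (σ τ : Equiv.Perm (Fin s)) {m m' : Fin s → ICat} (f : ∀ i, m i ⟶ m' i)
    (q : Fin s → ℤ) (x : ∀ i, Gr (E.toFunctor.obj (m i)))
    (hx : ∀ i, x i ∈ LinearMap.range (Gr.ι _ (q i))) :
    Gr.map (E.toFunctor.map (ICat.blkHom σ τ f)) (koszul σ q • E.prod s _ fun i => x (σ.symm i)) =
      koszul τ q • E.prod s _ fun i => Gr.map (E.toFunctor.map (f (τ.symm i))) (x (τ.symm i)) := by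
  let a : Fin s → E.El := fun i => ⟨m i, x i⟩
  let b : Fin s → E.El := fun i => ⟨m' i, Gr.map (E.toFunctor.map (f i)) (x i)⟩
  -- The morphism is factored: first `f` is applied on the blocks in the order given by `σ`, then
  -- the blocks are permuted by `τ * σ⁻¹`. The first step is naturality of products.
  have h1 : Arr (ICat.valFun (ICat.blkHom σ σ f)) (El.prod fun i => a (σ.symm i))
      (El.prod fun i => b (σ.symm i)) := by
    refine Arr.prod (fun i => Arr.of_map (f (σ.symm i)) (x (σ.symm i))) _ fun i u hu => ?_
    have h := blockEquiv_symm_val σ (fun i => (m i).card) ⟨σ.symm i, ⟨u, hu⟩⟩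
    have h' := ICat.blkHom_val σ σ f ⟨σ.symm i, ⟨u, hu⟩⟩
    rw [← sum_lt_perm, Equiv.apply_symm_apply] at h
    rw [← sum_lt_perm σ fun i => (m' i).card, Equiv.apply_symm_apply] at h'
    refine Eq.trans ?_ (h'.trans (congrArg _ (ICat.valFun_val (f (σ.symm i)) ⟨u, hu⟩).symm))
    refine Eq.trans (congrArg (ICat.valFun (ICat.blkHom σ σ f)) h.symm) ?_
    exact ICat.valFun_val (ICat.blkHom σ σ f) ((blockEquiv σ fun i => (m i).card).symm _)
  -- The second step uses commutativity; by `koszul_mul` its sign turns the Koszul sign of `σ` into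
  -- that of `τ`.
  have h2 := permComm (τ * σ⁻¹) (fun i => b (σ.symm i)) (fun i => q (σ.symm i)) fun i =>
    Gr.map_mem_range _ (hx (σ.symm i))
  have h3 := (h1.smul (koszul σ q)).trans (h2.smul (koszul σ q))
  rw [El.smul_smul, ← koszul_mul, inv_mul_cancel_right] at h3
  have h4 : (fun i => b (σ.symm ((τ * σ⁻¹).symm i))) = fun i => b (τ.symm i) := by
    funext i
    have : (τ * σ⁻¹).symm i = σ (τ.symm i) := rfl
    rw [this, Equiv.symm_apply_apply]
  rw [h4, ← prod_eq (fun i => m (σ.symm i)) fun i => x (σ.symm i),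
    ← prod_eq (fun i => m' (τ.symm i)) fun i => Gr.map (E.toFunctor.map (f (τ.symm i))) (x (τ.symm i))]
    at h3
  refine h3.map_eq (ICat.blkHom σ τ f) fun t => ?_
  obtain ⟨⟨i, u⟩, rfl⟩ := (blockEquiv σ fun i => (m i).card).symm.surjective t
  rw [ICat.blkHom_val]
  dsimp only
  have h5 := ICat.blkHom_val σ σ f ⟨i, u⟩
  rw [← sum_lt_perm σ fun i => (m' i).card] at h5
  refine Eq.trans ?_ (congrArg _ (h5.symm.trans (ICat.valFun_val (ICat.blkHom σ σ f)
    ((blockEquiv σ fun i => (m i).card).symm ⟨i, u⟩)).symm))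
  have h6 := blkFun_apply (τ * σ⁻¹) (fun i => (m' (σ.symm i)).card) (σ i) (ICat.toEmb (f i) u).val
    (by simp)
  refine Eq.trans ?_ h6.symm
  rw [← Equiv.sum_comp σ.symm]
  simp

theorem mul_mem_range {m n : ICat} {p q : ℤ} {x : Gr (E.toFunctor.obj m)} {y : Gr (E.toFunctor.obj n)}
    (hx : x ∈ LinearMap.range (Gr.ι _ p)) (hy : y ∈ LinearMap.range (Gr.ι _ q)) :
    E.mul m n x y ∈ LinearMap.range (Gr.ι _ (p + q)) := by
  obtain ⟨x, rfl⟩ := hx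
  obtain ⟨y, rfl⟩ := hy
  exact E.mul_degree m n p q x y

theorem prod_mem_range {s : ℕ} {m : Fin s → ICat} {x : ∀ i, Gr (E.toFunctor.obj (m i))} {q : Fin s → ℤ}
    (hx : ∀ i, x i ∈ LinearMap.range (Gr.ι _ (q i))) :
    E.prod s m x ∈ LinearMap.range (Gr.ι _ (∑ i, q i)) := by
  induction s with
  | zero => exact Gr.map_mem_range _ ⟨_, rfl⟩
  | succ s ih =>
    rw [Fin.sum_univ_succ]
    exact Gr.map_mem_range _ (mul_mem_range (hx 0) (ih fun i => hx i.succ))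

theorem d_prod {s : ℕ} {m : Fin s → ICat} {x : ∀ i, Gr (E.toFunctor.obj (m i))} {q : Fin s → ℤ}
    (hx : ∀ i, x i ∈ LinearMap.range (Gr.ι _ (q i))) :
    Gr.d _ (E.prod s m x) = ∑ i, sgn (∑ j, if j < i then q j else 0) •
      E.prod s m (Function.update x i (Gr.d _ (x i))) := by
  induction s with
  | zero =>
    refine (Gr.d_map (E.toFunctor.map (ICat.castHom _)) (Gr.ι _ 0 E.one)).trans ?_
    rw [E.one_cycle, map_zero]
    simp
  | succ s ih =>
    have h : (m 0).card + (ICat.sum fun i => m i.succ).card = (ICat.sum m).card := by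
      simp [ICat.sum, Fin.sum_univ_succ]
    have hl : Gr.d _ (E.mul (m 0) _ (x 0) (E.prod s (fun i => m i.succ) fun i => x i.succ)) =
        E.mul _ _ (Gr.d _ (x 0)) (E.prod s (fun i => m i.succ) fun i => x i.succ) + sgn (q 0) •
          E.mul _ _ (x 0) (Gr.d _ (E.prod s (fun i => m i.succ) fun i => x i.succ)) := by
      obtain ⟨y, hy⟩ := prod_mem_range fun i : Fin s => hx i.succ
      obtain ⟨z, hz⟩ := hx 0
      rw [← hy, ← hz]
      exact E.leibniz _ _ _ _ _ _
    rw [prod_succ m x h, Gr.d_map, hl, ih fun i => hx i.succ, map_add, map_zsmul, map_sum, map_sum,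
      Fin.sum_univ_succ, Finset.smul_sum]
    congr 1
    · simp only [Fin.not_lt_zero, if_false, Finset.sum_const_zero, sgn_zero, one_smul]
      rw [prod_succ m _ h]
      simp
    · refine Finset.sum_congr rfl fun i _ => ?_
      rw [prod_succ m _ h, map_zsmul, map_zsmul, ← mul_smul, ← sgn_add, Fin.sum_univ_succ]
      simp only [Fin.succ_pos, if_true, Fin.succ_lt_succ_iff]
      refine congrArg _ (congrArg _ ?_)
      rw [Function.update_of_ne (Fin.succ_ne_zero i).symm]
      refine congrArg _ (congrArg _ (funext fun i' => ?_))
      by_cases hi : i' = i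
      · subst hi; simp
      · rw [Function.update_of_ne hi, Function.update_of_ne (by simpa using hi)]

theorem El.prod_cast {n n' : ℕ} (h : n = n') (a : Fin n → E.El) (b : Fin n' → E.El)
    (hab : ∀ t, b (finCongr h t) = a t) : El.prod b = El.prod a := by
  subst h
  exact congrArg El.prod (funext hab)

theorem El.prod_add {n n' : ℕ} (a : Fin (n + n') → E.El) :
    El.prod a = El.prod (fun i => a (Fin.castAdd n' i)) * El.prod fun i => a (Fin.natAdd n i) := by
  rw [El.prod, List.ofFn_add, List.prod_append]
  rfl

theorem El.prod_nested {s : ℕ} (j : Fin s → ℕ) (a : Fin (∑ i, j i) → E.El) :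
    El.prod a = El.prod fun i => El.prod fun t => a (finSigmaFinEquiv ⟨i, t⟩) := by
  induction s with
  | zero =>
    rw [El.prod_zero]
    exact El.prod_zero _
  | succ s ih =>
    rw [El.prod_succ]
    have h : j 0 + ∑ i : Fin s, j i.succ = ∑ i, j i := (Fin.sum_univ_succ j).symm
    rw [El.prod_cast h (fun t => a (finCongr h t)) a fun _ => rfl, El.prod_add, ih]
    refine congrArg₂ (· * ·) (congrArg _ (funext fun t => congrArg a (Fin.ext ?_)))
      (congrArg _ (funext fun i => congrArg _ (funext fun t => congrArg a (Fin.ext ?_))))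
    · rw [finSigma_val]
      simp
    · rw [finSigma_val]
      have : (∑ i', if i' < i.succ then j i' else 0) =
          j 0 + ∑ i' : Fin s, if i' < i then j i'.succ else 0 := by
        rw [Fin.sum_univ_succ]; simp
      rw [this, add_assoc]
      exact congrArg _ (finSigma_val (n := fun i => j i.succ) ⟨i, t⟩)

/-- The order given by `permComp σ τ` runs through the blocks in the order of `σ`, and through each
block in the order of its `τ i`. After regrouping, both sides list the same factors. -/
theorem El.prod_permComp {s : ℕ} {j : Fin s → ℕ} (σ : Equiv.Perm (Fin s))
    (τ : ∀ i, Equiv.Perm (Fin (j i))) (a : Fin (∑ i, j i) → E.El) :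
    El.prod (fun u => a ((permComp σ τ).symm u)) = El.prod fun i => El.prod fun t =>
      a (finSigmaFinEquiv ⟨σ.symm i, (τ (σ.symm i)).symm t⟩) := by
  have h : ∑ i, j (σ.symm i) = ∑ i, j i := Equiv.sum_comp σ.symm j
  rw [El.prod_cast h (fun u => a ((permComp σ τ).symm (finCongr h u))) _ fun _ => rfl,
    El.prod_nested]
  refine congrArg _ (funext fun i => congrArg _ (funext fun t => congrArg a ?_))
  rw [Equiv.symm_apply_eq]
  refine Fin.ext ?_
  rw [permComp_val, Equiv.apply_symm_apply, Equiv.apply_symm_apply, ← sum_lt_perm]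
  exact finSigma_val (n := fun i => j (σ.symm i)) ⟨i, t⟩

theorem El.prod_one (a : Fin 1 → E.El) : El.prod a = a 0 := by
  rw [El.prod_succ, El.prod_zero, _root_.mul_one]

/-- Morphisms of commutative `𝓘`-dgas are compatible with products of finite families. -/
theorem Hom.map_prod {F : CommIDGA.{u, v} k} (f : Hom E F) {s : ℕ} (m : Fin s → ICat)
    (x : ∀ i, Gr (E.toFunctor.obj (m i))) :
    Gr.map (f.toNatTrans.app (ICat.sum m)) (E.prod s m x) =
      F.prod s m fun i => Gr.map (f.toNatTrans.app (m i)) (x i) := by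
  induction s with
  | zero =>
    refine (Gr.map_map (E.toFunctor.map (ICat.castHom _)) (f.toNatTrans.app (ICat.sum m))
      (Gr.ι _ 0 E.one)).trans ?_
    rw [f.toNatTrans.naturality, ← Gr.map_map, Gr.map_ι, f.map_one]
    rfl
  | succ s ih =>
    have h : (m 0).card + (ICat.sum fun i => m i.succ).card = (ICat.sum m).card := by
      simp [ICat.sum, Fin.sum_univ_succ]
    rw [prod_succ m _ h, prod_succ m _ h, Gr.map_map, f.toNatTrans.naturality, ← Gr.map_map, f.map_mul, ih]

end CommIDGA

end IDGA

end

noncomputable section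

namespace IDGA

/-! ### Simplices of the simplicial replacement -/

section

variable {k : Type u} [CommRing k]

/-- The simplices of the simplicial replacement of `P`. -/
abbrev HR (P : ICat ⥤ Ch.{u, v} k) : SSimp.{v} where
  X N := (F : NSimplex N) × Gr (P.obj F.last)
  pull f y := ⟨y.1.pull f, Gr.map (P.map (y.1.lastHom f)) y.2⟩
  pull_id y := by
    refine Sigma.ext rfl (heq_of_eq ?_)
    change Gr.map (P.map (y.1.map (𝟙 _))) y.2 = y.2
    rw [y.1.map_id, P.map_id, Gr.map_id]
    rfl
  pull_pull f g y := by
    refine Sigma.ext rfl (heq_of_eq ?_)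
    refine (Gr.map_map _ _ _).trans ?_
    rw [← P.map_comp]
    exact congrArg (fun h => Gr.map (P.map h) y.2) (y.1.map_comp _ _).symm

variable (P : ICat ⥤ Ch.{u, v} k)

/-- The bicomplex of the simplicial replacement. -/
abbrev srepC : ChainComplex (Ch.{u, v} k) ℕ :=
  (AlgebraicTopology.alternatingFaceMapComplex (Ch.{u, v} k)).obj (srep.obj P)

/-- The element of the homotopy colimit given by a simplex of the simplicial replacement. -/
def hEl (z : (r : ℕ) × (HR P).X r) : Gr (hocolim.obj P) := hGen P z.2.1 z.2.2

variable {P}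

/-- The inclusion of a summand into the homotopy colimit. -/
def hInc {p : ℕ} (F : NSimplex p) (q n : ℤ) (h : p + q = n) :
    (P.obj F.last).X q →ₗ[k] (hocolim.obj P).X n :=
  totGen (srepC P) p q n h ∘ₗ srepGen P F q

theorem hGen_ι {p : ℕ} (F : NSimplex p) (q n : ℤ) (h : p + q = n) (x : (P.obj F.last).X q) :
    hGen P F (Gr.ι _ q x) = Gr.ι (hocolim.obj P) n (hInc F q n h x) := by
  subst h
  exact DirectSum.toModule_lof _ _ _

theorem hGen_mem_range {p : ℕ} (F : NSimplex p) {q n : ℤ} (h : p + q = n) {x : Gr (P.obj F.last)}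
    (hx : x ∈ LinearMap.range (Gr.ι _ q)) : hGen P F x ∈ LinearMap.range (Gr.ι (hocolim.obj P) n) := by
  obtain ⟨x, rfl⟩ := hx
  exact ⟨_, (hGen_ι F q n h x).symm⟩

variable (P) in
/-- The elements of degree `n` given by the simplices of the simplicial replacement. -/
def hGens (n : ℤ) : Set (Gr (hocolim.obj P)) :=
  {y | ∃ (z : (r : ℕ) × (HR P).X r) (q : ℤ), z.1 + q = n ∧ z.2.2 ∈ LinearMap.range (Gr.ι _ q) ∧
    hEl P z = y}

theorem hEl_span (n : ℤ) (y : (hocolim.obj P).X n) :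
    Gr.ι (hocolim.obj P) n y ∈ Submodule.span k (hGens P n) := by
  revert y
  change ∀ y : TotX (srepC P) n, _
  intro y
  let L : TotX (srepC P) n →ₗ[k] Gr (hocolim.obj P) := Gr.ι (hocolim.obj P) n
  change L y ∈ _
  induction y using DirectSum.induction_on with
  | zero => exact (map_zero L).symm ▸ Submodule.zero_mem _
  | add x y hx hy => exact (map_add L x y).symm ▸ Submodule.add_mem _ hx hy
  | of a y =>
    obtain ⟨⟨p, q⟩, h⟩ := a
    revert y
    change ∀ y : SrepX P p q, _
    intro y
    let L' : SrepX P p q →ₗ[k] Gr (hocolim.obj P) := L ∘ₗ totGen (srepC P) p q n h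
    change L' y ∈ _
    induction y using DirectSum.induction_on with
    | zero => exact (map_zero L').symm ▸ Submodule.zero_mem _
    | add x y hx hy => exact (map_add L' x y).symm ▸ Submodule.add_mem _ hx hy
    | of F x =>
      exact Submodule.subset_span ⟨⟨p, F, Gr.ι _ q x⟩, q, h, ⟨x, rfl⟩, hGen_ι F q n h x⟩

theorem hCoord_hGen {p : ℕ} (F : NSimplex p) (q : ℤ) (x : (P.obj F.last).X q) :
    hCoord P (hGen P F (Gr.ι _ q x)) = DFinsupp.lsingle (R := k)
      (M := fun a : HIndex => (P.obj a.2.1.last).X a.2.2) ⟨p, F, q⟩ x := by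
  rw [hGen_ι F q (p + q) rfl]
  refine (DirectSum.toModule_lof _ _ _).trans ?_
  refine (DirectSum.toModule_lof _ _ _).trans ?_
  exact DirectSum.toModule_lof _ _ _

theorem map_hEl {Q : ICat ⥤ Ch.{u, v} k} (φ : P ⟶ Q) {p : ℕ} (F : NSimplex p) (x : Gr (P.obj F.last)) :
    Gr.map (hocolim.map φ) (hEl P ⟨p, F, x⟩) = hEl Q ⟨p, F, Gr.map (φ.app F.last) x⟩ := by
  suffices h : Gr.map (hocolim.map φ) ∘ₗ hGen P F = hGen Q F ∘ₗ Gr.map (φ.app F.last) from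
    LinearMap.congr_fun h x
  refine Gr.hom_ext fun q x => ?_
  rw [LinearMap.comp_apply, LinearMap.comp_apply, hGen_ι F q _ rfl, Gr.map_ι, Gr.map_ι,
    hGen_ι F q _ rfl]
  refine congrArg _ ?_
  refine (totMap_gen _ p q _ rfl _).trans ?_
  exact congrArg (totGen (srepC Q) p q _ rfl) (srepNat_gen φ F q x)

theorem hocolim_d (n : ℤ) : (hocolim.obj P).d (n + 1) n = ModuleCat.ofHom (totD (srepC P) n) :=
  ChainComplex.of_d (fun n : ℤ => ModuleCat.of k (TotX (srepC P) n))
    (fun n => ModuleCat.ofHom (totD (srepC P) n)) n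

theorem f_sum_zsmul {X Y : Ch.{u, v} k} {ι : Type*} (S : Finset ι) (z : ι → ℤ) (f : ι → (X ⟶ Y))
    (q : ℤ) (x : X.X q) : ((∑ i ∈ S, z i • f i).f q).hom x = ∑ i ∈ S, z i • ((f i).f q).hom x := by
  have h : (∑ i ∈ S, z i • f i).f q = ∑ i ∈ S, z i • (f i).f q := by
    refine (map_sum (HomologicalComplex.Hom.fAddMonoidHom q) _ _).trans ?_
    exact Finset.sum_congr rfl fun i _ => map_zsmul (HomologicalComplex.Hom.fAddMonoidHom q) _ _
  rw [h, hom_sum_zsmul]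

theorem srepC_d {p : ℕ} (F : NSimplex (p + 1)) (q : ℤ) (x : (P.obj F.last).X q) :
    (((srepC P).d (p + 1) p).f q).hom (srepGen P F q x) =
      ∑ l : Fin (p + 2), (-1 : ℤ) ^ l.val • srepGen P (F.pull (coface l)) q
        (((P.map (F.lastHom (coface l))).f q).hom x) := by
  refine (hom_congr (congrArg (fun h => HomologicalComplex.Hom.f h q)
    (AlgebraicTopology.alternatingFaceMapComplex_obj_d (srep.obj P) p)) _).trans ?_
  refine (f_sum_zsmul _ _ _ _ _).trans (Finset.sum_congr rfl fun l _ => congrArg _ ?_)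
  exact srepMap_gen P (coface l) F q x

theorem hocolim_d_hInc_zero (F : NSimplex 0) (q n : ℤ) (h : (0 : ℕ) + q = n + 1)
    (x : (P.obj F.last).X q) : ((hocolim.obj P).d (n + 1) n).hom (hInc F q (n + 1) h x) =
      hInc F (q - 1) n (by omega) (((P.obj F.last).d q (q - 1)).hom x) := by
  refine (hom_congr (hocolim_d n) _).trans ((totD_gen_zero _ q n h _).trans (congrArg _ ?_))
  exact srepD_gen P F q (q - 1) x

theorem hocolim_d_hInc_succ {p : ℕ} (F : NSimplex (p + 1)) (q n : ℤ) (h : (p + 1 : ℕ) + q = n + 1)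
    (x : (P.obj F.last).X q) : ((hocolim.obj P).d (n + 1) n).hom (hInc F q (n + 1) h x) =
      (∑ l : Fin (p + 2), (-1 : ℤ) ^ l.val • hInc (F.pull (coface l)) q n
        (by omega) (((P.map (F.lastHom (coface l))).f q).hom x)) +
      sgn (p + 1 : ℕ) • hInc F (q - 1) n (by omega) (((P.obj F.last).d q (q - 1)).hom x) := by
  refine (hom_congr (hocolim_d n) _).trans ((totD_gen_succ _ p q n h _).trans ?_)
  have h1 : totGen (srepC P) p q n (by omega)
      ((((srepC P).d (p + 1) p).f q).hom (srepGen P F q x)) = _ := congrArg _ (srepC_d F q x)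
  have h2 : totGen (srepC P) (p + 1) (q - 1) n (by omega)
      ((((srepC P).X (p + 1)).d q (q - 1)).hom (srepGen P F q x)) = _ :=
    congrArg _ (srepD_gen P F q (q - 1) x)
  have h3 : sgn ((p + 1 : ℕ) : ℤ) = - sgn p := by simp [sgn, Int.negOnePow_succ]
  rw [h3, neg_smul]
  refine Eq.trans ?_ (sub_eq_add_neg _ _)
  refine congrArg₂ (· - ·) (h1.trans ?_) (congrArg _ h2)
  let T : SrepX P p q →ₗ[k] TotX (srepC P) n :=
    totGen (srepC P) p q n (by omega)
  refine (map_sum T _ _).trans (Finset.sum_congr rfl fun l _ => ?_)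
  exact map_zsmul T _ _

/-- The differential of the homotopy colimit. -/
theorem d_hEl {p : ℕ} (F : NSimplex p) {q : ℤ} {x : Gr (P.obj F.last)}
    (hx : x ∈ LinearMap.range (Gr.ι _ q)) :
    Gr.d _ (hEl P ⟨p, F, x⟩) = (HR P).bdry (hEl P) ⟨p, F, x⟩ + sgn p • hEl P ⟨p, F, Gr.d _ x⟩ := by
  obtain ⟨x, rfl⟩ := hx
  obtain ⟨n, hn⟩ : ∃ n : ℤ, p + q = n + 1 := ⟨p + q - 1, by ring⟩
  have h1 : hEl P ⟨p, F, Gr.ι _ q x⟩ = _ := hGen_ι F q (n + 1) hn x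
  have h2 : hEl P ⟨p, F, Gr.d _ (Gr.ι _ q x)⟩ = Gr.ι (hocolim.obj P) n (hInc F (q - 1) n
      (by omega) (((P.obj F.last).d q (q - 1)).hom x)) := by
    rw [Gr.d_ι]
    exact hGen_ι F (q - 1) n (by omega) _
  rw [h1, h2, Gr.d_ι_of_eq (hocolim.obj P) (m := n) rfl]
  rcases p with _ | p
  · rw [hocolim_d_hInc_zero, SSimp.bdry_of_eq_zero _ _ rfl]
    simp [sgn]
  · rw [hocolim_d_hInc_succ, map_add, map_sum, map_zsmul]
    refine congrArg₂ (· + ·) (Finset.sum_congr rfl fun l _ => ?_) rfl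
    rw [map_zsmul]
    refine congrArg _ ?_
    refine (hGen_ι (F.pull (coface l)) q n (by omega) _).symm.trans ?_
    rw [← Gr.map_ι]
    rfl

end

end IDGA

end

noncomputable section

namespace IDGA

/-! ### The action on simplices -/

section

variable {k : Type u} [CommRing k] (E : CommIDGA.{u, v} k) {s : ℕ}

/-- The action of simplices of the translation category on simplices of the simplicial replacement
with coefficients of degrees `q`. -/
def actLevel (q : Fin s → ℤ) (N : ℕ) (c : (beS s).X N) (y : Fin s → (HR E.toFunctor).X N) :
    (HR E.toFunctor).X N :=
  ⟨actSimplex c fun i => (y i).1, koszul (c (Fin.last N)) q •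
    E.prod s (fun i => (y ((c (Fin.last N)).symm i)).1.last) fun i => (y ((c (Fin.last N)).symm i)).2⟩

/-- The degrees `q` can be kept as fixed parameters of the operation, since simplicial operators do
not change the degrees of coefficients. -/
theorem actGen_eq_shSum (q : Fin s → ℤ) (c : (p : ℕ) × (beS s).X p) (r : Fin s → ℕ)
    (F : ∀ i, NSimplex (r i)) (x : ∀ i, (E.toFunctor.obj (F i).last).X (q i)) :
    actGen E c (fun i => ⟨r i, F i, q i⟩) x =
      sgn (∑ i, ∑ j, if i < j then q i * (r j : ℤ) else 0) •
        shSum (C := beS s) (S := fun _ => HR E.toFunctor)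
          (fun N c y => hEl E.toFunctor ⟨N, actLevel E q N c y⟩)
          (∑ i, (Fin.cons c.1 r : Fin (s + 1) → ℕ) i) c fun i => ⟨r i, F i, Gr.ι _ (q i) (x i)⟩ := by
  rw [actGen, smul_apply, sum_apply]
  refine congrArg _ ?_
  rw [shSum]
  dsimp only
  rw [← sum_shuffle _ fun w => wsign (· < ·) w • hEl E.toFunctor ⟨_, actLevel E q _
    ((beS s).degen w 0 c) fun i => (HR E.toFunctor).degen w i.succ ⟨r i, F i, Gr.ι _ (q i) (x i)⟩⟩]
  refine Finset.sum_congr rfl fun w _ => ?_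
  rw [Shuffle.sign_eq, smul_apply]
  refine congrArg _ ?_
  have h : hEl E.toFunctor ⟨_, actLevel E q _ ((beS s).pull (w.deg 0) c.2) fun i =>
      (HR E.toFunctor).pull (w.deg i.succ) ⟨F i, Gr.ι _ (q i) (x i)⟩⟩ =
      hEl E.toFunctor ⟨_, actLevel E q _ ((beS s).degen w.1 0 c) fun i =>
        (HR E.toFunctor).degen w.1 i.succ ⟨r i, F i, Gr.ι _ (q i) (x i)⟩⟩ := by
    refine congrArg (fun y => hEl E.toFunctor ⟨_, y⟩) (congrArg₂ (actLevel E q _)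
      (congrArg (fun D => (beS s).pull D c.2) (w.deg_eq 0)) (funext fun i => ?_))
    exact congrArg (fun D => (HR E.toFunctor).pull D ⟨F i, Gr.ι _ (q i) (x i)⟩) (w.deg_eq i.succ)
  rw [← h, smul_apply]
  exact (map_zsmul (hGen E.toFunctor _) _ _).symm

theorem hocolimAction_beEl (q : Fin s → ℤ) (c : (p : ℕ) × (beS s).X p) (r : Fin s → ℕ)
    (F : ∀ i, NSimplex (r i)) (x : ∀ i, (E.toFunctor.obj (F i).last).X (q i)) :
    hocolimAction E s (beEl k c) (fun i => hEl E.toFunctor ⟨r i, F i, Gr.ι _ (q i) (x i)⟩) =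
      actGen E c (fun i => ⟨r i, F i, q i⟩) x := by
  rw [hocolimAction, LinearMap.comp_apply, beCoord_beEl, DFinsupp.lsum_apply_apply,
    DFinsupp.sumAddHom_single]
  change ((1 : k) • (_ : MultilinearMap k _ _)) _ = _
  rw [one_smul, MultilinearMap.compLinearMap_apply]
  have h : ∀ i, hCoord E.toFunctor (hEl E.toFunctor ⟨r i, F i, Gr.ι _ (q i) (x i)⟩) =
    DFinsupp.single (⟨r i, F i, q i⟩ : HIndex) (x i) := fun i => hCoord_hGen (F i) (q i) (x i)
  simp only [h]
  exact MultilinearMap.fromDFinsuppEquiv_single (R := k) (N := Gr (hocolim.obj E.toFunctor))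
    (M := fun (_ : Fin s) (a : HIndex) => (E.toFunctor.obj a.2.1.last).X a.2.2)
    (fun a => actGen E c a) (fun i => (⟨r i, F i, q i⟩ : HIndex)) x

/-- The exponent of the sign in the action on the total complex. -/
def totExp (q : Fin s → ℤ) (r : Fin s → ℕ) : ℤ := ∑ i, ∑ j, if i < j then q i * (r j : ℤ) else 0

/-- Homogeneity enters as membership in the range of an inclusion, a condition that survives
simplicial operators, differentials and products without a choice of representatives. -/
theorem hocolimAction_eq_shSum (q : Fin s → ℤ) (c : (p : ℕ) × (beS s).X p)
    (y : Fin s → (r : ℕ) × (HR E.toFunctor).X r)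
    (hy : ∀ i, (y i).2.2 ∈ LinearMap.range (Gr.ι _ (q i))) {N : ℕ} (hN : N = c.1 + ∑ i, (y i).1) :
    hocolimAction E s (beEl k c) (fun i => hEl E.toFunctor (y i)) =
      sgn (totExp q fun i => (y i).1) • shSum (C := beS s) (S := fun _ => HR E.toFunctor)
        (fun N c y => hEl E.toFunctor ⟨N, actLevel E q N c y⟩) N c y := by
  choose x hx using hy
  have h : y = fun i => ⟨(y i).1, (y i).2.1, Gr.ι _ (q i) (x i)⟩ := by
    funext i
    exact Sigma.ext rfl (heq_of_eq (Sigma.ext rfl (heq_of_eq (hx i).symm)))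
  obtain rfl : N = ∑ i, (Fin.cons c.1 (fun i => (y i).1) : Fin (s + 1) → ℕ) i := by
    rw [hN, Fin.sum_univ_succ]; simp
  have key := (hocolimAction_beEl E q c (fun i => (y i).1) (fun i => (y i).2.1) x).trans
    (actGen_eq_shSum E q c _ _ x)
  rw [← h] at key
  refine Eq.trans (congrArg _ (funext fun i => ?_)) key
  rw [hx]

end

end IDGA

end

/-! ### Identities for the action in a fixed simplicial dimension -/

noncomputable section

namespace IDGA

theorem ICat.hom_heq {m m' n n' : ICat} (hm : m = m') (hn : n = n') {f : m ⟶ n} {g : m' ⟶ n'}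
    (h : ∀ x x', x.val = x'.val → (toEmb f x).val = (toEmb g x').val) : HEq f g := by
  subst hm hn
  exact heq_of_eq (hom_ext fun t => h t t rfl)

/-- Simplices of the nerve are compared through cardinalities and values in the natural numbers,
which avoids transport along equalities of objects. -/
theorem NSimplex.ext_val {N : ℕ} {F F' : NSimplex N} (hobj : ∀ t, (F.obj t).card = (F'.obj t).card)
    (hmap : ∀ (t t' : (Fin (N + 1))ᵒᵖ) (f : t ⟶ t') x x', x.val = x'.val →
      (ICat.toEmb (F.map f) x).val = (ICat.toEmb (F'.map f) x').val) : F = F' :=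
  Functor.hext (fun t => ICat.eq_of_card (hobj t)) fun t t' f =>
    ICat.hom_heq (ICat.eq_of_card (hobj t)) (ICat.eq_of_card (hobj t')) (hmap t t' f)

section

variable {s N : ℕ}

theorem actSimplex_card (c : ESimplex s N) (G : Fin s → NSimplex N) (t : (Fin (N + 1))ᵒᵖ) :
    ((actSimplex c G).obj t).card = ∑ i, ((G i).obj t).card :=
  Equiv.sum_comp (c t.unop).symm fun i => ((G i).obj t).card

/-- The position of an element of a block. -/
theorem actSimplex_exists (c : ESimplex s N) (G : Fin s → NSimplex N) {t t' : (Fin (N + 1))ᵒᵖ}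
    (f : t ⟶ t') (x : Fin ((actSimplex c G).obj t).card) :
    ∃ (i : Fin s) (u : Fin ((G i).obj t).card),
      x.val = (∑ j, if c t.unop j < c t.unop i then ((G j).obj t).card else 0) + u.val ∧
      (ICat.toEmb ((actSimplex c G).map f) x).val =
        (∑ j, if c t'.unop j < c t'.unop i then ((G j).obj t').card else 0) +
          (ICat.toEmb ((G i).map f) u).val := by
  obtain ⟨⟨i, u⟩, rfl⟩ := (blockEquiv (c t.unop) fun i => ((G i).obj t).card).symm.surjective x
  refine ⟨i, u, blockEquiv_symm_val _ _ _, ?_⟩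
  exact ICat.blkHom_val (m := fun i => (G i).obj t) (m' := fun i => (G i).obj t') _ _
    (fun i => (G i).map f) ⟨i, u⟩

theorem block_val_inj (σ : Equiv.Perm (Fin s)) (m : Fin s → ℕ) {i i' : Fin s} {a b : ℕ}
    (ha : a < m i) (hb : b < m i')
    (h : (∑ k, if σ k < σ i then m k else 0) + a = (∑ k, if σ k < σ i' then m k else 0) + b) :
    i = i' ∧ a = b := by
  have h1 := block_val_lt_iff σ m ha hb
  have h2 := block_val_lt_iff σ m hb ha
  rw [h, lt_self_iff_false, false_iff, not_or, not_and] at h1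
  rw [h, lt_self_iff_false, false_iff, not_or, not_and] at h2
  have hi : i = i' := σ.injective (le_antisymm (not_lt.1 h2.1) (not_lt.1 h1.1))
  have := h1.2 hi
  have := h2.2 hi.symm
  exact ⟨hi, by omega⟩

/-- The map of a simplex is determined by its values on the blocks. -/
theorem actSimplex_map_val (c : ESimplex s N) (G : Fin s → NSimplex N) {t t' : (Fin (N + 1))ᵒᵖ}
    (f : t ⟶ t') (x : Fin ((actSimplex c G).obj t).card) (i : Fin s) (u : Fin ((G i).obj t).card)
    (hx : x.val = (∑ j, if c t.unop j < c t.unop i then ((G j).obj t).card else 0) + u.val) :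
    (ICat.toEmb ((actSimplex c G).map f) x).val =
        (∑ j, if c t'.unop j < c t'.unop i then ((G j).obj t').card else 0) +
          (ICat.toEmb ((G i).map f) u).val := by
  obtain ⟨i', u', hu', h⟩ := actSimplex_exists c G f x
  obtain ⟨rfl, hu⟩ := block_val_inj (c t.unop) (fun j => ((G j).obj t).card) u.2 u'.2
    (hx.symm.trans hu')
  obtain rfl := Fin.ext hu
  exact h

theorem actSimplex_mul (σ : Equiv.Perm (Fin s)) (c : ESimplex s N) (G : Fin s → NSimplex N) :
    actSimplex (fun t => c t * σ) G = actSimplex c fun i => G (σ.symm i) := by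
  refine NSimplex.ext_val (fun t => rfl) fun t t' f x x' hx => ?_
  obtain ⟨i, u, hu, h⟩ := actSimplex_exists (fun t => c t * σ) G f x
  rw [h]
  obtain ⟨i, rfl⟩ := σ.symm.surjective i
  have key : ∀ t : (Fin (N + 1))ᵒᵖ, (∑ j, if (c t.unop * σ) j < (c t.unop * σ) (σ.symm i)
      then ((G j).obj t).card else 0) =
      ∑ j, if c t.unop j < c t.unop i then ((G (σ.symm j)).obj t).card else 0 := by
    intro t
    rw [← Equiv.sum_comp σ.symm]
    simp
  rw [key] at hu ⊢
  exact (actSimplex_map_val c (fun i => G (σ.symm i)) f x' i u (hx.symm.trans hu)).symm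

/-- An element is located by its innermost block and its position there. By `nested_block_sum` the
offsets of this block agree at the source and at the target of every morphism. -/
theorem actSimplex_assoc {j : Fin s → ℕ} (c : ESimplex s N) (a : ∀ i, ESimplex (j i) N)
    (G : Fin (∑ i, j i) → NSimplex N) :
    actSimplex c (fun i => actSimplex (a i) fun t => G (finSigmaFinEquiv ⟨i, t⟩)) =
      actSimplex (fun t => permComp (c t) fun i => a i t) G := by
  refine NSimplex.ext_val (fun t => ?_) fun t t' f x x' hx => ?_
  · rw [actSimplex_card, actSimplex_card, sum_finSigma]
    exact Finset.sum_congr rfl fun i _ => actSimplex_card _ _ _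
  · obtain ⟨i, y, hy, h⟩ := actSimplex_exists c _ f x
    obtain ⟨l, u, hu, h'⟩ := actSimplex_exists (a i) _ f y
    rw [h, h', ← add_assoc]
    rw [hu, ← add_assoc] at hy
    have key : ∀ t : (Fin (N + 1))ᵒᵖ, (∑ i', if c t.unop i' < c t.unop i then
        ((actSimplex (a i') fun t => G (finSigmaFinEquiv ⟨i', t⟩)).obj t).card else 0) +
        (∑ l', if a i t.unop l' < a i t.unop l then ((G (finSigmaFinEquiv ⟨i, l'⟩)).obj t).card else 0) =
        ∑ v, if permComp (c t.unop) (fun i => a i t.unop) v <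
          permComp (c t.unop) (fun i => a i t.unop) (finSigmaFinEquiv ⟨i, l⟩)
          then ((G v).obj t).card else 0 := by
      intro t
      rw [nested_block_sum]
      simp only [actSimplex_card]
    rw [key] at hy ⊢
    exact (actSimplex_map_val (fun t => permComp (c t) fun i => a i t) G f x'
      (finSigmaFinEquiv ⟨i, l⟩) u (hx.symm.trans hy)).symm

theorem actSimplex_one (G : Fin 1 → NSimplex N) : actSimplex (fun _ => 1) G = G 0 := by
  refine NSimplex.ext_val (fun t => ?_) fun t t' f x x' hx => ?_
  · rw [actSimplex_card, Fin.sum_univ_one]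
  · rw [actSimplex_map_val (fun _ => 1) G f x 0 x' (by simp [hx])]
    simp

end

section

variable {k : Type u} [CommRing k] {E : CommIDGA.{u, v} k} {s : ℕ}

theorem HR.ext {N : ℕ} {y y' : (HR E.toFunctor).X N} (h : y.1 = y'.1)
    (h' : (⟨y.1.last, y.2⟩ : E.El) = ⟨y'.1.last, y'.2⟩) : y = y' := by
  obtain ⟨F, x⟩ := y
  obtain ⟨F', x'⟩ := y'
  obtain rfl : F = F' := h
  exact congrArg _ (eq_of_heq (Sigma.mk.inj h').2)

/-- Passing to the monoid of all elements makes coefficients over propositionally equal objects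
comparable; together with `HR.ext` this separates indices from coefficients. -/
theorem actLevel_el (q : Fin s → ℤ) (N : ℕ) (c : (beS s).X N) (y : Fin s → (HR E.toFunctor).X N) :
    (⟨(actLevel E q N c y).1.last, (actLevel E q N c y).2⟩ : E.El) =
      koszul (c (Fin.last N)) q • CommIDGA.El.prod fun i =>
        ⟨(y ((c (Fin.last N)).symm i)).1.last, (y ((c (Fin.last N)).symm i)).2⟩ := by
  rw [← CommIDGA.prod_eq]
  rfl

theorem actLevel_mem_range {q : Fin s → ℤ} {N : ℕ} (c : (beS s).X N)
    {y : Fin s → (HR E.toFunctor).X N} (hy : ∀ i, (y i).2 ∈ LinearMap.range (Gr.ι _ (q i))) :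
    (actLevel E q N c y).2 ∈ LinearMap.range (Gr.ι _ (∑ i, q i)) := by
  rw [← Equiv.sum_comp (c (Fin.last N)).symm q]
  obtain ⟨z, hz⟩ := CommIDGA.prod_mem_range fun i => hy ((c (Fin.last N)).symm i)
  exact ⟨koszul (c (Fin.last N)) q • z, (map_zsmul _ _ _).trans (congrArg _ hz)⟩

/-- The action is compatible with the simplicial structures. -/
theorem pull_actLevel {q : Fin s → ℤ} {N N' : ℕ} (g : Fin (N' + 1) →o Fin (N + 1)) (c : (beS s).X N)
    {y : Fin s → (HR E.toFunctor).X N} (hy : ∀ i, (y i).2 ∈ LinearMap.range (Gr.ι _ (q i))) :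
    (HR E.toFunctor).pull g (actLevel E q N c y) =
      actLevel E q N' ((beS s).pull g c) fun i => (HR E.toFunctor).pull g (y i) := by
  refine Sigma.ext rfl (heq_of_eq ?_)
  -- The morphism of `actSimplex` from the last vertex to the vertex `g (Fin.last N')` is `blkHom`
  -- by definition. This is where the commutativity of `E` is needed: the two vertices of `c` may
  -- order the factors differently.
  exact CommIDGA.map_blkHom (c (Fin.last N)) (c (g (Fin.last N'))) (m := fun i => (y i).1.last)
    (m' := fun i => ((y i).1.pull g).last) (fun i => (y i).1.lastHom g) q (fun i => (y i).2) hy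

/-- Indices agree by `actSimplex_assoc`, coefficients by regrouping the product with
`El.prod_permComp`, and signs by `koszul_permComp`. -/
theorem actLevel_assoc {j : Fin s → ℕ} (q : Fin (∑ i, j i) → ℤ) (N : ℕ) (c : (beS s).X N)
    (a : ∀ i, (beS (j i)).X N) (y : Fin (∑ i, j i) → (HR E.toFunctor).X N) :
    actLevel E (fun i => ∑ t, q (finSigmaFinEquiv ⟨i, t⟩)) N c (fun i =>
      actLevel E (fun t => q (finSigmaFinEquiv ⟨i, t⟩)) N (a i) fun t => y (finSigmaFinEquiv ⟨i, t⟩)) =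
    actLevel E q N (beLevel j N c a) y := by
  refine HR.ext (actSimplex_assoc c a fun t => (y t).1) ?_
  rw [actLevel_el, actLevel_el]
  simp only [actLevel_el]
  rw [CommIDGA.El.prod_smul, CommIDGA.El.smul_smul, ← CommIDGA.El.prod_permComp
    (c (Fin.last N)) (fun i => a i (Fin.last N)) fun t => (⟨(y t).1.last, (y t).2⟩ : E.El)]
  refine congrArg (· • _) ?_
  rw [beLevel, koszul_permComp]
  exact congrArg _ (Equiv.prod_comp (c (Fin.last N)).symm fun i =>
    koszul (a i (Fin.last N)) fun t => q (finSigmaFinEquiv ⟨i, t⟩))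

theorem actLevel_mul (σ : Equiv.Perm (Fin s)) (q : Fin s → ℤ) (N : ℕ) (c : (beS s).X N)
    (y : Fin s → (HR E.toFunctor).X N) :
    hEl E.toFunctor ⟨N, actLevel E q N (fun t => c t * σ) y⟩ = koszul σ q •
      hEl E.toFunctor ⟨N, actLevel E (fun i => q (σ.symm i)) N c fun i => y (σ.symm i)⟩ := by
  refine Eq.trans (congrArg (fun y => hEl E.toFunctor ⟨N, y⟩) (?_ : _ =
    (⟨(actLevel E (fun i => q (σ.symm i)) N c fun i => y (σ.symm i)).1, koszul σ q •
      (actLevel E (fun i => q (σ.symm i)) N c fun i => y (σ.symm i)).2⟩ : (HR E.toFunctor).X N)))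
    (map_zsmul (hGen E.toFunctor _) _ _)
  refine HR.ext (actSimplex_mul σ c fun i => (y i).1) ?_
  rw [actLevel_el]
  have h := congrArg (koszul σ q • ·) (actLevel_el (E := E) (fun i => q (σ.symm i)) N c
    fun i => y (σ.symm i))
  refine Eq.trans ?_ h.symm
  rw [CommIDGA.El.smul_smul, koszul_mul]
  rfl

theorem actLevel_one (q : Fin 1 → ℤ) (N : ℕ) (y : Fin 1 → (HR E.toFunctor).X N) :
    actLevel E q N (fun _ => 1) y = y 0 := by
  refine HR.ext (actSimplex_one fun i => (y i).1) ?_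
  rw [actLevel_el, koszul_one, CommIDGA.El.one_smul, CommIDGA.El.prod_one]
  rfl

/-- The Leibniz rule for the permuted product, with signs rewritten by `koszul_update` in terms of
the original order of the factors. -/
theorem CommIDGA.d_prod_perm (σ : Equiv.Perm (Fin s)) {q : Fin s → ℤ} {m : Fin s → ICat}
    {x : ∀ i, Gr (E.toFunctor.obj (m i))} (hx : ∀ i, x i ∈ LinearMap.range (Gr.ι _ (q i))) :
    Gr.d _ (koszul σ q • E.prod s (fun i => m (σ.symm i)) fun i => x (σ.symm i)) =
      ∑ i, sgn (∑ j ∈ Finset.Iio i, q j) • koszul σ (Function.update q i (q i - 1)) •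
        E.prod s (fun i => m (σ.symm i)) fun i' => Function.update x i (Gr.d _ (x i)) (σ.symm i') := by
  rw [map_zsmul, CommIDGA.d_prod (q := fun i => q (σ.symm i)) fun i => hx (σ.symm i),
    Finset.smul_sum, ← Equiv.sum_comp σ]
  refine Finset.sum_congr rfl fun i _ => ?_
  rw [smul_smul, smul_smul, ← koszul_update, ← Equiv.sum_comp σ]
  simp only [Equiv.symm_apply_apply]
  refine congrArg _ (congrArg _ (funext fun i' => ?_))
  obtain ⟨i', rfl⟩ := σ.surjective i'
  by_cases hi : i' = i
  · subst hi
    have h : ∀ (j : Fin s) (_ : j = i'), Gr.d _ (x j) =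
        Function.update x i' (Gr.d _ (x i')) j := by
      rintro _ rfl
      simp
    rw [Function.update_self]
    exact h _ (σ.symm_apply_apply i')
  · rw [Function.update_of_ne (fun h => hi (σ.injective h)),
      Function.update_of_ne (by simpa using hi)]

theorem actLevel_d {q : Fin s → ℤ} {N : ℕ} (c : (beS s).X N) {y : Fin s → (HR E.toFunctor).X N}
    (hy : ∀ i, (y i).2 ∈ LinearMap.range (Gr.ι _ (q i))) :
    hEl E.toFunctor ⟨N, (actLevel E q N c y).1, Gr.d _ (actLevel E q N c y).2⟩ =
    ∑ i, sgn (∑ j ∈ Finset.Iio i, q j) • hEl E.toFunctor ⟨N, actLevel E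
      (Function.update q i (q i - 1)) N c (Function.update y i ⟨(y i).1, Gr.d _ (y i).2⟩)⟩ := by
  refine (congrArg (hGen E.toFunctor _) (CommIDGA.d_prod_perm (c (Fin.last N)) hy)).trans ?_
  refine (map_sum (hGen E.toFunctor _) _ _).trans (Finset.sum_congr rfl fun i _ => ?_)
  refine (map_zsmul (hGen E.toFunctor _) _ _).trans (congrArg _ ?_)
  have h : Function.update y i ⟨(y i).1, Gr.d _ (y i).2⟩ = fun i' => (⟨(y i').1,
      Function.update (β := fun i => Gr (E.toFunctor.obj (y i).1.last)) (fun i => (y i).2) i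
        (Gr.d _ (y i).2) i'⟩ : (HR E.toFunctor).X N) := by
    funext i'
    by_cases hi : i' = i
    · subst hi; simp
    · simp [hi]
  rw [h]
  rfl

theorem map_hEl_actLevel {F : CommIDGA.{u, v} k} (f : CommIDGA.Hom E F) (q : Fin s → ℤ) (N : ℕ)
    (c : (beS s).X N) (y : Fin s → (HR E.toFunctor).X N) :
    Gr.map (hocolim.map f.toNatTrans) (hEl E.toFunctor ⟨N, actLevel E q N c y⟩) =
      hEl F.toFunctor ⟨N, actLevel F q N c fun i =>
        ⟨(y i).1, Gr.map (f.toNatTrans.app (y i).1.last) (y i).2⟩⟩ := by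
  refine (map_hEl f.toNatTrans _ _).trans ?_
  refine congrArg (hGen F.toFunctor _) ((map_zsmul _ _ _).trans (congrArg _ ?_))
  exact f.map_prod _ _

end

end IDGA

end

/-! ### Compatibility of the action with differentials -/

noncomputable section

namespace IDGA

theorem sum_Iio {s : ℕ} (f : Fin s → ℤ) (i : Fin s) :
    ∑ j ∈ Finset.Iio i, f j = ∑ j, if j < i then f j else 0 := by
  rw [← Finset.sum_filter]
  exact Finset.sum_congr (by ext; simp) fun _ _ => rfl

section

variable {s : ℕ} (q : Fin s → ℤ) (r : Fin s → ℕ) (i : Fin s)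

/-- The effect of a face in the `i`-th variable on the sign of the total complex: the face moves
past the coefficients of the earlier variables. -/
theorem totExp_update_right {n : ℕ} (hn : n + 1 = r i) :
    totExp q r = totExp q (Function.update r i n) + ∑ j ∈ Finset.Iio i, q j := by
  rw [totExp, totExp, sum_Iio, ← Finset.sum_add_distrib]
  refine Finset.sum_congr rfl fun a _ => ?_
  rw [← Finset.sum_erase_add _ _ (Finset.mem_univ i),
    ← Finset.sum_erase_add _ _ (Finset.mem_univ i), add_assoc]
  refine congrArg₂ (· + ·) (Finset.sum_congr rfl fun b hb => ?_) ?_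
  · rw [Function.update_of_ne (Finset.ne_of_mem_erase hb)]
  · rw [Function.update_self, ← hn]
    split_ifs
    · push_cast
      ring
    · ring

/-- The corresponding effect of an internal differential, which is measured by the simplicial
degrees of the later variables. -/
theorem totExp_update_left : totExp q r = totExp (Function.update q i (q i - 1)) r +
    ∑ j, if i < j then (r j : ℤ) else 0 := by
  rw [totExp, totExp, ← Finset.sum_erase_add _ _ (Finset.mem_univ i),
    ← Finset.sum_erase_add (s := Finset.univ) (f := fun a => ∑ b, if a < b then
      Function.update q i (q i - 1) a * (r b : ℤ) else 0) (h := Finset.mem_univ i), add_assoc]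
  refine congrArg₂ (· + ·) (Finset.sum_congr rfl fun b hb => ?_) ?_
  · rw [Function.update_of_ne (Finset.ne_of_mem_erase hb)]
  · rw [← Finset.sum_add_distrib]
    refine Finset.sum_congr rfl fun b _ => ?_
    rw [Function.update_self]
    split_ifs <;> ring

theorem sum_eq_Iio_add : ∑ j, (r j : ℤ) = ∑ j ∈ Finset.Iio i, (r j : ℤ) + r i +
    ∑ j, if i < j then (r j : ℤ) else 0 := by
  have h : (r i : ℤ) = ∑ j, if j = i then (r j : ℤ) else 0 := by simp
  rw [sum_Iio, h, ← Finset.sum_add_distrib, ← Finset.sum_add_distrib]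
  refine Finset.sum_congr rfl fun j _ => ?_
  rcases lt_trichotomy j i with h | h | h
  · simp [h, h.ne, h.not_gt]
  · simp [h]
  · simp [h, h.ne', h.not_gt]

end

/-- A comparison on the faces of `z` alone, needed where homogeneity of the coefficient is known for
`z` and inherited by its faces. -/
theorem SSimp.bdry_congr_faces (S : SSimp.{v}) {M : Type*} [AddCommGroup M]
    {F G : (r : ℕ) × S.X r → M} {z : (r : ℕ) × S.X r}
    (h : ∀ n (l : Fin (n + 2)) (x : S.X (n + 1)), z = ⟨n + 1, x⟩ →
      F ⟨n, S.pull (coface l) x⟩ = G ⟨n, S.pull (coface l) x⟩) : S.bdry F z = S.bdry G z := by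
  obtain ⟨_ | n, x⟩ := z
  · rfl
  · exact Finset.sum_congr rfl fun l _ => congrArg _ (h n l x rfl)

theorem SSimp.bdry_zsmul (S : SSimp.{v}) {M : Type*} [AddCommGroup M] (a : ℤ)
    (F : (r : ℕ) × S.X r → M) (z : (r : ℕ) × S.X r) :
    S.bdry (fun z => a • F z) z = a • S.bdry F z :=
  (S.map_bdry (zsmulAddGroupHom a) F z).symm

section

variable {k : Type u} [CommRing k] {E : CommIDGA.{u, v} k} {s : ℕ}

/-- The internal differential of a simplex of the simplicial replacement. -/
def vd (P : ICat ⥤ Ch.{u, v} k) (z : (r : ℕ) × (HR P).X r) : (r : ℕ) × (HR P).X r :=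
  ⟨z.1, z.2.1, Gr.d _ z.2.2⟩

theorem HR.pull_mem_range {P : ICat ⥤ Ch.{u, v} k} {N N' : ℕ} (g : Fin (N' + 1) →o Fin (N + 1))
    {y : (HR P).X N} {q : ℤ} (hy : y.2 ∈ LinearMap.range (Gr.ι _ q)) :
    ((HR P).pull g y).2 ∈ LinearMap.range (Gr.ι _ q) :=
  Gr.map_mem_range _ hy

theorem hocolimAction_mem_range (q : Fin s → ℤ) (c : (p : ℕ) × (beS s).X p)
    (y : Fin s → (r : ℕ) × (HR E.toFunctor).X r)
    (hy : ∀ i, (y i).2.2 ∈ LinearMap.range (Gr.ι _ (q i))) :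
    hocolimAction E s (beEl k c) (fun i => hEl E.toFunctor (y i)) ∈
      LinearMap.range (Gr.ι _ (c.1 + ∑ i, ((y i).1 + q i))) := by
  rw [hocolimAction_eq_shSum E q c y hy rfl]
  refine zsmul_mem (Submodule.sum_mem _ fun w _ => zsmul_mem ?_ _) _
  refine hGen_mem_range _ ?_ (actLevel_mem_range _ fun i => HR.pull_mem_range _ (hy i))
  push_cast
  rw [Finset.sum_add_distrib, add_assoc]

/-- Internal differentials commute with degeneracies and preserve simplicial dimensions, so the same
shuffles occur on both sides and the Leibniz rule applies to each of them. -/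
theorem actLevel_shSum_vd {q : Fin s → ℤ} (N : ℕ) (c : (p : ℕ) × (beS s).X p)
    {y : Fin s → (r : ℕ) × (HR E.toFunctor).X r}
    (hy : ∀ i, (y i).2.2 ∈ LinearMap.range (Gr.ι _ (q i))) :
    shSum (C := beS s) (S := fun _ => HR E.toFunctor)
      (fun N c y => hEl E.toFunctor (vd _ ⟨N, actLevel E q N c y⟩)) N c y =
    ∑ i, sgn (∑ j ∈ Finset.Iio i, q j) • shSum (C := beS s) (S := fun _ => HR E.toFunctor)
      (fun N c y => hEl E.toFunctor ⟨N, actLevel E (Function.update q i (q i - 1)) N c y⟩) N c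
        (Function.update y i (vd _ (y i))) := by
  have h1 : ∀ i, (fun i' => (Function.update y i (vd _ (y i)) i').1) = fun i' => (y i').1 := by
    intro i
    funext i'
    by_cases hi : i' = i
    · subst hi; simp [vd]
    · simp [hi]
  unfold shSum
  simp only [h1, Finset.smul_sum]
  rw [Finset.sum_comm]
  refine Finset.sum_congr rfl fun w _ => ?_
  refine (congrArg _ (actLevel_d (q := q) ((beS s).degen w 0 c)
    (y := fun i => (HR E.toFunctor).degen w i.succ (y i))
    fun i => HR.pull_mem_range _ (hy i))).trans ?_
  rw [Finset.smul_sum]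
  refine Finset.sum_congr rfl fun i _ => ?_
  rw [smul_comm]
  refine congrArg _ (congrArg _ (congrArg (fun y => hEl E.toFunctor ⟨N, actLevel E _ N _ y⟩)
    (funext fun i' => ?_)))
  by_cases hi : i' = i
  · subst hi
    rw [Function.update_self, Function.update_self]
    exact Sigma.ext rfl (heq_of_eq (Gr.d_map _ _))
  · rw [Function.update_of_ne hi, Function.update_of_ne hi]

theorem d_hEl_vd {P : ICat ⥤ Ch.{u, v} k} (z : (r : ℕ) × (HR P).X r) {q : ℤ}
    (hz : z.2.2 ∈ LinearMap.range (Gr.ι _ q)) :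
    Gr.d _ (hEl P z) = (HR P).bdry (hEl P) z + sgn z.1 • hEl P (vd P z) :=
  d_hEl _ hz

theorem d_shSum_actLevel {q : Fin s → ℤ} (N : ℕ) (c : (p : ℕ) × (beS s).X p)
    {y : Fin s → (r : ℕ) × (HR E.toFunctor).X r}
    (hy : ∀ i, (y i).2.2 ∈ LinearMap.range (Gr.ι _ (q i))) :
    Gr.d _ (shSum (C := beS s) (S := fun _ => HR E.toFunctor)
      (fun N c y => hEl E.toFunctor ⟨N, actLevel E q N c y⟩) N c y) =
    shSum (C := beS s) (S := fun _ => HR E.toFunctor) (fun N c y =>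
      (HR E.toFunctor).bdry (hEl E.toFunctor) ⟨N, actLevel E q N c y⟩) N c y +
    sgn N • shSum (C := beS s) (S := fun _ => HR E.toFunctor)
      (fun N c y => hEl E.toFunctor (vd _ ⟨N, actLevel E q N c y⟩)) N c y := by
  unfold shSum
  rw [map_sum, Finset.smul_sum, ← Finset.sum_add_distrib]
  refine Finset.sum_congr rfl fun w _ => ?_
  rw [map_zsmul, smul_comm (sgn N), ← smul_add]
  have h := actLevel_mem_range (q := q) ((beS s).degen w 0 c)
    (y := fun i => (HR E.toFunctor).degen w i.succ (y i)) fun i => HR.pull_mem_range _ (hy i)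
  rw [d_hEl_vd ⟨N, actLevel E q N ((beS s).degen w 0 c)
    fun i => (HR E.toFunctor).degen w i.succ (y i)⟩ h]

/-- By `pull_actLevel` the action commutes with faces, so `shSum_faces` applies. For `N = 0` all
boundaries vanish, hence the truncated `N - 1` is harmless. -/
theorem shSum_bdry_actLevel {q : Fin s → ℤ} {N : ℕ} {c : (p : ℕ) × (beS s).X p}
    {y : Fin s → (r : ℕ) × (HR E.toFunctor).X r} (hN : N = c.1 + ∑ i, (y i).1)
    (hy : ∀ i, (y i).2.2 ∈ LinearMap.range (Gr.ι _ (q i))) :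
    shSum (C := beS s) (S := fun _ => HR E.toFunctor) (fun N c y =>
      (HR E.toFunctor).bdry (hEl E.toFunctor) ⟨N, actLevel E q N c y⟩) N c y =
    (beS s).bdry (fun c => shSum (C := beS s) (S := fun _ => HR E.toFunctor)
      (fun N c y => hEl E.toFunctor ⟨N, actLevel E q N c y⟩) (N - 1) c y) c +
    ∑ i, sgn (c.1 + ∑ i' ∈ Finset.Iio i, ((y i').1 : ℤ)) • (HR E.toFunctor).bdry (fun z =>
      shSum (C := beS s) (S := fun _ => HR E.toFunctor)
        (fun N c y => hEl E.toFunctor ⟨N, actLevel E q N c y⟩) (N - 1) c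
          (Function.update y i z)) (y i) := by
  rcases N with _ | N
  · have h0 : c.1 = 0 ∧ ∀ i, (y i).1 = 0 := by
      have : ∑ i, (y i).1 = 0 := by omega
      exact ⟨by omega, fun i => Finset.sum_eq_zero_iff.1 this i (Finset.mem_univ i)⟩
    rw [SSimp.bdry_of_eq_zero _ _ h0.1, zero_add]
    refine (Finset.sum_eq_zero fun w _ => ?_).trans (Finset.sum_eq_zero fun i _ => ?_).symm
    · exact smul_zero _
    · rw [SSimp.bdry_of_eq_zero _ _ (h0.2 i), smul_zero]
  · refine Eq.trans ?_ (shSum_faces (C := beS s) (S := fun _ => HR E.toFunctor)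
      (fun N c y => hEl E.toFunctor ⟨N, actLevel E q N c y⟩) N c y)
    refine Finset.sum_congr rfl fun w _ => congrArg _ (Finset.sum_congr rfl fun l _ =>
      congrArg _ ?_)
    have h := pull_actLevel (q := q) (coface l) ((beS s).degen w 0 c)
      (y := fun i => (HR E.toFunctor).degen w i.succ (y i)) fun i => HR.pull_mem_range _ (hy i)
    exact congrArg (fun y => hEl E.toFunctor ⟨N, y⟩) h

/-- The differential of the total complex is split into its simplicial and its internal part. Each
part satisfies a Leibniz rule up to sign, and it remains to match the signs with the factor of
exponent `totExp`. -/
theorem hocolimAction_d (q : Fin s → ℤ) (c : (p : ℕ) × (beS s).X p)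
    (y : Fin s → (r : ℕ) × (HR E.toFunctor).X r)
    (hy : ∀ i, (y i).2.2 ∈ LinearMap.range (Gr.ι _ (q i))) :
    Gr.d _ (hocolimAction E s (beEl k c) fun i => hEl E.toFunctor (y i)) =
      hocolimAction E s (Gr.d _ (beEl k c)) (fun i => hEl E.toFunctor (y i)) +
      ∑ i, sgn (c.1 + ∑ i' ∈ Finset.Iio i, ((y i').1 + q i')) •
        hocolimAction E s (beEl k c) (Function.update (fun i => hEl E.toFunctor (y i)) i
          (Gr.d _ (hEl E.toFunctor (y i)))) := by
  obtain ⟨N, hN⟩ : ∃ N, N = c.1 + ∑ i, (y i).1 := ⟨_, rfl⟩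
  let Φ : (Fin s → ℤ) → ∀ N, (beS s).X N → (Fin s → (HR E.toFunctor).X N) → Gr (hocolim.obj E.toFunctor) :=
    fun q N c y => hEl E.toFunctor ⟨N, actLevel E q N c y⟩
  let T := totExp q fun i => (y i).1
  have hupd : ∀ i z, (fun i' => hEl E.toFunctor (Function.update y i z i')) =
      Function.update (fun i => hEl E.toFunctor (y i)) i (hEl E.toFunctor z) := by
    intro i z
    funext i'
    by_cases hi : i' = i
    · subst hi; simp
    · simp [hi]
  have hc : hocolimAction E s (Gr.d _ (beEl k c)) (fun i => hEl E.toFunctor (y i)) =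
      sgn T • (beS s).bdry (fun c => shSum (C := beS s) (S := fun _ => HR E.toFunctor)
        (Φ q) (N - 1) c y) c := by
    rw [d_beEl, ← SSimp.bdry_zsmul]
    refine (SSimp.map_bdry _ (evalAt (hocolimAction E s) fun i => hEl E.toFunctor (y i)) _ _).trans ?_
    refine SSimp.bdry_congr _ fun c' hc' => ?_
    exact hocolimAction_eq_shSum E q c' y hy (by omega)
  -- Simplicial part in the `i`-th variable: the coefficient degrees stay, one simplicial degree
  -- drops.
  have hh : ∀ i, hocolimAction E s (beEl k c) (Function.update (fun i => hEl E.toFunctor (y i)) i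
      ((HR E.toFunctor).bdry (hEl E.toFunctor) (y i))) =
      (sgn T * sgn (∑ j ∈ Finset.Iio i, q j)) • (HR E.toFunctor).bdry (fun z =>
        shSum (C := beS s) (S := fun _ => HR E.toFunctor) (Φ q) (N - 1) c
          (Function.update y i z)) (y i) := by
    intro i
    rw [← SSimp.bdry_zsmul]
    refine (SSimp.map_bdry _ ((hocolimAction E s (beEl k c)).toLinearMap _ i) _ _).trans ?_
    refine SSimp.bdry_congr_faces _ fun n l x hx => ?_
    refine (congrArg (hocolimAction E s (beEl k c)) (hupd i _).symm).trans ?_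
    have hr : (fun i' => (Function.update y i
        ⟨n, (HR E.toFunctor).pull (coface l) x⟩ i').1) = Function.update (fun i => (y i).1) i n := by
      funext i'
      by_cases hi : i' = i
      · subst hi; simp
      · simp [hi]
    have hn : n + 1 = (y i).1 := by rw [hx]
    refine (hocolimAction_eq_shSum E q c _ ?_ (N := N - 1) ?_).trans ?_
    · intro i'
      by_cases hi : i' = i
      · subst hi
        rw [Function.update_self]
        have := hy i'
        rw [hx] at this
        exact HR.pull_mem_range _ this
      · rw [Function.update_of_ne hi]
        exact hy i'
    · have h1 := Finset.sum_update_of_mem (Finset.mem_univ i) (fun i => (y i).1) n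
      have h2 := Finset.sum_update_of_mem (Finset.mem_univ i) (fun i => (y i).1) (y i).1
      rw [Function.update_eq_self] at h2
      rw [hr, h1]
      omega
    · rw [hr]
      refine congrArg (· • _) ?_
      simp only [T]
      rw [totExp_update_right q (fun i => (y i).1) i hn, sgn_add, mul_assoc, sgn_mul_self, mul_one]
  -- Internal part in the `i`-th variable: the simplicial degrees stay, one coefficient degree
  -- drops.
  have hv : ∀ i, hocolimAction E s (beEl k c) (Function.update (fun i => hEl E.toFunctor (y i)) i
      (hEl E.toFunctor (vd _ (y i)))) =
      sgn (T + ∑ j, if i < j then ((y j).1 : ℤ) else 0) • shSum (C := beS s)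
        (S := fun _ => HR E.toFunctor) (Φ (Function.update q i (q i - 1))) N c
          (Function.update y i (vd _ (y i))) := by
    intro i
    have hr : (fun i' => (Function.update y i (vd _ (y i)) i').1) = fun i => (y i).1 := by
      funext i'
      by_cases hi : i' = i
      · subst hi; simp [vd]
      · simp [hi]
    rw [← hupd, hocolimAction_eq_shSum E (Function.update q i (q i - 1)) c _ _ (N := N), hr]
    · refine congrArg (· • _) (sgn_congr ?_)
      simp only [T]
      rw [totExp_update_left q _ i]
      exact ⟨-∑ j, if i < j then ((y j).1 : ℤ) else 0, by ring⟩
    · rw [hr]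
      exact hN
    · intro i'
      by_cases hi : i' = i
      · subst hi
        rw [Function.update_self, Function.update_self]
        exact Gr.d_mem_range (hy i')
      · rw [Function.update_of_ne hi, Function.update_of_ne hi]
        exact hy i'
  have hd : ∀ i, hocolimAction E s (beEl k c) (Function.update (fun i => hEl E.toFunctor (y i)) i
      (Gr.d _ (hEl E.toFunctor (y i)))) =
      hocolimAction E s (beEl k c) (Function.update (fun i => hEl E.toFunctor (y i)) i
        ((HR E.toFunctor).bdry (hEl E.toFunctor) (y i))) +
      sgn (y i).1 • hocolimAction E s (beEl k c) (Function.update (fun i => hEl E.toFunctor (y i)) i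
        (hEl E.toFunctor (vd _ (y i)))) := by
    intro i
    refine (congrArg ((hocolimAction E s (beEl k c)).toLinearMap _ i) (d_hEl _ (hy i))).trans ?_
    rw [map_add, map_zsmul]
    rfl
  rw [hocolimAction_eq_shSum E q c y hy hN, map_zsmul, d_shSum_actLevel N c hy,
    shSum_bdry_actLevel hN hy, actLevel_shSum_vd N c hy, hc]
  simp only [hd, hh, hv, smul_add, Finset.smul_sum, smul_smul]
  rw [add_assoc, ← Finset.sum_add_distrib]
  refine congrArg _ (Finset.sum_congr rfl fun i _ => congrArg₂ (· + ·) (congrArg (· • _) ?_)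
    (congrArg (· • _) ?_))
  -- For the simplicial part, the degrees `q j` with `j < i` enter twice on the right: through the
  -- Leibniz sign and through the change of `totExp`.
  · rw [← sgn_add, ← sgn_add, ← sgn_add]
    refine sgn_congr ⟨-∑ j ∈ Finset.Iio i, q j, ?_⟩
    rw [Finset.sum_add_distrib]
    ring
  -- For the internal part the exponents agree exactly, once `N` is decomposed into the dimensions
  -- of `c` and of the variables before, at and after `i`.
  · rw [← sgn_add, ← sgn_add, ← sgn_add, ← sgn_add]
    refine sgn_congr ⟨0, ?_⟩
    rw [Finset.sum_add_distrib, hN]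
    push_cast
    rw [sum_eq_Iio_add _ i]
    ring

end

end IDGA

end

/-! ### Signs of the total complex; the chain map property, unitality, equivariance and naturality
-/

noncomputable section

namespace IDGA

section

variable {s : ℕ}

theorem sgn_sum {ι : Type*} (S : Finset ι) (f : ι → ℤ) : sgn (∑ i ∈ S, f i) = ∏ i ∈ S, sgn (f i) := by
  classical
  induction S using Finset.induction_on with
  | empty => simp
  | insert a S ha ih => rw [Finset.prod_insert ha, Finset.sum_insert ha, sgn_add, ih]

/-- The signs of the symmetries of the tensor product and of the total complex. -/
theorem koszul_add (σ : Equiv.Perm (Fin s)) (q : Fin s → ℤ) (r : Fin s → ℕ) :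
    koszul σ (fun i => r i + q i) * sgn (totExp (fun i => q (σ.symm i)) fun i => r (σ.symm i)) =
      sgn (totExp q r) * (koszul σ (fun i => (r i : ℤ)) * koszul σ q) := by
  have h1 : totExp (fun i => q (σ.symm i)) (fun i => r (σ.symm i)) =
      ∑ i, ∑ j, if σ i < σ j then q i * (r j : ℤ) else 0 := by
    rw [totExp, ← Equiv.sum_comp σ]
    refine Finset.sum_congr rfl fun i _ => ?_
    rw [← Equiv.sum_comp σ]
    simp
  -- Reordering by `σ` removes from the exponent the pairs `i < j` inverted by `σ` and adds those
  -- inverted pairs with the roles of `q` and `r` exchanged.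
  have h2 : (∑ i, ∑ j, if σ i < σ j then q i * (r j : ℤ) else 0) +
      (∑ i, ∑ j, if i < j ∧ σ j < σ i then q i * (r j : ℤ) else 0) = totExp q r +
      ∑ i, ∑ j, if i < j ∧ σ j < σ i then (r i : ℤ) * q j else 0 := by
    rw [Finset.sum_comm (f := fun i j => if i < j ∧ σ j < σ i then (r i : ℤ) * q j else 0), totExp]
    simp only [← Finset.sum_add_distrib]
    refine Finset.sum_congr rfl fun i _ => Finset.sum_congr rfl fun j _ => ?_
    rcases lt_trichotomy i j with h | rfl | h
    · rcases lt_or_gt_of_ne fun h' => h.ne (σ.injective h') with h' | h' <;>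
        simp [h, h', h.not_gt, h'.not_gt]
    · simp
    · rcases lt_or_gt_of_ne fun h' => h.ne (σ.injective h') with h' | h' <;>
        simp [h, h', h.not_gt, h'.not_gt, mul_comm]
  have h3 : (∑ i, ∑ j, if i < j ∧ σ j < σ i then ((r i : ℤ) + q i) * (r j + q j) else 0) =
      (∑ i, ∑ j, if i < j ∧ σ j < σ i then (r i : ℤ) * r j else 0) +
      (∑ i, ∑ j, if i < j ∧ σ j < σ i then q i * q j else 0) +
      (∑ i, ∑ j, if i < j ∧ σ j < σ i then q i * (r j : ℤ) else 0) +
      ∑ i, ∑ j, if i < j ∧ σ j < σ i then (r i : ℤ) * q j else 0 := by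
    simp only [← Finset.sum_add_distrib]
    refine Finset.sum_congr rfl fun i _ => Finset.sum_congr rfl fun j _ => ?_
    split_ifs <;> ring
  unfold koszul
  rw [← sgn_add, ← sgn_add, ← sgn_add, h1, h3]
  refine sgn_congr ⟨∑ i, ∑ j, if i < j ∧ σ j < σ i then (r i : ℤ) * q j else 0, ?_⟩
  linear_combination h2

/-- The signs of the total complex in nested tensor products. -/
theorem totExp_nested {j : Fin s → ℕ} (q : Fin (∑ i, j i) → ℤ) (r : Fin (∑ i, j i) → ℕ)
    (A : Fin s → ℕ) :
    (∑ i, totExp (fun t => q (finSigmaFinEquiv ⟨i, t⟩)) fun t => r (finSigmaFinEquiv ⟨i, t⟩)) +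
      totExp (fun i => ∑ t, q (finSigmaFinEquiv ⟨i, t⟩))
        (fun i => A i + ∑ t, r (finSigmaFinEquiv ⟨i, t⟩)) =
    (∑ i, (A i : ℤ) * ∑ i' ∈ Finset.Iio i, ∑ t, q (finSigmaFinEquiv ⟨i', t⟩)) + totExp q r := by
  -- Pairs of variables are split into those in different blocks and those in the same block.
  have h1 : totExp q r = (∑ i, ∑ i', if i < i' then (∑ t, q (finSigmaFinEquiv ⟨i, t⟩)) *
      ∑ t, (r (finSigmaFinEquiv ⟨i', t⟩) : ℤ) else 0) +
      ∑ i, totExp (fun t => q (finSigmaFinEquiv ⟨i, t⟩)) fun t => r (finSigmaFinEquiv ⟨i, t⟩) := by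
    rw [totExp, sum_finSigma, ← Finset.sum_add_distrib]
    refine Finset.sum_congr rfl fun i _ => ?_
    have h : ∀ t i', (∑ t', if finSigmaFinEquiv (⟨i, t⟩ : (i : Fin s) × Fin (j i)) <
        finSigmaFinEquiv ⟨i', t'⟩ then
          q (finSigmaFinEquiv ⟨i, t⟩) * (r (finSigmaFinEquiv ⟨i', t'⟩) : ℤ) else 0) =
        (if i < i' then q (finSigmaFinEquiv ⟨i, t⟩) * ∑ t', (r (finSigmaFinEquiv ⟨i', t'⟩) : ℤ)
          else 0) + if i' = i then ∑ t', (if t < t' then q (finSigmaFinEquiv ⟨i, t⟩) *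
            (r (finSigmaFinEquiv ⟨i, t'⟩) : ℤ) else 0) else 0 := by
      intro t i'
      simp only [finSigma_lt_iff]
      rcases lt_trichotomy i i' with h | rfl | h
      · simp [h, h.ne', Finset.mul_sum]
      · simp
      · simp [h.not_gt, h.ne, h.ne']
    simp only [sum_finSigma (fun u => if _ < u then _ else _), h, Finset.sum_add_distrib,
      Finset.sum_ite_eq', Finset.mem_univ, if_true]
    refine congrArg₂ (· + ·) ?_ rfl
    rw [Finset.sum_comm]
    refine Finset.sum_congr rfl fun i' _ => ?_
    split_ifs
    · rw [Finset.sum_mul]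
    · simp
  have h2 : (∑ i, (A i : ℤ) * ∑ i' ∈ Finset.Iio i, ∑ t, q (finSigmaFinEquiv ⟨i', t⟩)) =
      ∑ i, ∑ i', if i < i' then (∑ t, q (finSigmaFinEquiv ⟨i, t⟩)) * (A i' : ℤ) else 0 := by
    rw [Finset.sum_comm]
    refine Finset.sum_congr rfl fun i _ => ?_
    rw [sum_Iio, Finset.mul_sum]
    refine Finset.sum_congr rfl fun i' _ => ?_
    split_ifs <;> ring
  have h3 : totExp (fun i => ∑ t, q (finSigmaFinEquiv ⟨i, t⟩))
        (fun i => A i + ∑ t, r (finSigmaFinEquiv ⟨i, t⟩)) =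
      (∑ i, ∑ i', if i < i' then (∑ t, q (finSigmaFinEquiv ⟨i, t⟩)) * (A i' : ℤ) else 0) +
      ∑ i, ∑ i', if i < i' then (∑ t, q (finSigmaFinEquiv ⟨i, t⟩)) *
        ∑ t, (r (finSigmaFinEquiv ⟨i', t⟩) : ℤ) else 0 := by
    rw [totExp]
    simp only [← Finset.sum_add_distrib]
    refine Finset.sum_congr rfl fun i _ => Finset.sum_congr rfl fun i' _ => ?_
    push_cast
    split_ifs <;> ring
  rw [h1, h2, h3]
  ring

end

section

variable {k : Type u} [CommRing k] {E : CommIDGA.{u, v} k} {s : ℕ}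

theorem hEl_span_top {P : ICat ⥤ Ch.{u, v} k} (y : Gr (hocolim.obj P)) :
    y ∈ Submodule.span k {y | ∃ n, y ∈ hGens P n} := by
  induction y using DirectSum.induction_on with
  | zero => exact Submodule.zero_mem _
  | add x y hx hy => exact Submodule.add_mem _ hx hy
  | of n y =>
    have h : hGens P n ⊆ {y | ∃ n, y ∈ hGens P n} := fun z hz => ⟨n, hz⟩
    exact Submodule.span_mono h (hEl_span n y)

theorem hocolimAction_chain (s : ℕ) : IsChainMap (X := fun _ => hocolim.obj E.toFunctor)
    (hocolimAction E s) := by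
  refine isChainMap_of_span (beGens k s) (fun i => hGens E.toFunctor) (fun n => beEl_span k n)
    (fun i n => hEl_span n) ?_ ?_
  · rintro _ _ ⟨c, rfl, rfl⟩ p x hx
    choose y q hp hy hyx using hx
    obtain rfl : p = fun i => ((y i).1 + q i : ℤ) := funext fun i => (hp i).symm
    obtain rfl : x = fun i => hEl _ (y i) := funext fun i => (hyx i).symm
    exact hocolimAction_mem_range q c y hy
  · rintro _ _ ⟨c, rfl, rfl⟩ p x hx
    choose y q hp hy hyx using hx
    obtain rfl : p = fun i => ((y i).1 + q i : ℤ) := funext fun i => (hp i).symm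
    obtain rfl : x = fun i => hEl _ (y i) := funext fun i => (hyx i).symm
    exact hocolimAction_d q c y hy

theorem hocolimAction_unit (x : Fin 1 → Gr (hocolim.obj E.toFunctor)) :
    hocolimAction E 1 (beEl k ⟨0, fun _ => 1⟩) x = x 0 := by
  refine IsMulti.eq_of_span (k := k) (M := fun _ : Fin 1 => Gr (hocolim.obj E.toFunctor))
    (f := fun x => hocolimAction E 1 (beEl k ⟨0, fun _ => 1⟩) x)
    (g := fun x => x 0) (MultilinearMap.isMulti _)
    (fun x i => by
      obtain rfl := Subsingleton.elim i 0
      exact ⟨LinearMap.id, fun a => by simp⟩) (fun _ => {y | ∃ n, y ∈ hGens E.toFunctor n})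
    (fun x hx => ?_) x fun i => hEl_span_top (x i)
  choose p y q _ hy hyx using hx
  obtain rfl : x = fun i => hEl _ (y i) := funext fun i => (hyx i).symm
  rw [hocolimAction_eq_shSum E q _ y hy (N := (y 0).1) (by simp),
    shSum_of_left_eq_zero (C := beS 1) (S := fun i => HR E.toFunctor) _ ⟨0, fun _ => 1⟩ rfl y]
  have h : totExp q (fun i => (y i).1) = 0 := by simp [totExp]
  rw [h, sgn_zero, one_smul]
  refine congrArg (fun z => hEl E.toFunctor ⟨(y 0).1, z⟩) ((actLevel_one q _ _).trans ?_)
  exact (HR E.toFunctor).degen_const (1 : Fin 2) (y 0)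

/-- The permutation of shuffles contributes the Koszul sign of the simplicial degrees, that of
coefficients the Koszul sign of the `q i`. By `koszul_add` these, together with the signs of the
total complex, give the Koszul sign of the total degrees. -/
theorem hocolimAction_equivariant_hEl (σ : Equiv.Perm (Fin s)) (q : Fin s → ℤ)
    (c : (p : ℕ) × (beS s).X p) (y : Fin s → (r : ℕ) × (HR E.toFunctor).X r)
    (hy : ∀ i, (y i).2.2 ∈ LinearMap.range (Gr.ι _ (q i))) :
    hocolimAction E s (Gr.map (beAct k s σ) (beEl k c)) (fun i => hEl E.toFunctor (y i)) =
      koszul σ (fun i => (y i).1 + q i) •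
        hocolimAction E s (beEl k c) fun i => hEl E.toFunctor (y (σ.symm i)) := by
  have hN : c.1 + ∑ i, (y i).1 = c.1 + ∑ i, (y (σ.symm i)).1 := by
    rw [Equiv.sum_comp σ.symm fun i => (y i).1]
  rw [map_beAct_beEl k σ c.1 c.2, hocolimAction_eq_shSum E q _ y hy rfl,
    hocolimAction_eq_shSum E (fun i => q (σ.symm i)) c (fun i => y (σ.symm i))
      (fun i => hy (σ.symm i)) hN, smul_smul, koszul_add]
  have key := shSum_perm (C := beS s) (S := fun _ => HR E.toFunctor) σ
    (fun N c y => hEl E.toFunctor ⟨N, actLevel E q N (fun t => c t * σ) y⟩)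
    (fun N c y => koszul σ q • hEl E.toFunctor ⟨N, actLevel E (fun i => q (σ.symm i)) N c y⟩)
    (fun N c y => actLevel_mul σ q N c y) (c.1 + ∑ i, (y i).1) c y
  rw [mul_smul, mul_smul]
  refine congrArg _ (Eq.trans key (congrArg _ ?_))
  exact (map_shSum (M := Gr (hocolim.obj E.toFunctor)) (zsmulAddGroupHom (koszul σ q)) _ _ _ _).symm

theorem hocolimAction_equivariant (σ : Equiv.Perm (Fin s)) (c : Gr (beObj k s)) (q : Fin s → ℤ)
    (x : ∀ i, (hocolim.obj E.toFunctor).X (q i)) :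
    hocolimAction E s (Gr.map (beAct k s σ) c) (fun i => Gr.ι _ (q i) (x i)) =
      koszul σ q • hocolimAction E s c fun i => Gr.ι _ (q (σ.symm i)) (x (σ.symm i)) := by
  refine eq_of_span (k := k) (C := Gr (beObj k s)) (f := fun c =>
      hocolimAction E s (Gr.map (beAct k s σ) c) fun i => Gr.ι _ (q i) (x i))
    (g := fun c => koszul σ q • hocolimAction E s c fun i => Gr.ι _ (q (σ.symm i)) (x (σ.symm i)))
    ⟨by simp, by simp⟩ ⟨by simp, by simp [smul_comm (koszul σ q)]⟩ ?_ (beEl_span_top k c)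
  rintro _ ⟨c, rfl⟩
  refine IsMulti.eq_of_span (k := k) (M := fun _ : Fin s => Gr (hocolim.obj E.toFunctor))
    (f := fun x => hocolimAction E s (Gr.map (beAct k s σ) (beEl k c)) x)
    (g := fun x => koszul σ q • hocolimAction E s (beEl k c) fun i => x (σ.symm i))
    (MultilinearMap.isMulti _)
    ((IsMulti.perm (B := fun _ => Gr (hocolim.obj E.toFunctor)) σ _).zsmul _)
    (fun i => hGens E.toFunctor (q i)) ?_ _ fun i => hEl_span (q i) (x i)
  clear x
  intro x hx
  choose y q' hp hy hyx using hx
  obtain rfl : q = fun i => ((y i).1 + q' i : ℤ) := funext fun i => (hp i).symm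
  obtain rfl : x = fun i => hEl _ (y i) := funext fun i => (hyx i).symm
  exact hocolimAction_equivariant_hEl σ q' c y hy

/-- Indices, shuffles and signs are unaffected by `f`; on coefficients, `f` commutes with structure
morphisms by naturality and with products by `Hom.map_prod`. -/
theorem hocolimAction_natural {F : CommIDGA.{u, v} k} (f : CommIDGA.Hom E F) (c : Gr (beObj k s))
    (x : Fin s → Gr (hocolim.obj E.toFunctor)) :
    Gr.map (hocolim.map f.toNatTrans) (hocolimAction E s c x) =
      hocolimAction F s c fun i => Gr.map (hocolim.map f.toNatTrans) (x i) := by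
  refine eq_of_span (k := k) (C := Gr (beObj k s)) (f := fun c =>
      Gr.map (hocolim.map f.toNatTrans) (hocolimAction E s c x))
    (g := fun c => hocolimAction F s c fun i => Gr.map (hocolim.map f.toNatTrans) (x i))
    ⟨by simp, by simp⟩ ⟨by simp, by simp⟩ ?_ (beEl_span_top k c)
  rintro _ ⟨c, rfl⟩
  refine IsMulti.eq_of_span (k := k) (M := fun _ : Fin s => Gr (hocolim.obj E.toFunctor))
    (f := fun x => Gr.map (hocolim.map f.toNatTrans) (hocolimAction E s (beEl k c) x))
    (g := fun x => hocolimAction F s (beEl k c) fun i => Gr.map (hocolim.map f.toNatTrans) (x i))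
    ((MultilinearMap.isMulti _).linear_comp _) (IsMulti.multilinear_comp _ fun _ => Gr.map _)
    (fun _ => {y | ∃ n, y ∈ hGens E.toFunctor n}) (fun x hx => ?_) x fun i => hEl_span_top (x i)
  choose p y q _ hy hyx using hx
  obtain rfl : x = fun i => hEl _ (y i) := funext fun i => (hyx i).symm
  let y' : Fin s → (r : ℕ) × (HR F.toFunctor).X r := fun i =>
    ⟨(y i).1, (y i).2.1, Gr.map (f.toNatTrans.app (y i).2.1.last) (y i).2.2⟩
  have h : (fun i => Gr.map (hocolim.map f.toNatTrans) (hEl E.toFunctor (y i))) =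
      fun i => hEl F.toFunctor (y' i) := funext fun i => map_hEl f.toNatTrans _ _
  dsimp only
  rw [h, hocolimAction_eq_shSum E q c y hy rfl, hocolimAction_eq_shSum F q c y'
    (fun i => Gr.map_mem_range _ (hy i)) rfl, map_zsmul, map_shSum]
  refine congrArg _ (Finset.sum_congr rfl fun w _ => congrArg _ ?_)
  refine (map_hEl_actLevel f q _ _ _).trans ?_
  refine congrArg (fun y => hEl F.toFunctor ⟨_, actLevel F q _ _ y⟩) (funext fun i => ?_)
  refine Sigma.ext rfl (heq_of_eq ?_)
  refine (Gr.map_map _ _ _).trans (Eq.trans ?_ (Gr.map_map _ _ _).symm)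
  exact congrArg (fun g => Gr.map g (y i).2.2) (f.toNatTrans.naturality _)

end

end IDGA

end

/-! ### Associativity of the action -/

noncomputable section

namespace IDGA

section

variable {k : Type u} [CommRing k] {E : CommIDGA.{u, v} k} {s : ℕ}

/-- The simplices of the simplicial replacement of `P` with coefficients of degree `q`. -/
abbrev HQ (P : ICat ⥤ Ch.{u, v} k) (q : ℤ) : SSimp.{v} where
  X N := {y : (HR P).X N // y.2 ∈ LinearMap.range (Gr.ι _ q)}
  pull g y := ⟨(HR P).pull g y.1, HR.pull_mem_range g y.2⟩
  pull_id y := Subtype.ext ((HR P).pull_id y.1)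
  pull_pull f g y := Subtype.ext ((HR P).pull_pull f g y.1)

/-- The underlying simplex. -/
def HQ.val {P : ICat ⥤ Ch.{u, v} k} {q : ℤ} (y : (r : ℕ) × (HQ P q).X r) : (r : ℕ) × (HR P).X r :=
  ⟨y.1, y.2.1⟩

variable (E) in
/-- The action on simplices with coefficients of fixed degrees. -/
def actHQ (q : Fin s → ℤ) (N : ℕ) (c : (beS s).X N) (y : ∀ i, (HQ E.toFunctor (q i)).X N) :
    (HQ E.toFunctor (∑ i, q i)).X N :=
  ⟨actLevel E q N c fun i => (y i).1, actLevel_mem_range c fun i => (y i).2⟩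

/-- `shSum_assoc` requires an operation that commutes with simplicial operators on all simplices.
For `actLevel` this is established only for coefficients of the prescribed degrees, so the action is
rewritten in terms of the simplicial sets `HQ` of such simplices. -/
theorem hocolimAction_eq_shSum_HQ (q : Fin s → ℤ) (c : (p : ℕ) × (beS s).X p)
    (y : ∀ i, (r : ℕ) × (HQ E.toFunctor (q i)).X r) {N : ℕ} (hN : N = c.1 + ∑ i, (y i).1) :
    hocolimAction E s (beEl k c) (fun i => hEl E.toFunctor (HQ.val (y i))) =
      sgn (totExp q fun i => (y i).1) • shSum (C := beS s) (S := fun i => HQ E.toFunctor (q i))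
        (fun N c y => hEl E.toFunctor (HQ.val ⟨N, actHQ E q N c y⟩)) N c y :=
  hocolimAction_eq_shSum E q c (fun i => HQ.val (y i)) (fun i => (y i).2.2) hN

/-- The shuffles produce the part of the sign that involves the simplicial degrees of the `y t`; the
part involving the degrees of coefficients comes from the signs of the total complex. -/
theorem hocolimAction_assoc_hEl (j : Fin s → ℕ) (q : Fin (∑ i, j i) → ℤ) (c : (p : ℕ) × (beS s).X p)
    (a : ∀ i, (p : ℕ) × (beS (j i)).X p) (y : ∀ t, (r : ℕ) × (HQ E.toFunctor (q t)).X r) :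
    (hocolimAction E s (beEl k c) fun i => hocolimAction E (j i) (beEl k (a i)) fun t =>
      hEl E.toFunctor (HQ.val (y (finSigmaFinEquiv ⟨i, t⟩)))) =
    sgn (∑ i, ((a i).1 : ℤ) * ∑ i' ∈ Finset.Iio i, ∑ t, ((y (finSigmaFinEquiv ⟨i', t⟩)).1 +
        q (finSigmaFinEquiv ⟨i', t⟩))) •
      hocolimAction E (∑ i, j i) (beComp k j (beEl k c) fun i => beEl k (a i))
        fun t => hEl E.toFunctor (HQ.val (y t)) := by
  let R : Fin s → ℕ := fun i => (a i).1 + ∑ t, (y (finSigmaFinEquiv ⟨i, t⟩)).1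
  let P : ℕ := c.1 + ∑ i, (a i).1
  let Q : Fin s → ℤ := fun i => ∑ t, q (finSigmaFinEquiv ⟨i, t⟩)
  have hN : P + ∑ t, (y t).1 = c.1 + ∑ i, R i := by
    simp only [R, P, Finset.sum_add_distrib, ← sum_finSigma fun t => (y t).1]
    omega
  have h1 : (fun i => hocolimAction E (j i) (beEl k (a i))
      (fun t => hEl E.toFunctor (HQ.val (y (finSigmaFinEquiv ⟨i, t⟩))))) = _ := funext fun i =>
    hocolimAction_eq_shSum_HQ (fun t => q (finSigmaFinEquiv ⟨i, t⟩)) (a i)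
      (fun t => y (finSigmaFinEquiv ⟨i, t⟩)) (N := R i) rfl
  have key := shSum_assoc (C := beS s) (A := fun i => beS (j i)) (D := beS (∑ i, j i))
    (X := fun t => HQ E.toFunctor (q t)) (Y := fun i => HQ E.toFunctor (Q i))
    (fun i => actHQ E fun t => q (finSigmaFinEquiv ⟨i, t⟩))
    (fun i _ _ g a x => Subtype.ext (pull_actLevel g a fun t => (x t).2))
    (beLevel j) (fun _ _ _ => rfl)
    (fun N c y => hEl E.toFunctor (HQ.val ⟨N, actHQ E Q N c y⟩))
    (fun N c y => hEl E.toFunctor (HQ.val ⟨N, actHQ E q N c y⟩))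
    (fun N c a x => congrArg (fun y => hEl E.toFunctor ⟨N, y⟩)
      (actLevel_assoc q N c a fun t => (x t).1))
    c a y (R := R) (fun _ => rfl) (P := P) rfl (P + ∑ t, (y t).1)
  -- The signs of the inner and outer actions, compared with the sign of the single action on all
  -- variables.
  have hs := congrArg sgn (totExp_nested q (fun t => (y t).1) fun i => (a i).1)
  rw [sgn_add, sgn_sum, sgn_add] at hs
  have hL : ∀ w : ∀ i, Fin (R i) → Fin (j i + 1),
      (hocolimAction E s (beEl k c) fun i => hEl E.toFunctor (HQ.val ⟨R i,
        actHQ E (fun t => q (finSigmaFinEquiv ⟨i, t⟩)) (R i) ((beS (j i)).degen (w i) 0 (a i))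
          fun t => (HQ E.toFunctor (q (finSigmaFinEquiv ⟨i, t⟩))).degen (w i) t.succ
            (y (finSigmaFinEquiv ⟨i, t⟩))⟩)) = _ := fun w =>
    hocolimAction_eq_shSum_HQ Q c (fun i => ⟨R i,
        actHQ E (fun t => q (finSigmaFinEquiv ⟨i, t⟩)) (R i) ((beS (j i)).degen (w i) 0 (a i))
          fun t => (HQ E.toFunctor (q (finSigmaFinEquiv ⟨i, t⟩))).degen (w i) t.succ
            (y (finSigmaFinEquiv ⟨i, t⟩))⟩) (N := P + ∑ t, (y t).1) hN
  have hA := (MultilinearMap.map_sum_zsmul (hocolimAction E s (beEl k c))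
    (fun i => words (R i) (Fin.cons (a i).1 (fun t => (y (finSigmaFinEquiv ⟨i, t⟩)).1) :
      Fin (j i + 1) → ℕ)) (fun i w => wsign (· < ·) w) fun i w => hEl E.toFunctor (HQ.val ⟨R i,
        actHQ E (fun t => q (finSigmaFinEquiv ⟨i, t⟩)) (R i) ((beS (j i)).degen w 0 (a i))
          fun t => (HQ E.toFunctor (q (finSigmaFinEquiv ⟨i, t⟩))).degen w t.succ
            (y (finSigmaFinEquiv ⟨i, t⟩))⟩)).trans
    (Finset.sum_congr rfl fun w _ => congrArg _ (hL w))
  have hB := (sum_zsmul_apply (hocolimAction E (∑ i, j i)) (words P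
      (Fin.cons c.1 (fun i => (a i).1) : Fin (s + 1) → ℕ)) (fun u => wsign (· < ·) u)
      (fun u => beEl k ⟨P, beLevel j P ((beS s).degen u 0 c)
        fun i => (beS (j i)).degen u i.succ (a i)⟩) fun t => hEl E.toFunctor (HQ.val (y t))).trans
    (Finset.sum_congr rfl fun u _ => congrArg _ (hocolimAction_eq_shSum_HQ q _ y rfl))
  -- The signs of the total complex do not depend on the shuffle, since all simplices in a shuffle
  -- sum have the same dimension; they can be taken out of the sums.
  simp only [smul_comm _ (sgn _)] at hA hB
  rw [← Finset.smul_sum] at hA hB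
  rw [h1, MultilinearMap.map_zsmul_univ, beComp_eq_shSum k j c a (N := P) rfl]
  refine (congrArg _ (hA.trans (congrArg _ key))).trans (Eq.trans ?_ (congrArg _ hB).symm)
  rw [smul_smul, smul_smul, smul_smul]
  refine congrArg (· • _) ?_
  simp only [Finset.sum_add_distrib, mul_add]
  rw [sgn_add, mul_assoc (sgn _), ← hs]
  exact mul_comm (_ : ℤ) _

theorem hocolimAction_assoc (j : Fin s → ℕ) (p₀ : ℤ) (c : (beObj k s).X p₀) (p : Fin s → ℤ)
    (a : ∀ i, (beObj k (j i)).X (p i)) (q : Fin (∑ i, j i) → ℤ)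
    (x : ∀ t, (hocolim.obj E.toFunctor).X (q t)) :
    (hocolimAction E s (Gr.ι _ p₀ c) fun i => hocolimAction E (j i) (Gr.ι _ (p i) (a i)) fun t =>
      Gr.ι (hocolim.obj E.toFunctor) (q (finSigmaFinEquiv ⟨i, t⟩)) (x (finSigmaFinEquiv ⟨i, t⟩))) =
    sgn (∑ i, p i * ∑ i' ∈ Finset.Iio i, ∑ t, q (finSigmaFinEquiv ⟨i', t⟩)) •
      hocolimAction E _ (beComp k j (Gr.ι _ p₀ c) fun i => Gr.ι _ (p i) (a i))
        fun t => Gr.ι (hocolim.obj E.toFunctor) (q t) (x t) := by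
  refine nested_eq_of_span (k := k) (C := Gr (beObj k s)) (A := fun i => Gr (beObj k (j i)))
    (X := fun _ => Gr (hocolim.obj E.toFunctor))
    (hocolimAction E s) (fun i => hocolimAction E (j i)) (beComp k j) (hocolimAction E _) _
    (beGens k s p₀) (fun i => beGens k (j i) (p i)) (fun t => hGens E.toFunctor (q t)) ?_ _
    (beEl_span k p₀ c) _ (fun i => beEl_span k (p i) (a i)) _ fun t => hEl_span (q t) (x t)
  clear a c x
  rintro _ ⟨c, rfl, rfl⟩ b hb x hx
  choose a ha hab using hb
  choose y q' hq hy hyx using hx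
  obtain rfl : p = fun i => ((a i).1 : ℤ) := funext fun i => (ha i).symm
  obtain rfl : b = fun i => beEl k (a i) := funext fun i => (hab i).symm
  obtain rfl : q = fun t => ((y t).1 + q' t : ℤ) := funext fun t => (hq t).symm
  obtain rfl : x = fun t => hEl _ (y t) := funext fun t => (hyx t).symm
  exact hocolimAction_assoc_hEl j q' c a fun t => ⟨(y t).1, (y t).2, hy t⟩

/-- The Barratt--Eccles operad acts on the homotopy colimit of a commutative `𝓘`-dga. -/
theorem hocolimAction_isAction (E : CommIDGA.{u, v} k) :
    (barrattEccles k).IsAction (hocolim.obj E.toFunctor) (hocolimAction E) where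
  chain s := hocolimAction_chain s
  unit x := hocolimAction_unit x
  assoc j p₀ c p a q x := hocolimAction_assoc j p₀ c p a q x
  equivariant σ c q x := hocolimAction_equivariant σ c q x

end

end IDGA

end

theorem mainTheorem6 (k : Type u) [CommRing k] :
    (IDGA.barrattEccles k).IsOperad ∧
    (∀ E : IDGA.CommIDGA.{u, v} k,
      (IDGA.barrattEccles k).IsAction (IDGA.hocolim.obj E.toFunctor) (IDGA.hocolimAction E)) ∧
    (∀ (E F : IDGA.CommIDGA.{u, v} k) (f : IDGA.CommIDGA.Hom E F) (s : ℕ)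
      (c : IDGA.Gr ((IDGA.barrattEccles k).obj s))
      (x : Fin s → IDGA.Gr (IDGA.hocolim.obj E.toFunctor)),
      IDGA.Gr.map (IDGA.hocolim.map f.toNatTrans) (IDGA.hocolimAction E s c x) =
        IDGA.hocolimAction F s c fun i => IDGA.Gr.map (IDGA.hocolim.map f.toNatTrans) (x i)) := ⟨IDGA.barrattEccles_isOperad k, fun E => IDGA.hocolimAction_isAction E,
    fun _ _ f _ c x => IDGA.hocolimAction_natural f c x⟩
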